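/- Let $F$ be a non-archimedean local field of odd residue characteristic $p$, with ring of integers $O_F$, uniformizer $\varpi$, and residue field of cardinality $q$. Let $E, E'$ be étale quadratic $F$-algebras. If $E$ is a field, $O_E,\varpi_E,e_E,v_E$ have their usual meaning ($v_E(\varpi_E)=1$). If $E=F\times F$, put $O_E=O_F\times O_F$, $\varpi_E=(\varpi,\varpi)$, $e_E=1$, and write $v_E(u)=k$ for $u\in\varpi_E^kO_E^\times$. The level $c(\theta)$ of a character $\theta$ of $E^\times$ is the smallest $n\ge 0$ such that $\theta$ is trivial on $U_E(n)$, where $U_E(0)=O_E^\times$ and $U_E(n)=1+\varpi_E^nO_E$ for $n>0$; similarly for characters of $F^\times$. Let $\psi$ be an additive character of $F$ that is trivial on $O_F$ but not on $\varpi^{-1}O_F$. Put $\psi_E=\psi\circ\mathrm{Tr}_{E/F}$ and $\chi_E=\chi\circ N_{E/F}$ for a character $\chi$ of $F^\times$. Let $\theta_1,\theta_2$ be continuous characters of $E^\times$, $E'^\times$ that are trivial on $F^\times$, and assume that each of them differs from its Galois conjugate if it lives on a field (so that the associated representation $\pi_i=\pi_{\theta_i}$ of $\mathrm{GL}_2(F)$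 is supercuspidal when the algebra is a field; it is a principal series representation when the algebra is split). Put $c(\pi_\theta)=\frac{2c(\theta)}{e_E}+e_E-1$, assume that $c(\pi_1)=c(\pi_2)=c\ge 2$, and let $c(\pi_1\times\pi_2)$ be the exponent of the Rankin--Selberg conductor, that is, $c(\pi_1\times\pi_2)=c(\pi_{\theta_1\theta_2})+c(\pi_{\theta_1\theta_2^{-1}})$ if $E\cong E'$ (and the two are identified), and $c(\pi_1\times\pi_2)=2c$ if $E\not\cong E'$. With Haar measures $d^\times u$, $d^\times w$ on $E^\times$, $E'^\times$, denote for integers $c/2\le i\le c$ $$P_i(\theta_1,\theta_2)=\sum_{c(\chi)=c-i}\ \int_{v_E(u)=-c(\theta_1)-e_E+1}\theta_1^{-1}(u)\chi_E(u)\psi_E(u)\,d^\times u\ \overline{\int_{v_{E'}(w)=-c(\theta_2)-e_{E'}+1}\theta_2^{-1}(w)\chi_{E'}(w)\psi_{E'}(w)\,d^\times w},$$ where $\chi$ runs over the characters of $F^\times$ with $\chi(\varpi)=1$ and $c(\chi)=c-i$, and $$P_i^\circ(\theta_1,\theta_2)=\frac{P_i(\theta_1,\theta_2)}{\sharp\{\chi: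 c(\chi)=c-i\}\ \int_{v_E(u)=-c(\theta_1)-e_E+1}\theta_1^{-1}(u)\psi_E(u)\,d^\times u\ \overline{\int_{v_{E'}(w)=-c(\theta_2)-e_{E'}+1}\theta_2^{-1}(w)\psi_{E'}(w)\,d^\times w}}.$$ The denominator is nonzero, and if $i\ge c/2>1$, then $$\begin{cases} P_i^\circ(\theta_1,\theta_2)=1, &\text{if } i\ge c(\pi_1\times\pi_2)/2,\text{ except when } i=c/2 \text{ and } \pi_1,\pi_2 \text{ are principal series;}\\ P_i^\circ(\theta_1,\theta_2)=\frac{q-3}{q-1}, &\text{if } i=c(\pi_1\times\pi_2)/2=c/2 \text{ and } \pi_1,\pi_2 \text{ are principal series;}\\ P_i^\circ(\theta_1,\theta_2)=-\frac{1}{q-1}, &\text{if } i=c(\pi_1\times\pi_2)/2-1>c/2 \text{ and } i<c-1;\\ P_i^\circ(\theta_1,\theta_2)=-\frac{1}{q-2}, &\text{if } i=c(\pi_1\times\pi_2)/2-1>c/2 \text{ and } i=c-1;\\ |P_i^\circ(\theta_1,\theta_2)|\le\frac{2}{q-1}, &\text{if } i=c(\pi_1\times\pi_2)/2-1=c/2;\\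 P_i^\circ(\theta_1,\theta_2)=0, &\text{otherwise.} \end{cases}$$ If $c=2$, then $P_i^\circ(\theta_1,\theta_2)=1$ if $i\ge c(\pi_1\times\pi_2)/2$, except when $i=1$ and $\pi_1,\pi_2$ are principal series; and $$P_1^\circ(\theta_1,\theta_2)=\frac{q-3}{q-1}-\frac{2}{q(q-1)(q-2)}$$ if $c(\pi_1\times\pi_2)=2$ and $\pi_1,\pi_2$ are principal series. If $c=2$, $c(\pi_1\times\pi_2)=4$ and $i=1$, then $P_1^\circ(\theta_1,\theta_2)\ll\frac1q$ with an absolute implied constant. -/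

import Mathlib

open ValuativeRel

/- Throughout, `F` is a nonarchimedean local field and `E` is a finite étale `F`-algebra, in the
applications `F` itself or a quadratic one: a quadratic field extension of `F`, or `E ≅ F × F`. -/

namespace GaussRel

section Algebra

variable (F : Type*) [Field F] [ValuativeRel F] [TopologicalSpace F] [IsNonarchimedeanLocalField F]
variable (E : Type*) [CommRing E] [Algebra F E]

/-- `O_E`, the integral closure of `O_F` in `E`: the ring of integers when `E` is a field, and
`O_F × O_F` when `E = F × F`. -/
noncomputable abbrev ringOfInt : Subalgebra 𝒪[F] E := integralClosure 𝒪[F] E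

/-- The Jacobson radical of `O_E`. It is the ideal `ϖ_E O_E`, where `ϖ_E` is a uniformizer when `E`
is a field, and `ϖ_E = (ϖ, ϖ)` when `E = F × F`. -/
noncomputable def rad : Ideal (ringOfInt F E) := Ideal.jacobson ⊥

/-- The index `e_E`, the largest `n` with `ϖ O_E ⊆ ϖ_E ^ n O_E`: the ramification index when `E` is
a field, and `1` when `E = F × F`. -/
noncomputable def ramIdx : ℕ :=
  sSup {n : ℕ | ∀ x ∈ 𝓂[F], algebraMap 𝒪[F] (ringOfInt F E) x ∈ rad F E ^ n}

/-- The group `O_E^×` inside `E^×`. -/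
noncomputable def intUnits : Subgroup Eˣ := (Units.map (ringOfInt F E).val.toMonoidHom).range

/-- `U_E(n)`: the group `O_E^×` for `n = 0`, and `1 + ϖ_E ^ n O_E` for `n > 0`. -/
def unitFiltration (n : ℕ) : Set Eˣ :=
  {u | ∃ w : (ringOfInt F E)ˣ,
    Units.map (ringOfInt F E).val.toMonoidHom w = u ∧ (w : ringOfInt F E) - 1 ∈ rad F E ^ n}

/-- `ϖ_E ∈ E^×` is an element of `O_E` that generates the radical of `O_E`. -/
def IsUnif (ϖE : Eˣ) : Prop :=
  ∃ w : ringOfInt F E, (w : E) = ϖE ∧ rad F E = Ideal.span {w}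

/-- The set of all `u ∈ E^×` with `v_E(u) = k`, that is, `u ∈ ϖ_E ^ k O_E^×`. -/
def valSet (k : ℤ) : Set Eˣ :=
  {u | ∃ ϖE : Eˣ, IsUnif F E ϖE ∧ ∃ ε ∈ intUnits F E, u = ϖE ^ k * ε}

variable {E}

/-- The level `c(θ)` of a character `θ` of `E^×`: the smallest `n ≥ 0` with `θ = 1` on `U_E(n)`. -/
noncomputable def level (θ : Eˣ →* ℂˣ) : ℕ :=
  sInf {n : ℕ | ∀ u ∈ unitFiltration F E n, θ u = 1}

/-- `c(π_θ) = 2 c(θ) / e_E + e_E - 1`. -/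
noncomputable def condExp (θ : Eˣ →* ℂˣ) : ℕ := 2 * level F θ / ramIdx F E + ramIdx F E - 1

open Classical in
/-- The exponent `c(π₁ × π₂)` of the Rankin-Selberg conductor of `π_{θ₁}` and `π_{θ₂}`: it is
`c(π_{θ₁θ₂}) + c(π_{θ₁θ₂⁻¹})` if the two algebras are isomorphic (and identified; the value is the
same for the two possible identifications when `θ₂` is trivial on `F^×`), and
`2 max (c(π_{θ₁}), c(π_{θ₂}))` otherwise. -/
noncomputable def pairCondExp {E' : Type*} [CommRing E'] [Algebra F E']
    (θ₁ : Eˣ →* ℂˣ) (θ₂ : E'ˣ →* ℂˣ) : ℕ :=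
  if h : Nonempty (E ≃ₐ[F] E') then
    condExp F (θ₁ * θ₂.comp (Units.map (h.some : E →* E')))
      + condExp F (θ₁ * (θ₂.comp (Units.map (h.some : E →* E')))⁻¹)
  else 2 * max (condExp F θ₁) (condExp F θ₂)

variable {F}

/-- `c(ψ) = 0`: the additive character `ψ` is trivial on `O_F` but not on `ϖ⁻¹ O_F`. -/
def IsUnramified (ψ : AddChar F Circle) : Prop :=
  (∀ x : 𝒪[F], ψ x = 1) ∧ ∃ x : F, (∀ y ∈ 𝓂[F], (y : F) * x ∈ 𝒪[F]) ∧ ψ x ≠ 1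

/-- The (quasi-)characters `χ` of `F^×` with `χ(ϖ) = 1` and `c(χ) = n`. -/
def twists (ϖ : 𝒪[F]) (n : ℕ) : Set (Fˣ →* ℂˣ) :=
  {χ | Continuous χ ∧ (∀ u : Fˣ, (u : F) = ϖ → χ u = 1) ∧ level F χ = n}

variable [TopologicalSpace E] [MeasurableSpace Eˣ]

/-- The Gauss integral
`∫_{v_E(u) = -c(θ) - e_E + 1} θ⁻¹(u) χ(N_{E/F} u) ψ(Tr_{E/F} u) d^×u`, with `d^×u = μ`. -/
noncomputable def gaussInt (ψ : AddChar F Circle) (μ : MeasureTheory.Measure Eˣ)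
    (θ : Eˣ →* ℂˣ) (χ : Fˣ →* ℂˣ) : ℂ :=
  ∫ u in valSet F E (-(level F θ : ℤ) - ramIdx F E + 1),
    ((θ u)⁻¹ : ℂˣ) * (χ (Units.map (Algebra.norm F) u) : ℂ)
      * (ψ (Algebra.trace F E u) : ℂ) ∂μ

variable {E' : Type*} [CommRing E'] [Algebra F E'] [TopologicalSpace E'] [MeasurableSpace E'ˣ]

open ComplexConjugate

/-- The sum, over the twists `χ` with `c(χ) = n`, of the products of twisted Gauss integrals;
`P_i(θ₁, θ₂)` is the case `n = c - i`. -/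
noncomputable def gaussSum (ϖ : 𝒪[F]) (ψ : AddChar F Circle)
    (μ : MeasureTheory.Measure Eˣ) (μ' : MeasureTheory.Measure E'ˣ)
    (θ₁ : Eˣ →* ℂˣ) (θ₂ : E'ˣ →* ℂˣ) (n : ℕ) : ℂ :=
  ∑ᶠ χ ∈ twists ϖ n, gaussInt ψ μ θ₁ χ * conj (gaussInt ψ μ' θ₂ χ)

/-- The normalizing factor: the number of twists with `c(χ) = n`, times the product of the
untwisted Gauss integrals. -/
noncomputable def gaussNorm (ϖ : 𝒪[F]) (ψ : AddChar F Circle)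
    (μ : MeasureTheory.Measure Eˣ) (μ' : MeasureTheory.Measure E'ˣ)
    (θ₁ : Eˣ →* ℂˣ) (θ₂ : E'ˣ →* ℂˣ) (n : ℕ) : ℂ :=
  (twists ϖ n).ncard * (gaussInt ψ μ θ₁ 1 * conj (gaussInt ψ μ' θ₂ 1))

/-- The normalized correlation; `P_i°(θ₁, θ₂)` is the case `n = c - i`. -/
noncomputable def gaussCorr (ϖ : 𝒪[F]) (ψ : AddChar F Circle)
    (μ : MeasureTheory.Measure Eˣ) (μ' : MeasureTheory.Measure E'ˣ)
    (θ₁ : Eˣ →* ℂˣ) (θ₂ : E'ˣ →* ℂˣ) (n : ℕ) : ℂ :=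
  gaussSum ϖ ψ μ μ' θ₁ θ₂ n / gaussNorm ϖ ψ μ μ' θ₁ θ₂ n

end Algebra

section Parameter

variable (F : Type*) [Field F]
variable {E : Type*} [CommRing E] [Algebra F E] [TopologicalSpace E]

/-- `θ` is a character of `E^×`, trivial on `F^×`, to which a representation `π_θ` with trivial
central character is attached. When `E` is a field `π_θ` is supercuspidal, so that `θ` differs from
its Galois conjugate; the conjugate is `θ⁻¹`, as `θ` is trivial on norms. When `E = F × F`,
`θ = μ⁻¹ ⊗ μ` and `π_θ = π(μ⁻¹, μ)`. -/
structure IsParameter (θ : Eˣ →* ℂˣ) : Prop where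
  continuous : Continuous θ
  trivial_on_base : ∀ a : Fˣ, θ (Units.map (algebraMap F E).toMonoidHom a) = 1
  ne_conj : IsField E → θ ≠ θ⁻¹

end Parameter

end GaussRel

/-!
A quadratic étale algebra over `F` is `F[δ]` with `δ² = D`, where `D` is a unit of `O_F` (the
unramified field extension and `F × F`; `e = 1`) or a uniformizer (the ramified extensions; `e =
2`), and its ring of integers is `O_F[δ]` (`exists_algEquiv_quad`, `mem_ringOfInt_iff`). A character
`θ` trivial on `F^×` has a conductor `m` with respect to the orders `O_F + ϖ ^ j O_F[δ]`, and
`c(π_θ) = 2 m + e - 1` (`condExp_eq`). In particular `c` determines `e` and `m`, so `θ₁` and `θ₂`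
have the same conductor `m` and their algebras have the same `e`.

The Gauss integral of `θ` twisted by `χ` is, up to a nonzero constant, a Gauss sum over the units of
the finite ring `(O_F / ϖ ^ m)[δ]` (`exists_gaussInt_eq`). If the products of the two twisted sums
are added up over all `χ` of level at most `n`, orthogonality leaves the sum `T n` of `θ⁻¹(x) Φ(x)
θ'(y) Φ'(-y)` over the pairs of units with `N x ≡ N y` modulo `ϖ ^ n`, up to a unit factor in the
ramified case (`pairSum`, `exists_finsum_gaussInt_eq`). The normalized correlation is therefore a
combination of `T n` and `T (n - 1)`, divided by `T 0` (`corrOf`,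
`gaussNorm_ne_zero_and_gaussCorr_eq`), and `|T 0| = |O_F / ϖ ^ m| ^ 2` (`norm_pairSum_zero`).

*Isomorphic algebras.* The substitution `y = x z` gives `T n = ∑ θ'(z) W_η(1 - z)` over the `z` with
`N z ≡ 1` modulo `ϖ ^ n`, where `W_η` is the Gauss sum of `η = θ⁻¹ θ'` (`pairSum_eq_sum`). As `p` is
odd, one of `θ θ'` and `η` has conductor `m` unless `m = 1`, the algebra is split and both are
trivial on the units; then only the value `1` for `n = 0` is asserted. The correlation is the same
for `θ'` and `θ'⁻¹` (`pairSum_inv_right`). So let `θ θ'` have conductor `m` and `η` conductor `l`;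
then `c(π₁ × π₂) = 2 (m + l + e - 1)`. The Gauss sum `W_η` lives on `ϖ ^ (m - l)` times the units,
hence the condition on `N z` is void for `n ≤ m - l`, and `T n = T 0`
(`pairSum_eq_pairSum_zero_of_add_le`). For `n > m - l` the translations of `z` by `1 + ϖ ^ (m - 1) t
δ` multiply the summand by a nontrivial character of `t`, and `T n = 0` (`pairSum_eq_zero`). If `l =
0`, the Gauss sum of the trivial character gives `T n = T 0` for all `n < m`, and for `n = m` in the
ramified case (`pairSum_self_eq_pairSum_zero`, `pairSum_self_eq_pairSum_zero_of_dvd`). What remains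
is the unramified case with `n = m` and `l ≤ 1`. The elements of norm `1` are then written as `g /
star g`: for `l = 0` one has `T m = T 0` in the inert and `T m = (1 - 2 / q) T 0` in the split case
(`pairSum_self_last`, `card_units_sub_unitGauss_inert`, `card_units_sub_unitGauss_split`), and for
`l = 1` one has `|T m| = |T 0| / q` (`norm_pairSum_last`).

*Algebras that are not isomorphic.* Here `T n = 0` for `n ≥ 1`, apart from the unramified case with
`m = 1`. In the ramified case no units have the required norms modulo `ϖ`
(`pairSum_eq_zero_of_dvd`). In the unramified case with `m ≥ 2` averaging over scalars leaves only
pairs with `re x ≡ re y` modulo `ϖ`, and there are none (`pairSum_eq_zero_of_not_square`). For `m =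
1` the same averaging leaves the scalars, and `T 1 = q` (`pairSum_one_of_not_square`).
-/

namespace GaussRel

/-! ### Gauss sums over a finite commutative ring -/

section FiniteRing

variable {A : Type*} [CommRing A] [Fintype A] [DecidableEq A]

/-- The Gauss sum `W_η(y) = ∑ η(x) Φ(x y)`, over the units `x` of a finite ring. -/
noncomputable def unitGauss (η : Aˣ →* ℂˣ) (Φ : AddChar A ℂ) (y : A) : ℂ :=
  ∑ x : Aˣ, (η x : ℂ) * Φ (x * y)

lemma norm_char_eq_one {G : Type*} [Group G] [Finite G] (η : G →* ℂˣ) (x : G) :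
    ‖(η x : ℂ)‖ = 1 := by
  have h : (η x : ℂ) ^ Nat.card G = 1 := by
    rw [← Units.val_pow_eq_pow_val, ← map_pow, pow_card_eq_one', map_one, Units.val_one]
  exact Complex.norm_eq_one_of_pow_eq_one h Nat.card_pos.ne'

lemma conj_char {G : Type*} [Group G] [Finite G] (η : G →* ℂˣ) (x : G) :
    starRingEnd ℂ (η x : ℂ) = ((η x)⁻¹ : ℂˣ) := by
  rw [Units.val_inv_eq_inv_val, Complex.inv_def, Complex.normSq_eq_norm_sq, norm_char_eq_one]
  simp

omit [DecidableEq A] in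
lemma conj_addChar (Φ : AddChar A ℂ) (x : A) : starRingEnd ℂ (Φ x) = Φ (-x) :=
  (AddChar.map_neg_eq_conj Φ x).symm

lemma unitGauss_unit_mul (η : Aˣ →* ℂˣ) (Φ : AddChar A ℂ) (h : Aˣ) (y : A) :
    unitGauss η Φ (h * y) = ((η h)⁻¹ : ℂˣ) * unitGauss η Φ y := by
  rw [unitGauss, unitGauss, Finset.mul_sum]
  refine Fintype.sum_equiv (Equiv.mulLeft h) _ _ fun x => ?_
  simp only [Equiv.coe_mulLeft, map_mul, Units.val_mul]
  rw [mul_assoc, Units.inv_mul_cancel_left, mul_left_comm, ← mul_assoc]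

lemma norm_unitGauss_unit_mul (η : Aˣ →* ℂˣ) (Φ : AddChar A ℂ) (h : Aˣ) (y : A) :
    ‖unitGauss η Φ (h * y)‖ = ‖unitGauss η Φ y‖ := by
  rw [unitGauss_unit_mul, norm_mul, Units.val_inv_eq_inv_val, norm_inv, norm_char_eq_one]
  simp

/-- `W_η` vanishes at every `y` fixed by a unit on which `η` is nontrivial. -/
lemma unitGauss_eq_zero_of_fixed {η : Aˣ →* ℂˣ} (Φ : AddChar A ℂ) {h : Aˣ} {y : A}
    (hη : η h ≠ 1) (hy : ((h : A) - 1) * y = 0) : unitGauss η Φ y = 0 := by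
  have h1 : (h : A) * y = y := by linear_combination hy
  have h2 := unitGauss_unit_mul η Φ h y
  rw [h1] at h2
  by_contra h3
  apply hη
  rw [← inv_eq_one]
  ext
  rw [Units.val_one]
  exact (mul_eq_right₀ h3).mp h2.symm

/-- If `η` is trivial on `1 + c A`, then `W_η` is supported on the annihilator of `c`: the sum over
each coset of `1 + c A` is a sum of a nontrivial additive character. -/
lemma unitGauss_eq_zero_of_mul_ne_zero {η : Aˣ →* ℂˣ} {Φ : AddChar A ℂ} (hΦ : Φ.IsPrimitive)
    {c y : A} (hc : ∀ t : A, ∃ u : Aˣ, (u : A) = 1 + c * t ∧ η u = 1) (hy : c * y ≠ 0) :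
    unitGauss η Φ y = 0 := by
  choose u hu hηu using hc
  have h1 : ∀ t, unitGauss η Φ y = ∑ x : Aˣ, (η x : ℂ) * Φ (x * y) * Φ (t * (x * (c * y))) := by
    intro t
    have := unitGauss_unit_mul η Φ (u t) y
    rw [hηu, inv_one, Units.val_one, one_mul] at this
    rw [← this, unitGauss]
    refine Finset.sum_congr rfl fun x _ => ?_
    rw [hu, mul_assoc, ← AddChar.map_add_eq_mul]
    congr 2
    ring
  have h2 : (Fintype.card A : ℂ) * unitGauss η Φ y = 0 := by
    have : ∑ _t : A, unitGauss η Φ y = 0 := by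
      rw [Finset.sum_congr rfl fun t _ => h1 t, Finset.sum_comm]
      refine Finset.sum_eq_zero fun x _ => ?_
      rw [← Finset.mul_sum, AddChar.sum_mulShift _ hΦ, if_neg, Nat.cast_zero, mul_zero]
      simpa using hy
    simpa using this
  simpa using h2

/-- Parseval's identity for the function `a ↦ W_η(c a)`. -/
lemma norm_unitGauss_sq {η : Aˣ →* ℂˣ} {Φ : AddChar A ℂ} (hΦ : Φ.IsPrimitive) {c : A}
    (hc : ∀ y : A, ¬ IsUnit y → unitGauss η Φ (c * y) = 0)
    (hη : ∀ a : A, c * a = 0 → ∃ u : Aˣ, (u : A) = 1 + a ∧ η u = 1) :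
    ‖unitGauss η Φ c‖ ^ 2 = Fintype.card A * Fintype.card {a : A // c * a = 0} := by
  -- Only the units `y` contribute, and all of them equally.
  have e1 : ∑ y : A, unitGauss η Φ (c * y) * starRingEnd ℂ (unitGauss η Φ (c * y))
      = Fintype.card Aˣ * (‖unitGauss η Φ c‖ ^ 2 : ℝ) := by
    have : ∑ y : A, unitGauss η Φ (c * y) * starRingEnd ℂ (unitGauss η Φ (c * y))
        = ∑ u : Aˣ, unitGauss η Φ (c * u) * starRingEnd ℂ (unitGauss η Φ (c * u)) := by
      refine (Finset.sum_of_injOn (fun u : Aˣ => (u : A)) (fun _ _ _ _ h => Units.ext h)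
        (by simp) ?_ (by simp)).symm
      intro y _ hy
      rw [hc y, zero_mul]
      rintro ⟨u, rfl⟩
      exact hy ⟨u, by simp, rfl⟩
    rw [this]
    have h2 : ∀ u : Aˣ, unitGauss η Φ (c * u) * starRingEnd ℂ (unitGauss η Φ (c * u))
        = (‖unitGauss η Φ c‖ ^ 2 : ℝ) := by
      intro u
      rw [Complex.mul_conj, Complex.normSq_eq_norm_sq, mul_comm, norm_unitGauss_unit_mul]
    rw [Finset.sum_congr rfl fun u _ => h2 u]
    simp
  -- Expanding the squares, the sum over `y` leaves the pairs with `c (x - x') = 0`, on which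
  -- `η(x) = η(x')`.
  have e2 : ∑ y : A, unitGauss η Φ (c * y) * starRingEnd ℂ (unitGauss η Φ (c * y))
      = Fintype.card Aˣ * (Fintype.card A * Fintype.card {a : A // c * a = 0}) := by
    have h1 : ∀ y : A, unitGauss η Φ (c * y) * starRingEnd ℂ (unitGauss η Φ (c * y))
        = ∑ x : Aˣ, ∑ x' : Aˣ, (η x : ℂ) * ((η x')⁻¹ : ℂˣ) * Φ (y * (c * (x - x'))) := by
      intro y
      rw [unitGauss, map_sum, Finset.sum_mul_sum]
      refine Finset.sum_congr rfl fun x _ => Finset.sum_congr rfl fun x' _ => ?_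
      rw [map_mul (starRingEnd ℂ), conj_char, conj_addChar, mul_mul_mul_comm, ← AddChar.map_add_eq_mul]
      congr 2
      ring
    rw [Finset.sum_congr rfl fun y _ => h1 y, Finset.sum_comm]
    have h3 : ∀ x : Aˣ, ∑ y : A, ∑ x' : Aˣ,
        (η x : ℂ) * ((η x')⁻¹ : ℂˣ) * Φ (y * (c * (x - x')))
        = Fintype.card A * Fintype.card {a : A // c * a = 0} := by
      intro x
      rw [Finset.sum_comm]
      have h4 : ∀ x' : Aˣ, ∑ y : A, (η x : ℂ) * ((η x')⁻¹ : ℂˣ) * Φ (y * (c * (x - x')))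
          = if c * (x - x') = 0 then (Fintype.card A : ℂ) else 0 := by
        intro x'
        rw [← Finset.mul_sum, AddChar.sum_mulShift _ hΦ]
        split_ifs with h
        · obtain ⟨u, hu, hu1⟩ := hη ((x - x') * (x'⁻¹ : Aˣ)) (by rw [← mul_assoc, h, zero_mul])
          have : x = u * x' := by
            ext
            rw [Units.val_mul, hu, add_mul, mul_assoc, Units.inv_mul]
            ring
          rw [this, map_mul, hu1, one_mul, Units.mul_inv, one_mul]
        · simp
      rw [Finset.sum_congr rfl fun x' _ => h4 x', ← Finset.sum_filter, Finset.sum_const,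
        nsmul_eq_mul, mul_comm]
      congr 2
      rw [← Fintype.card_subtype]
      -- For fixed `x` these `x'` correspond to the annihilator of `c` by `x' ↦ x - x'`.
      refine Fintype.card_congr
        { toFun := fun x' => ⟨x - x'.1, x'.2⟩
          invFun := fun a => ⟨(hη (-(a.1 * (x⁻¹ : Aˣ)))
            (by rw [mul_neg, ← mul_assoc, a.2]; simp)).choose * x, ?_⟩
          left_inv := ?_
          right_inv := ?_ }
      · have := (hη (-(a.1 * (x⁻¹ : Aˣ))) (by rw [mul_neg, ← mul_assoc, a.2]; simp)).choose_spec.1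
        rw [Units.val_mul, this]
        have h5 : (x : A) - (1 + -(a.1 * (x⁻¹ : Aˣ))) * x = a.1 * ((x⁻¹ : Aˣ) * x) := by ring
        rw [h5, Units.inv_mul, mul_one, a.2]
      · intro x'
        ext
        dsimp only
        generalize_proofs h6
        have := h6.choose_spec.1
        rw [Units.val_mul, this]
        have h5 : (1 + -(((x : A) - x'.1) * (x⁻¹ : Aˣ))) * x
          = x + (x'.1 - x) * ((x⁻¹ : Aˣ) * x) := by ring
        rw [h5, Units.inv_mul]
        ring
      · intro a
        ext
        dsimp only
        generalize_proofs h6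
        have := h6.choose_spec.1
        rw [Units.val_mul, this]
        have h5 : (x : A) - (1 + -(a.1 * (x⁻¹ : Aˣ))) * x = a.1 * ((x⁻¹ : Aˣ) * x) := by ring
        rw [h5, Units.inv_mul, mul_one]
    rw [Finset.sum_congr rfl fun x _ => h3 x]
    simp
  rw [e1] at e2
  have h0 : (Fintype.card Aˣ : ℂ) ≠ 0 := by simp
  have := mul_left_cancel₀ h0 e2
  exact_mod_cast this

/-- A sum over a finite group that picks up a factor other than `1` under a translation
vanishes. -/
lemma sum_eq_zero_of_mul_left {G : Type*} [Group G] [Fintype G] {f : G → ℂ} (h : G) {c : ℂ}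
    (hc : c ≠ 1) (hf : ∀ x, f (h * x) = c * f x) : ∑ x, f x = 0 := by
  have h1 : ∑ x, f x = c * ∑ x, f x := by
    rw [Finset.mul_sum, ← Finset.sum_congr rfl fun x _ => hf x]
    exact (Fintype.sum_equiv (Equiv.mulLeft h) _ _ fun x => rfl).symm
  by_contra h2
  exact hc ((mul_eq_right₀ h2).mp h1.symm)

end FiniteRing

/-! ### Chain rings and their quadratic algebras -/

/-- A local ring with principal nilpotent maximal ideal `(ϖ)`, where `m` is the least exponent with
`ϖ ^ m = 0`, in which `2` is invertible. The example is `O_F / ϖ ^ m`. -/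
structure IsOddChainRing {R : Type*} [CommRing R] (ϖ : R) (m : ℕ) : Prop where
  pos : 0 < m
  isUnit_or_dvd : ∀ x : R, IsUnit x ∨ ϖ ∣ x
  pow_eq_zero : ϖ ^ m = 0
  pow_ne_zero : ϖ ^ (m - 1) ≠ 0
  two : IsUnit (2 : R)

/-- The quadratic algebra `R[δ]` with `δ² = D`. -/
abbrev Quad {R : Type*} [CommRing R] (D : R) := QuadraticAlgebra R D 0

noncomputable instance {R : Type*} [CommRing R] [Fintype R] (D : R) : Fintype (Quad D) :=
  Fintype.ofEquiv _ (QuadraticAlgebra.equivProd D 0).symm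

namespace IsOddChainRing

variable {R : Type*} [CommRing R] {ϖ : R} {m : ℕ} (hR : IsOddChainRing ϖ m)
include hR

lemma not_isUnit : ¬ IsUnit ϖ := fun h => by
  have := (h.pow m).mul_left_cancel (a := ϖ ^ m) (b := ϖ ^ (m - 1)) (c := 0)
    (by rw [hR.pow_eq_zero]; ring)
  exact hR.pow_ne_zero this

lemma isUnit_iff {x : R} : IsUnit x ↔ ¬ ϖ ∣ x :=
  ⟨fun h hd => hR.not_isUnit (isUnit_of_dvd_unit hd h), fun h => (hR.isUnit_or_dvd x).resolve_right h⟩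

lemma dvd_iff {x : R} : ϖ ∣ x ↔ ¬ IsUnit x := by rw [hR.isUnit_iff, not_not]

lemma dvd_mul_iff {x y : R} : ϖ ∣ x * y ↔ ϖ ∣ x ∨ ϖ ∣ y := by
  simp only [hR.dvd_iff, IsUnit.mul_iff]; tauto

lemma dvd_of_dvd_sq {x : R} (h : ϖ ∣ x * x) : ϖ ∣ x := by
  rw [hR.dvd_mul_iff] at h; tauto

lemma isUnit_add {x y : R} (hx : IsUnit x) (hy : ϖ ∣ y) : IsUnit (x + y) := by
  rw [hR.isUnit_iff] at hx ⊢
  exact fun h => hx ((dvd_add_left hy).mp h)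

lemma pow_ne {j : ℕ} (hj : j < m) : ϖ ^ j ≠ 0 := fun h =>
  hR.pow_ne_zero (pow_eq_zero_of_le (by omega) h)

/-- Divisibility by `ϖ` can be read off after multiplication by `ϖ ^ j`, for `j < m`. -/
lemma dvd_of_pow_mul {j : ℕ} (hj : j < m) {s : R} (h : ϖ ^ (j + 1) ∣ ϖ ^ j * s) : ϖ ∣ s := by
  by_contra hs
  rw [← hR.isUnit_iff] at hs
  obtain ⟨s, rfl⟩ := hs
  obtain ⟨t, ht⟩ := h
  have h1 : IsUnit ((s : R) + ϖ * -t) := hR.isUnit_add s.isUnit (dvd_mul_right _ _)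
  have h2 : ϖ ^ j * (s + ϖ * -t) = 0 := by rw [mul_add, ht]; ring
  exact hR.pow_ne hj ((h1.mul_left_eq_zero).mp h2)

lemma pow_pred_mul_eq_zero {s : R} : ϖ ^ (m - 1) * s = 0 ↔ ϖ ∣ s := by
  constructor
  · intro h
    exact hR.dvd_of_pow_mul (j := m - 1) (by have := hR.pos; omega) (by rw [h]; exact dvd_zero _)
  · rintro ⟨t, rfl⟩
    rw [← mul_assoc, ← pow_succ, Nat.sub_add_cancel hR.pos, hR.pow_eq_zero, zero_mul]

lemma exists_eq_pow_mul_unit {x : R} (hx : x ≠ 0) : ∃ j < m, ∃ u : Rˣ, x = ϖ ^ j * u := by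
  by_contra! h
  have : ∀ j ≤ m, ϖ ^ j ∣ x := by
    intro j
    induction j with
    | zero => simp
    | succ j ih =>
      intro hj
      obtain ⟨y, rfl⟩ := ih (by omega)
      rcases hR.isUnit_or_dvd y with hy | hy
      · exact absurd rfl (h j (by omega) hy.unit)
      · rw [pow_succ]; exact mul_dvd_mul_left _ hy
  obtain ⟨y, rfl⟩ := this m le_rfl
  exact hx (by rw [hR.pow_eq_zero, zero_mul])

lemma pow_dvd_of_pow_mul_eq_zero {l : ℕ} {x : R} (h : ϖ ^ l * x = 0) :
    ϖ ^ (m - l) ∣ x := by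
  by_cases hx : x = 0
  · rw [hx]; exact dvd_zero _
  obtain ⟨j, hj, u, rfl⟩ := hR.exists_eq_pow_mul_unit hx
  have h1 : ϖ ^ (l + j) = 0 := by
    rw [← mul_assoc, ← pow_add] at h
    exact (u.isUnit.mul_left_eq_zero).mp h
  have h2 : m ≤ l + j := by
    by_contra h3
    exact hR.pow_ne (by omega) h1
  exact (pow_dvd_pow _ (by omega)).mul_right _

/-- An additive character that is nontrivial on `ϖ ^ (m - 1) R` is primitive. -/
lemma exists_addChar_ne_one {Ψ : AddChar R ℂ} (hΨ : ∃ t, Ψ (ϖ ^ (m - 1) * t) ≠ 1) {a : R}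
    (ha : a ≠ 0) : ∃ t, Ψ (a * t) ≠ 1 := by
  obtain ⟨t, ht⟩ := hΨ
  obtain ⟨j, hj, u, rfl⟩ := hR.exists_eq_pow_mul_unit ha
  refine ⟨(u⁻¹ : Rˣ) * (ϖ ^ (m - 1 - j) * t), ?_⟩
  convert! ht using 2
  have : ϖ ^ (m - 1) = ϖ ^ j * ϖ ^ (m - 1 - j) := by rw [← pow_add]; congr 1; omega
  rw [this, mul_assoc, Units.mul_inv_cancel_left, mul_assoc]

end IsOddChainRing

section Quad

open scoped Classical
open QuadraticAlgebra

variable {R : Type*} [CommRing R] {D : R}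

/-- The embedding of the scalars into the quadratic algebra. -/
def Quad.coe (D : R) (a : R) : Quad D := ⟨a, 0⟩

@[simp] lemma Quad.coe_re (a : R) : (Quad.coe D a).re = a := rfl

@[simp] lemma Quad.coe_im (a : R) : (Quad.coe D a).im = 0 := rfl

lemma Quad.coe_mul (a b : R) : Quad.coe D (a * b) = Quad.coe D a * Quad.coe D b := by
  ext <;> simp

@[simp] lemma Quad.coe_zero : Quad.coe D 0 = 0 := rfl

@[simp] lemma Quad.coe_one : Quad.coe D 1 = 1 := rfl

/-- The scalar units of the quadratic algebra. -/
def Quad.coeUnit (D : R) (a : Rˣ) : (Quad D)ˣ := Units.map (algebraMap R (Quad D)).toMonoidHom a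

@[simp] lemma Quad.val_coeUnit (a : Rˣ) : (Quad.coeUnit D a : Quad D) = Quad.coe D a := rfl

lemma quad_norm (x : Quad D) : norm x = x.re * x.re - D * x.im * x.im := by
  rw [norm_def]; ring

/-- `θ` is trivial on the units `a + b δ` with `ϖ ^ j ∣ b`, the units of the order
`R + ϖ ^ j R[δ]`. -/
def TrivOn (ϖ : R) (θ : (Quad D)ˣ →* ℂˣ) (j : ℕ) : Prop :=
  ∀ x : (Quad D)ˣ, ϖ ^ j ∣ (x : Quad D).im → θ x = 1

lemma TrivOn.mono {ϖ : R} {θ : (Quad D)ˣ →* ℂˣ} {i j : ℕ} (h : TrivOn ϖ θ i) (hij : i ≤ j) :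
    TrivOn ϖ θ j := fun x hx => h x ((pow_dvd_pow _ hij).trans hx)

lemma TrivOn.mul {ϖ : R} {θ θ' : (Quad D)ˣ →* ℂˣ} {j : ℕ} (h : TrivOn ϖ θ j)
    (h' : TrivOn ϖ θ' j) : TrivOn ϖ (θ * θ') j := fun x hx => by
  rw [MonoidHom.mul_apply, h x hx, h' x hx, one_mul]

lemma TrivOn.inv {ϖ : R} {θ : (Quad D)ˣ →* ℂˣ} {j : ℕ} (h : TrivOn ϖ θ j) :
    TrivOn ϖ θ⁻¹ j := fun x hx => by
  rw [MonoidHom.inv_apply, h x hx, inv_one]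

/-- The conjugate of a unit. -/
def unitStar (x : (Quad D)ˣ) : (Quad D)ˣ := Units.map (starRingEnd (Quad D)).toMonoidHom x

@[simp] lemma coe_unitStar (x : (Quad D)ˣ) : (unitStar x : Quad D) = star (x : Quad D) := rfl

lemma mul_star_eq (x : Quad D) : x * star x = Quad.coe D (norm x) :=
  (algebraMap_norm_eq_mul_star x).symm

variable {ϖ : R} {m : ℕ}

lemma char_eq_one_of_im_eq_zero {θ : (Quad D)ˣ →* ℂˣ} (hθ : TrivOn ϖ θ m) {x : (Quad D)ˣ}
    (hx : (x : Quad D).im = 0) : θ x = 1 := hθ x (by rw [hx]; exact dvd_zero _)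

lemma char_unitStar {θ : (Quad D)ˣ →* ℂˣ} (hθ : TrivOn ϖ θ m) (x : (Quad D)ˣ) :
    θ (unitStar x) = (θ x)⁻¹ := by
  rw [eq_inv_iff_mul_eq_one, mul_comm, ← map_mul]
  apply char_eq_one_of_im_eq_zero hθ
  rw [Units.val_mul, coe_unitStar, mul_star_eq, Quad.coe_im]

/-- A character that is trivial on the scalars only depends on a unit up to scalars. -/
lemma char_congr {θ : (Quad D)ˣ →* ℂˣ} (hθ : TrivOn ϖ θ m) {x y : (Quad D)ˣ} {a : R}
    (h : (x : Quad D) = Quad.coe D a * y) : θ x = θ y := by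
  have : θ (x * y⁻¹) = 1 := by
    apply char_eq_one_of_im_eq_zero hθ
    rw [Units.val_mul, h, mul_assoc, Units.mul_inv, mul_one, Quad.coe_im]
  rwa [map_mul, map_inv, mul_inv_eq_one] at this

variable (hR : IsOddChainRing ϖ m)
include hR

lemma isUnit_quad_iff {x : Quad D} : IsUnit x ↔ ¬ ϖ ∣ norm x := by
  rw [isUnit_iff_norm_isUnit, hR.isUnit_iff]

/-- A character that is nontrivial on the units `α + ϖ ^ (l - 1) β δ` is nontrivial on the units
that fix a given nonunit modulo `ϖ ^ l`. For `y = a + b δ` with `b` invertible, multiplication by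
`α + ϖ ^ (l - 1) β δ` acts on `y` modulo `ϖ ^ l` like the scalar `α + ϖ ^ (l - 1) β a / b`, as
`ϖ ∣ a² - D b²`. -/
lemma exists_char_ne_one_fixing {η : (Quad D)ˣ →* ℂˣ} (hη : TrivOn ϖ η m) {l : ℕ} (hl : 1 ≤ l)
    (hη' : ¬ TrivOn ϖ η (l - 1)) {y : Quad D} (hy : ¬ IsUnit y) :
    ∃ h : (Quad D)ˣ, η h ≠ 1 ∧ ∃ w, ((h : Quad D) - 1) * y = Quad.coe D (ϖ ^ l) * w := by
  obtain ⟨l, rfl⟩ : ∃ k, l = k + 1 := ⟨l - 1, by omega⟩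
  simp only [TrivOn, not_forall, Nat.add_sub_cancel] at hη'
  obtain ⟨g, ⟨β, hβ⟩, hg⟩ := hη'
  have hyN : ϖ ∣ norm y := by rwa [isUnit_quad_iff hR, not_not] at hy
  have hgu : IsUnit (norm (g : Quad D)) := isUnit_iff_norm_isUnit.mp g.isUnit
  obtain ⟨n, hn⟩ := hyN
  rw [quad_norm] at hn hgu
  -- Rescaling `g` by a unit `c` does not change `η g`.
  have key : ∀ c : Rˣ, η (Quad.coeUnit D c * g) ≠ 1 := by
    intro c
    rwa [char_congr hη (y := g) (a := c) (by simp)]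
  -- If `ϖ ∣ y`, it suffices to make the first coordinate of `g` equal to `1`, and for `l = 1` any
  -- `g` does.
  by_cases hb : ϖ ∣ y.im
  · have ha : ϖ ∣ y.re := by
      apply hR.dvd_of_dvd_sq
      have : y.re * y.re = ϖ * n + D * y.im * y.im := by linear_combination hn
      rw [this]
      exact dvd_add (dvd_mul_right _ _) (hb.mul_left _)
    obtain ⟨a, ha⟩ := ha
    obtain ⟨b, hb⟩ := hb
    rcases Nat.eq_zero_or_pos l with rfl | hl
    · refine ⟨g, hg, ((g : Quad D) - 1) * ⟨a, b⟩, ?_⟩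
      ext <;> simp [ha, hb] <;> ring
    · have hα : IsUnit (g : Quad D).re := by
        rw [hR.isUnit_iff] at hgu ⊢
        refine fun h => hgu (dvd_sub (h.mul_left _) ?_)
        rw [hβ]
        exact ((dvd_pow_self ϖ hl.ne').mul_right β).mul_left _
      obtain ⟨α, hα⟩ := hα
      refine ⟨_, key α⁻¹, ⟨D * (α⁻¹ : Rˣ) * β * b, (α⁻¹ : Rˣ) * β * a⟩, ?_⟩
      have h1 : ((α⁻¹ : Rˣ) : R) * α = 1 := Units.inv_mul α
      ext
      · simp [ha, hb, hβ, ← hα]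
        ring
      · simp [ha, hb, hβ, ← hα]
        ring
  -- Otherwise divide `g = α + ϖ ^ l β δ` by the scalar `c = α + ϖ ^ l β a / b`. It is a unit as
  -- its product with `α - ϖ ^ l β a / b` is congruent to `N g`.
  · obtain ⟨b, hb⟩ := hR.isUnit_iff.mpr hb
    have h1 : ((b⁻¹ : Rˣ) : R) * b = 1 := Units.inv_mul b
    have hc : IsUnit ((g : Quad D).re + ϖ ^ l * β * y.re * (b⁻¹ : Rˣ)) := by
      set s := ϖ ^ l * β * y.re * (b⁻¹ : Rˣ)
      have h2 : IsUnit (((g : Quad D).re + s) * ((g : Quad D).re - s)) := by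
        have : ((g : Quad D).re + s) * ((g : Quad D).re - s)
            = ((g : Quad D).re * (g : Quad D).re - D * (g : Quad D).im * (g : Quad D).im)
              + ϖ * (-(ϖ ^ l * β * (b⁻¹ : Rˣ)) ^ 2 * n) := by
          rw [hβ]
          simp only [s]
          rw [← hb] at hn
          linear_combination (-(ϖ ^ l * β * (b⁻¹ : Rˣ)) ^ 2) * hn
            - (ϖ ^ l * β) ^ 2 * D * ((b⁻¹ : Rˣ) * b + 1) * h1
        rw [this]
        exact hR.isUnit_add hgu (dvd_mul_right _ _)
      exact isUnit_of_mul_isUnit_left h2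
    obtain ⟨c, hc⟩ := hc
    have h2 : ((c⁻¹ : Rˣ) : R) * c = 1 := Units.inv_mul c
    refine ⟨_, key c⁻¹, ⟨-(c⁻¹ : Rˣ) * β * (b⁻¹ : Rˣ) * n, 0⟩, ?_⟩
    rw [← hb] at hn
    ext
    · simp [hβ, ← hb]
      linear_combination (y.re) * h2 - (c⁻¹ : Rˣ) * ϖ ^ l * β * (b⁻¹ : Rˣ) * hn
        - (c⁻¹ : Rˣ) * y.re * hc - (c⁻¹ : Rˣ) * ϖ ^ l * β * D * b * h1
    · simp [hβ, ← hb]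
      linear_combination b * h2 - (c⁻¹ : Rˣ) * b * hc - (c⁻¹ : Rˣ) * ϖ ^ l * β * y.re * h1

end Quad

section Correlation

open scoped Classical
open QuadraticAlgebra

variable {R : Type*} [CommRing R] {D D' : R} {ϖ : R} {m : ℕ}

/-! ### Gauss sums over a quadratic algebra -/

lemma exists_unit_one_add (hR : IsOddChainRing ϖ m) {a : Quad D} (ha : ϖ ∣ a.re)
    (hb : ϖ ∣ D * a.im) : ∃ u : (Quad D)ˣ, (u : Quad D) = 1 + a := by
  refine ⟨IsUnit.unit (a := 1 + a) ?_, rfl⟩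
  rw [isUnit_iff_norm_isUnit, quad_norm]
  have : (1 + a).re * (1 + a).re - D * (1 + a).im * (1 + a).im
      = 1 + (2 * a.re + a.re * a.re - D * a.im * a.im) := by
    simp; ring
  rw [this]
  exact hR.isUnit_add isUnit_one
    (dvd_sub (dvd_add (ha.mul_left _) (ha.mul_left _)) (hb.mul_right _))

lemma dvd_of_coe_pow_mul_eq_zero (hR : IsOddChainRing ϖ m) {l : ℕ} {y : Quad D}
    (h : Quad.coe D (ϖ ^ l) * y = 0) : ∃ y', y = Quad.coe D (ϖ ^ (m - l)) * y' := by
  have h1 := congr_arg QuadraticAlgebra.re h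
  have h2 := congr_arg QuadraticAlgebra.im h
  simp at h1 h2
  obtain ⟨a, ha⟩ := hR.pow_dvd_of_pow_mul_eq_zero h1
  obtain ⟨b, hb⟩ := hR.pow_dvd_of_pow_mul_eq_zero h2
  exact ⟨⟨a, b⟩, by ext <;> simp [ha, hb]⟩

variable [Fintype R]

/-- The Gauss sum of a character of conductor `l ≥ 1` is supported on `ϖ ^ (m - l)` times the
units. -/
lemma exists_eq_of_unitGauss_ne_zero (hR : IsOddChainRing ϖ m) {η : (Quad D)ˣ →* ℂˣ}
    {Φ : AddChar (Quad D) ℂ} (hΦ : Φ.IsPrimitive) {l : ℕ} (hl : 1 ≤ l) (hlm : l ≤ m)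
    (hη : TrivOn ϖ η l) (hη' : ¬ TrivOn ϖ η (l - 1)) {y : Quad D}
    (hy : unitGauss η Φ y ≠ 0) : ∃ u : (Quad D)ˣ, y = Quad.coe D (ϖ ^ (m - l)) * u := by
  have h1 : Quad.coe D (ϖ ^ l) * y = 0 := by
    by_contra h
    refine hy (unitGauss_eq_zero_of_mul_ne_zero hΦ (c := Quad.coe D (ϖ ^ l)) (fun t => ?_) h)
    have hd : ϖ ∣ ϖ ^ l := dvd_pow_self _ (by omega)
    obtain ⟨u, hu⟩ := exists_unit_one_add hR (a := Quad.coe D (ϖ ^ l) * t)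
      (by simpa using hd.mul_right _) (by simpa using (hd.mul_right _).mul_left _)
    exact ⟨u, hu, hη u (by simp [hu])⟩
  obtain ⟨y', rfl⟩ := dvd_of_coe_pow_mul_eq_zero hR h1
  by_cases hy' : IsUnit y'
  · exact ⟨hy'.unit, rfl⟩
  obtain ⟨h, hh, w, hw⟩ := exists_char_ne_one_fixing hR (hη.mono hlm) hl hη' hy'
  refine absurd (unitGauss_eq_zero_of_fixed Φ hh ?_) hy
  rw [mul_left_comm, hw, ← mul_assoc, ← Quad.coe_mul, ← pow_add, Nat.sub_add_cancel hlm,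
    hR.pow_eq_zero, Quad.coe_zero, zero_mul]

lemma dvd_of_unitGauss_one_ne_zero (hR : IsOddChainRing ϖ m)
    {Φ : AddChar (Quad D) ℂ} (hΦ : Φ.IsPrimitive) {y : Quad D}
    (hy : unitGauss 1 Φ y ≠ 0) : ∃ y', y = Quad.coe D (ϖ ^ (m - 1)) * y' := by
  apply dvd_of_coe_pow_mul_eq_zero hR
  by_contra h
  refine hy (unitGauss_eq_zero_of_mul_ne_zero hΦ (c := Quad.coe D (ϖ ^ 1)) (fun t => ?_) h)
  obtain ⟨u, hu⟩ := exists_unit_one_add hR (a := Quad.coe D (ϖ ^ 1) * t)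
      (by simp) (by simpa using (dvd_mul_right _ _).mul_left _)
  exact ⟨u, hu, rfl⟩

/-- For `D` divisible by `ϖ`, so that `1 + δ R[δ]` consists of units, the Gauss sum of the trivial
character is supported on the annihilator of `δ`. -/
lemma delta_mul_eq_zero_of_unitGauss_one_ne_zero (hR : IsOddChainRing ϖ m) (hD : ϖ ∣ D)
    {Φ : AddChar (Quad D) ℂ} (hΦ : Φ.IsPrimitive) {y : Quad D}
    (hy : unitGauss 1 Φ y ≠ 0) : y.re = 0 ∧ D * y.im = 0 := by
  have : (⟨0, 1⟩ : Quad D) * y = 0 := by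
    by_contra h
    refine hy (unitGauss_eq_zero_of_mul_ne_zero hΦ (c := ⟨0, 1⟩) (fun t => ?_) h)
    obtain ⟨u, hu⟩ := exists_unit_one_add hR (a := ⟨0, 1⟩ * t)
      (by simpa using hD.mul_right _) (by simpa using hD.mul_right _)
    exact ⟨u, hu, rfl⟩
  have h1 := congr_arg QuadraticAlgebra.re this
  have h2 := congr_arg QuadraticAlgebra.im this
  simp at h1 h2
  exact ⟨h2, h1⟩

lemma card_quad : Fintype.card (Quad D) = Fintype.card R ^ 2 := by
  rw [Fintype.card_congr (QuadraticAlgebra.equivProd D 0), Fintype.card_prod, sq]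

/-- `|W_η(ϖ ^ (m - l))| = |R| |Ann_R(ϖ ^ (m - l))|` for a character `η` of conductor `l ≥ 1`. -/
lemma norm_unitGauss_coe (hR : IsOddChainRing ϖ m) {η : (Quad D)ˣ →* ℂˣ}
    {Φ : AddChar (Quad D) ℂ} (hΦ : Φ.IsPrimitive) {l : ℕ} (hl : 1 ≤ l) (hlm : l ≤ m)
    (hη : TrivOn ϖ η l) (hη' : ¬ TrivOn ϖ η (l - 1)) :
    ‖unitGauss η Φ (Quad.coe D (ϖ ^ (m - l)))‖
      = Fintype.card R * Fintype.card {a : R // ϖ ^ (m - l) * a = 0} := by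
  have h := norm_unitGauss_sq (η := η) hΦ (c := Quad.coe D (ϖ ^ (m - l))) ?_ ?_
  · have hc : Fintype.card {a : Quad D // Quad.coe D (ϖ ^ (m - l)) * a = 0}
        = Fintype.card {a : R // ϖ ^ (m - l) * a = 0} ^ 2 := by
      rw [sq, ← Fintype.card_prod]
      refine Fintype.card_congr
        { toFun := fun a => (⟨a.1.re, by simpa using congr_arg QuadraticAlgebra.re a.2⟩,
            ⟨a.1.im, by simpa using congr_arg QuadraticAlgebra.im a.2⟩)
          invFun := fun a => ⟨⟨a.1.1, a.2.1⟩, by ext <;> simp [a.1.2, a.2.2]⟩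
          left_inv := fun a => rfl
          right_inv := fun a => rfl }
    rw [hc, card_quad, ← Nat.cast_mul, ← mul_pow, Nat.cast_pow, Nat.cast_mul] at h
    exact (pow_left_inj₀ (norm_nonneg _) (by positivity) two_ne_zero).mp h
  · intro y hy
    obtain ⟨h, hh, w, hw⟩ := exists_char_ne_one_fixing hR (hη.mono hlm) hl hη' hy
    refine unitGauss_eq_zero_of_fixed Φ hh ?_
    rw [mul_left_comm, hw, ← mul_assoc, ← Quad.coe_mul, ← pow_add, Nat.sub_add_cancel hlm,
      hR.pow_eq_zero, Quad.coe_zero, zero_mul]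
  · intro a ha
    obtain ⟨a', rfl⟩ := dvd_of_coe_pow_mul_eq_zero hR ha
    have e : m - (m - l) = l := by omega
    rw [e]
    have hd : ϖ ∣ ϖ ^ l := dvd_pow_self _ (by omega)
    obtain ⟨u, hu⟩ := exists_unit_one_add hR (a := Quad.coe D (ϖ ^ l) * a')
      (by simpa using hd.mul_right _) (by simpa using (hd.mul_right _).mul_left _)
    exact ⟨u, hu, hη u (by simp [hu])⟩

/-! ### Correlations of Gauss sums of two characters of the same algebra -/

/-- The correlation sum of `θ⁻¹(x) Φ(x)` and `θ'(y)⁻¹ Φ'(y)` over the pairs of units with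
`N x ≡ r N y` modulo `ϖ ^ n`. -/
noncomputable def pairSum (ϖ r : R) (Φ : AddChar (Quad D) ℂ) (Φ' : AddChar (Quad D') ℂ)
    (θ : (Quad D)ˣ →* ℂˣ) (θ' : (Quad D')ˣ →* ℂˣ) (n : ℕ) : ℂ :=
  ∑ x : (Quad D)ˣ, ∑ y : (Quad D')ˣ, if ϖ ^ n ∣ norm (x : Quad D) - r * norm (y : Quad D') then
    (((θ x)⁻¹ : ℂˣ) * Φ x : ℂ) * (θ' y * Φ' (-y)) else 0

/-- The substitution `y = x z`, for two characters of the same algebra. -/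
lemma pairSum_eq_sum (Φ : AddChar (Quad D) ℂ) (θ θ' : (Quad D)ˣ →* ℂˣ) (n : ℕ) :
    pairSum ϖ 1 Φ Φ θ θ' n = ∑ z : (Quad D)ˣ, if ϖ ^ n ∣ norm (z : Quad D) - 1 then
      θ' z * unitGauss (θ⁻¹ * θ') Φ (1 - z) else 0 := by
  rw [pairSum]
  have h1 : ∀ x : (Quad D)ˣ, (∑ y : (Quad D)ˣ, if ϖ ^ n ∣ norm (x : Quad D) - 1 * norm (y : Quad D)
      then (((θ x)⁻¹ : ℂˣ) * Φ x : ℂ) * (θ' y * Φ (-y)) else 0)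
      = ∑ z : (Quad D)ˣ, if ϖ ^ n ∣ norm (z : Quad D) - 1 then
        θ' z * (((θ⁻¹ * θ') x : ℂˣ) * Φ (x * (1 - z))) else 0 := by
    intro x
    refine (Fintype.sum_equiv (Equiv.mulLeft x) _ _ fun z => ?_).symm
    have hx : IsUnit (norm (x : Quad D)) := isUnit_iff_norm_isUnit.mp x.isUnit
    have h2 : ϖ ^ n ∣ norm (x : Quad D) - 1 * norm ((Equiv.mulLeft x z : (Quad D)ˣ) : Quad D)
        ↔ ϖ ^ n ∣ norm (z : Quad D) - 1 := by
      rw [Equiv.coe_mulLeft, Units.val_mul, map_mul, one_mul, ← mul_one_sub, hx.dvd_mul_left,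
        dvd_sub_comm]
    simp only [h2]
    refine if_congr Iff.rfl ?_ rfl
    rw [Equiv.coe_mulLeft, Units.val_mul, mul_sub, mul_one, sub_eq_add_neg,
      AddChar.map_add_eq_mul, map_mul, MonoidHom.mul_apply, MonoidHom.inv_apply]
    push_cast
    ring
  rw [Finset.sum_congr rfl fun x _ => h1 x, Finset.sum_comm]
  refine Finset.sum_congr rfl fun z _ => ?_
  split_ifs
  · rw [unitGauss, Finset.mul_sum]
  · simp

/-- For `n = 0` there is no condition on the pairs. -/
lemma pairSum_zero (r : R) (Φ : AddChar (Quad D) ℂ) (Φ' : AddChar (Quad D') ℂ)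
    (θ : (Quad D)ˣ →* ℂˣ) (θ' : (Quad D')ˣ →* ℂˣ) :
    pairSum ϖ r Φ Φ' θ θ' 0
      = unitGauss θ⁻¹ Φ 1 * starRingEnd ℂ (unitGauss θ'⁻¹ Φ' 1) := by
  rw [pairSum, unitGauss, unitGauss, map_sum, Finset.sum_mul_sum]
  refine Finset.sum_congr rfl fun x _ => Finset.sum_congr rfl fun y _ => ?_
  rw [pow_zero, if_pos (one_dvd _), map_mul (starRingEnd ℂ), conj_char, conj_addChar, mul_one,
    mul_one, MonoidHom.inv_apply, MonoidHom.inv_apply, inv_inv]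

/-- If `Φ(y) = Φ(± star y)`, the correlation does not change when one of the characters is
replaced by its inverse, which is its conjugate. -/
lemma pairSum_inv_right {ε : (Quad D')ˣ} (hε : (ε : Quad D').im = 0)
    (hεn : norm (ε : Quad D') = 1) (r : R)
    (Φ : AddChar (Quad D) ℂ) {Φ' : AddChar (Quad D') ℂ}
    (hΦ' : ∀ y : Quad D', Φ' (ε * star y) = Φ' y)
    (θ : (Quad D)ˣ →* ℂˣ) {θ' : (Quad D')ˣ →* ℂˣ} (hθ' : TrivOn ϖ θ' m) (n : ℕ) :
    pairSum ϖ r Φ Φ' θ θ'⁻¹ n = pairSum ϖ r Φ Φ' θ θ' n := by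
  rw [pairSum, pairSum]
  refine Finset.sum_congr rfl fun x _ => ?_
  let e : (Quad D')ˣ ≃ (Quad D')ˣ :=
    (Equiv.ofBijective unitStar (Function.Involutive.bijective
      (fun y => by ext1; simp))).trans (Equiv.mulLeft ε)
  refine Fintype.sum_equiv e _ _ fun y => ?_
  have he : (e y : Quad D') = ε * star (y : Quad D') := rfl
  have he' : e y = ε * unitStar y := rfl
  have h1 : θ' (e y) = (θ' y)⁻¹ := by
    rw [he', map_mul, char_unitStar hθ', char_eq_one_of_im_eq_zero hθ' hε, one_mul]
  have h2 : Φ' (-(e y : Quad D')) = Φ' (-y) := by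
    rw [he, ← hΦ' (-y), star_neg, mul_neg]
  rw [h1, h2, he, map_mul, hεn, QuadraticAlgebra.norm_star, one_mul, MonoidHom.inv_apply]

/-- The correlation does not depend on `n` as long as the Gauss sums `W_η(1 - z)` are supported on
the `z` with `N z ≡ 1` modulo `ϖ ^ n`. -/
lemma pairSum_eq_pairSum_zero {Φ : AddChar (Quad D) ℂ} {θ θ' : (Quad D)ˣ →* ℂˣ} {n : ℕ}
    (h : ∀ z : Quad D, unitGauss (θ⁻¹ * θ') Φ (1 - z) ≠ 0 → ϖ ^ n ∣ norm z - 1) :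
    pairSum ϖ 1 Φ Φ θ θ' n = pairSum ϖ 1 Φ Φ θ θ' 0 := by
  rw [pairSum_eq_sum, pairSum_eq_sum]
  refine Finset.sum_congr rfl fun z _ => ?_
  rw [pow_zero, if_pos (one_dvd _)]
  split_ifs with h1
  · rfl
  · by_contra h2
    exact h1 (h z (fun h3 => h2 (by rw [h3, mul_zero])))

omit [Fintype R] in
lemma norm_eq_of_eq_one_sub {a : R} {z ζ : Quad D} (h : 1 - z = Quad.coe D a * ζ) :
    norm z - 1 = a * (a * norm ζ - 2 * ζ.re) := by
  have : z = 1 - Quad.coe D a * ζ := by rw [← h]; ring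
  rw [this, quad_norm, quad_norm]
  simp
  ring

/-- If `η = θ⁻¹ θ'` has conductor `l ≥ 1`, then `W_η(1 - z) ≠ 0` only for `z ≡ 1` modulo
`ϖ ^ (m - l)`. -/
lemma pairSum_eq_pairSum_zero_of_add_le (hR : IsOddChainRing ϖ m) {Φ : AddChar (Quad D) ℂ}
    (hΦ : Φ.IsPrimitive) {θ θ' : (Quad D)ˣ →* ℂˣ} {l n : ℕ} (hl : 1 ≤ l)
    (hη : TrivOn ϖ (θ⁻¹ * θ') l) (hη' : ¬ TrivOn ϖ (θ⁻¹ * θ') (l - 1)) (hln : l + n ≤ m) :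
    pairSum ϖ 1 Φ Φ θ θ' n = pairSum ϖ 1 Φ Φ θ θ' 0 := by
  refine pairSum_eq_pairSum_zero fun z hz => ?_
  obtain ⟨u, hu⟩ := exists_eq_of_unitGauss_ne_zero hR hΦ hl (by omega) hη hη' hz
  rw [norm_eq_of_eq_one_sub hu]
  exact (pow_dvd_pow _ (by omega)).mul_right _

/-- For `θ = θ'` the Gauss sum of the trivial character is supported on `ϖ ^ (m - 1) R[δ]`. -/
lemma pairSum_self_eq_pairSum_zero (hR : IsOddChainRing ϖ m) {Φ : AddChar (Quad D) ℂ}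
    (hΦ : Φ.IsPrimitive) {θ : (Quad D)ˣ →* ℂˣ} {n : ℕ} (hn : n + 1 ≤ m) :
    pairSum ϖ 1 Φ Φ θ θ n = pairSum ϖ 1 Φ Φ θ θ 0 := by
  refine pairSum_eq_pairSum_zero fun z hz => ?_
  rw [show θ⁻¹ * θ = 1 from inv_mul_cancel θ] at hz
  obtain ⟨u, hu⟩ := dvd_of_unitGauss_one_ne_zero hR hΦ hz
  rw [norm_eq_of_eq_one_sub hu]
  exact (pow_dvd_pow _ (by omega)).mul_right _

/-- In the ramified case, with `θ = θ'`, the Gauss sum at `1 - z` vanishes unless `N z = 1`. -/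
lemma pairSum_self_eq_pairSum_zero_of_dvd (hR : IsOddChainRing ϖ m) (hD : ϖ ∣ D)
    {Φ : AddChar (Quad D) ℂ} (hΦ : Φ.IsPrimitive) {θ : (Quad D)ˣ →* ℂˣ} {n : ℕ} :
    pairSum ϖ 1 Φ Φ θ θ n = pairSum ϖ 1 Φ Φ θ θ 0 := by
  refine pairSum_eq_pairSum_zero fun z hz => ?_
  rw [show θ⁻¹ * θ = 1 from inv_mul_cancel θ] at hz
  obtain ⟨h1, h2⟩ := delta_mul_eq_zero_of_unitGauss_one_ne_zero hR hD hΦ hz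
  simp at h1 h2
  have : norm z - 1 = 0 := by
    rw [quad_norm, h2]
    linear_combination (-z.re - 1) * h1
  rw [this]
  exact dvd_zero _

end Correlation

/-! ### Vanishing of the correlation -/

section Vanishing

open scoped Classical
open QuadraticAlgebra

variable {R : Type*} [CommRing R] {D : R} {ϖ : R} {m : ℕ}

lemma IsOddChainRing.exists_half (hR : IsOddChainRing ϖ m) : ∃ c : R, 2 * c = 1 :=
  hR.two.exists_right_inv

lemma IsOddChainRing.dvd_two_mul (hR : IsOddChainRing ϖ m) {x : R} (h : ϖ ∣ 2 * x) : ϖ ∣ x :=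
  (hR.dvd_mul_iff.mp h).resolve_left (hR.isUnit_iff.mp hR.two)

lemma exists_unit_pow_pred (hR : IsOddChainRing ϖ m) (hD : ϖ ∣ D * ϖ ^ (m - 1)) (t : R) :
    ∃ u : (Quad D)ˣ, (u : Quad D) = ⟨1, ϖ ^ (m - 1) * t⟩ := by
  obtain ⟨u, hu⟩ := exists_unit_one_add hR (D := D) (a := ⟨0, ϖ ^ (m - 1) * t⟩) (by simp)
    (by simpa [← mul_assoc] using hD.mul_right t)
  exact ⟨u, by rw [hu]; ext <;> simp⟩

lemma mul_pow_pred_sq (hR : IsOddChainRing ϖ m) (hD : ϖ ∣ D * ϖ ^ (m - 1)) :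
    D * ϖ ^ (m - 1) * ϖ ^ (m - 1) = 0 := by
  rw [mul_comm]
  exact hR.pow_pred_mul_eq_zero.mpr hD

/-- A character that is nontrivial on the units `a + ϖ ^ (m - 1) b δ` is nontrivial at some
`1 + ϖ ^ (m - 1) t δ`. -/
lemma exists_char_pow_pred_ne_one (hR : IsOddChainRing ϖ m) (hD : ϖ ∣ D * ϖ ^ (m - 1))
    {η : (Quad D)ˣ →* ℂˣ} (hη : TrivOn ϖ η m) (hη' : ¬ TrivOn ϖ η (m - 1)) :
    ∃ t : R, ∃ u : (Quad D)ˣ, (u : Quad D) = ⟨1, ϖ ^ (m - 1) * t⟩ ∧ η u ≠ 1 := by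
  simp only [TrivOn, not_forall] at hη'
  obtain ⟨g, ⟨β, hβ⟩, hg⟩ := hη'
  have hα : IsUnit (g : Quad D).re := by
    have := isUnit_iff_norm_isUnit.mp g.isUnit
    rw [quad_norm, hR.isUnit_iff] at this
    rw [hR.isUnit_iff]
    refine fun h => this (dvd_sub (h.mul_left _) ?_)
    rw [hβ, ← mul_assoc D]
    exact (hD.mul_right β).mul_right _
  obtain ⟨α, hα⟩ := hα
  obtain ⟨u, hu⟩ := exists_unit_pow_pred hR hD ((α⁻¹ : Rˣ) * β)
  refine ⟨_, u, hu, ?_⟩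
  rw [← char_congr hη (x := g) (a := α)]
  · exact hg
  · rw [hu]
    ext
    · simp [hα]
    · simp only [im_mul, Quad.coe_re, Quad.coe_im, hβ]
      linear_combination -(ϖ ^ (m - 1) * β) * α.mul_inv

variable [Fintype R]

/-- The Gauss sums of a character `η` of conductor `l` at `1 - z` and at `1 - (1 + ϖ ^ (m-1) t δ) z`
agree up to the factor `η(1 + ϖ ^ (m-1) (t/2) δ)⁻¹`, if `N z ≡ 1` modulo `ϖ ^ (m - l + 1)`. -/
lemma unitGauss_one_sub_mul (hR : IsOddChainRing ϖ m) {l n : ℕ} (hl : 1 ≤ l) (hlm : l ≤ m)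
    (hD : ϖ ∣ D * ϖ ^ (l - 1)) {Φ : AddChar (Quad D) ℂ} (hΦ : Φ.IsPrimitive)
    {η : (Quad D)ˣ →* ℂˣ} (hη : TrivOn ϖ η l) (hη' : ¬ TrivOn ϖ η (l - 1)) (hn : m + 1 ≤ l + n)
    {s : R} {u v z : (Quad D)ˣ} (hu : (u : Quad D) = ⟨1, ϖ ^ (m - 1) * (2 * s)⟩)
    (hv : (v : Quad D) = ⟨1, ϖ ^ (m - 1) * s⟩) (hz : ϖ ^ n ∣ norm (z : Quad D) - 1)
    (hW : unitGauss η Φ (1 - z) ≠ 0) :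
    unitGauss η Φ (1 - u * z) = ((η v)⁻¹ : ℂˣ) * unitGauss η Φ (1 - z) := by
  obtain ⟨ζ, hζ⟩ := exists_eq_of_unitGauss_ne_zero hR hΦ hl hlm hη hη' hW
  obtain ⟨w, hwζ⟩ : ∃ w : Quad D, w * ζ = z :=
    ⟨z * (ζ⁻¹ : (Quad D)ˣ), by rw [mul_assoc, Units.inv_mul, mul_one]⟩
  have hNζ : IsUnit (norm (ζ : Quad D)) := isUnit_iff_norm_isUnit.mp ζ.isUnit
  -- With `1 - z = ϖ ^ (m - l) ζ` and `w = z / ζ`, the condition on `N z` says that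
  -- `2 re w ≡ -ϖ ^ (m - l)` modulo `ϖ`.
  have hwre : norm (ζ : Quad D) * w.re = (ζ : Quad D).re - ϖ ^ (m - l) * norm (ζ : Quad D) := by
    have h1 : w * (ζ * star (ζ : Quad D)) = (1 - Quad.coe D (ϖ ^ (m - l)) * ζ) * star (ζ : Quad D) := by
      rw [← hζ, ← mul_assoc, hwζ]; ring
    rw [mul_star_eq, sub_mul, mul_assoc (Quad.coe D _), mul_star_eq] at h1
    have := congr_arg QuadraticAlgebra.re h1
    simp at this
    linear_combination this
  have hdvd : ϖ ∣ ϖ ^ (m - l) * norm (ζ : Quad D) - 2 * (ζ : Quad D).re := by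
    rw [norm_eq_of_eq_one_sub hζ] at hz
    exact hR.dvd_of_pow_mul (j := m - l) (by omega) ((pow_dvd_pow _ (by omega)).trans hz)
  obtain ⟨κ, hκ⟩ : ϖ ∣ 2 * w.re + ϖ ^ (m - l) := by
    refine (hR.dvd_mul_iff.mp ?_).resolve_left (hR.isUnit_iff.mp hNζ)
    rw [← dvd_neg]
    convert! hdvd using 1
    linear_combination (-2) * hwre
  obtain ⟨k, rfl⟩ : ∃ k, l = k + 1 := ⟨l - 1, by omega⟩
  rw [Nat.add_sub_cancel] at hD hη'
  have hpow : ϖ ^ (m - 1) = ϖ ^ k * ϖ ^ (m - (k + 1)) := by rw [← pow_add]; congr 1; omega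
  -- The unit `h' = (1 - u z) / (1 - z)` is `1 - ϖ ^ (l - 1) (2 s) δ w`; by the congruence for `re w`
  -- its second coordinate is that of `v` modulo `ϖ ^ l`.
  obtain ⟨h', hh'⟩ := exists_unit_one_add hR (D := D)
    (a := ⟨-(ϖ ^ k * (2 * s) * D * w.im), -(ϖ ^ k * (2 * s) * w.re)⟩)
    (by
      rw [dvd_neg]
      have := hD.mul_right (2 * s * w.im)
      convert! this using 1; ring)
    (by
      rw [mul_neg, dvd_neg]
      have := hD.mul_right (2 * s * w.re)
      convert! this using 1; ring)
  have e1 : (1 : Quad D) - u * z = h' * (1 - z) := by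
    have h3 : (h' : Quad D) * Quad.coe D (ϖ ^ (m - (k + 1)))
        = Quad.coe D (ϖ ^ (m - (k + 1))) - (u - 1) * w := by
      rw [hu, hh', hpow]
      ext <;> simp <;> ring
    rw [hζ, ← mul_assoc, h3, sub_mul, mul_assoc, hwζ, ← hζ]
    ring
  have e2 : η h' = η v := by
    have h4 : η (h' * unitStar v) = 1 := by
      apply hη
      rw [Units.val_mul, coe_unitStar, hh', hv]
      obtain ⟨d, hd⟩ := hD
      have h0 : ϖ ^ m = 0 := hR.pow_eq_zero
      have hpm : ϖ ^ (m - 1) * ϖ = 0 := by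
        rw [← pow_succ, Nat.sub_add_cancel hR.pos, h0]
      refine ⟨-(s * κ), ?_⟩
      simp
      rw [pow_succ]
      linear_combination (-ϖ ^ k * s) * hκ - s * hpow + ϖ ^ (m - 1) * s * (2 * s) * w.im * hd
        + s * (2 * s) * w.im * d * hpm
    rwa [map_mul, char_unitStar (hη.mono hlm), mul_inv_eq_one] at h4
  rw [e1, unitGauss_unit_mul, e2]

/-- The correlation vanishes for `n > m - l`, where `l` is the conductor of `η = θ⁻¹ θ'`, if
`θ θ'` has conductor `m`: the translation `z ↦ (1 + ϖ ^ (m-1) t δ) z` multiplies the summand by a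
square root of `(θ θ')(1 + ϖ ^ (m-1) t δ)`. -/
lemma pairSum_eq_zero (hR : IsOddChainRing ϖ m) {l n : ℕ} (hl : 1 ≤ l) (hlm : l ≤ m)
    (hD : ϖ ∣ D * ϖ ^ (l - 1)) {Φ : AddChar (Quad D) ℂ} (hΦ : Φ.IsPrimitive)
    {θ θ' : (Quad D)ˣ →* ℂˣ} (hθ : TrivOn ϖ θ m) (hθ' : TrivOn ϖ θ' m)
    (hη : TrivOn ϖ (θ⁻¹ * θ') l) (hη' : ¬ TrivOn ϖ (θ⁻¹ * θ') (l - 1))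
    (hθθ' : ¬ TrivOn ϖ (θ * θ') (m - 1)) (hn : m + 1 ≤ l + n) :
    pairSum ϖ 1 Φ Φ θ θ' n = 0 := by
  have hDm : ϖ ∣ D * ϖ ^ (m - 1) :=
    hD.trans (mul_dvd_mul_left _ (pow_dvd_pow _ (by omega)))
  obtain ⟨t, u, hu, hθu⟩ := exists_char_pow_pred_ne_one hR hDm (hθ.mul hθ') hθθ'
  obtain ⟨c, hc⟩ := hR.exists_half
  -- The square root `v` of `u`.
  obtain ⟨v, hv⟩ := exists_unit_pow_pred hR hDm (c * t)
  have hu' : (u : Quad D) = ⟨1, ϖ ^ (m - 1) * (2 * (c * t))⟩ := by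
    rw [hu, ← mul_assoc 2, hc, one_mul]
  have h0 := mul_pow_pred_sq hR hDm
  have hinv : ∀ (s : R) (x : (Quad D)ˣ), (x : Quad D) = ⟨1, ϖ ^ (m - 1) * s⟩ →
      ((x⁻¹ : (Quad D)ˣ) : Quad D) = ⟨1, ϖ ^ (m - 1) * -s⟩ := by
    intro s x hx
    rw [Units.inv_eq_of_mul_eq_one_right]
    rw [hx]
    ext
    · simp; linear_combination (s * s) * h0
    · simp
  have hvv : v * v = u := by
    ext1
    rw [Units.val_mul, hv, hu']
    ext
    · simp; linear_combination (c * t * (c * t)) * h0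
    · simp; ring
  have hNu : norm (u : Quad D) = 1 := by
    rw [quad_norm, hu]; simp; linear_combination (t * t) * h0
  rw [pairSum_eq_sum]
  -- The translation by `u` multiplies the summands by `θ'(u) η(v)⁻¹`, whose square is `(θ θ')(u)`.
  have hcne : (((θ' u * ((θ⁻¹ * θ') v)⁻¹ : ℂˣ)) : ℂ) ≠ 1 := by
    intro h
    rw [Units.val_eq_one] at h
    apply hθu
    have h2 : (θ' u * ((θ⁻¹ * θ') v)⁻¹) ^ 2 = (θ * θ') u := by
      rw [← hvv]
      simp only [map_mul, MonoidHom.mul_apply, MonoidHom.inv_apply, mul_inv, inv_inv]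
      ext
      push_cast
      field_simp
    rw [← h2, h, one_pow]
  refine sum_eq_zero_of_mul_left u hcne fun z => ?_
  have hN : norm ((u * z : (Quad D)ˣ) : Quad D) = norm (z : Quad D) := by
    rw [Units.val_mul, map_mul, hNu, one_mul]
  rw [hN]
  split_ifs with hz
  -- `unitGauss_one_sub_mul` needs a nonzero Gauss sum at `1 - z`; otherwise it is applied to the
  -- inverse translation, from `u z` to `z`.
  · by_cases hW : unitGauss (θ⁻¹ * θ') Φ (1 - z) = 0
    · have : unitGauss (θ⁻¹ * θ') Φ (1 - (u * z : (Quad D)ˣ)) = 0 := by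
        by_contra hW'
        have h3 := unitGauss_one_sub_mul hR hl hlm hD hΦ hη hη' hn (s := -(c * t))
          (u := u⁻¹) (v := v⁻¹) (z := u * z)
          (by rw [hinv _ u hu']; simp) (by rw [hinv _ v hv]) (by rwa [hN]) hW'
        rw [← Units.val_mul, inv_mul_cancel_left, hW] at h3
        exact (mul_ne_zero (Units.ne_zero _) hW') h3.symm
      rw [this, hW, mul_zero, mul_zero, mul_zero]
    · rw [Units.val_mul u z, unitGauss_one_sub_mul hR hl hlm hD hΦ hη hη' hn hu' hv hz hW, map_mul]
      push_cast
      ring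
  · rw [mul_zero]

end Vanishing

/-! ### The correlation at the last step, for an unramified algebra -/

section Boundary

open scoped Classical
open QuadraticAlgebra

variable {R : Type*} [CommRing R] {D : R} {ϖ : R} {m : ℕ}

/-- The units `a + b δ` with `ϖ ^ j ∣ b`. -/
def orderUnits (ϖ D : R) (j : ℕ) : Subgroup (Quad D)ˣ where
  carrier := {x | ϖ ^ j ∣ (x : Quad D).im}
  one_mem' := by simp
  mul_mem' {x y} hx hy := by
    simp only [Set.mem_ofPred_eq, Units.val_mul, im_mul, zero_mul, add_zero] at hx hy ⊢
    exact dvd_add (hy.mul_left _) (hx.mul_right _)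
  inv_mem' {x} hx := by
    simp only [Set.mem_ofPred_eq] at hx ⊢
    have h1 : star (x : Quad D) = Quad.coe D (norm (x : Quad D)) * (x⁻¹ : (Quad D)ˣ) := by
      rw [← mul_star_eq, mul_comm (x : Quad D), mul_assoc, Units.mul_inv, mul_one]
    have h2 := congr_arg QuadraticAlgebra.im h1
    simp at h2
    have h3 : IsUnit (norm (x : Quad D)) := isUnit_iff_norm_isUnit.mp x.isUnit
    rw [← h3.dvd_mul_left, ← h2, dvd_neg]
    exact hx

@[simp] lemma mem_orderUnits {j : ℕ} {x : (Quad D)ˣ} :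
    x ∈ orderUnits ϖ D j ↔ ϖ ^ j ∣ (x : Quad D).im := Iff.rfl

lemma unitStar_mul (x y : (Quad D)ˣ) : unitStar (x * y) = unitStar x * unitStar y :=
  map_mul (Units.map (starRingEnd (Quad D)).toMonoidHom) _ _

/-- The homomorphism `g ↦ g / star g`, with values in the elements of norm `1`. -/
def normOneHom (D : R) : (Quad D)ˣ →* (Quad D)ˣ where
  toFun g := g * (unitStar g)⁻¹
  map_one' := by simp [unitStar]
  map_mul' x y := by rw [unitStar_mul, mul_inv, mul_mul_mul_comm]

lemma normOneHom_apply (g : (Quad D)ˣ) : normOneHom D g = g * (unitStar g)⁻¹ := rfl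

lemma normOneHom_mul_star (g : (Quad D)ˣ) :
    (normOneHom D g : Quad D) * star (g : Quad D) = g := by
  change ((g * (unitStar g)⁻¹ : (Quad D)ˣ) : Quad D) * (unitStar g : (Quad D)ˣ) = g
  rw [← Units.val_mul, inv_mul_cancel_right]

lemma norm_normOneHom (g : (Quad D)ˣ) : norm (normOneHom D g : Quad D) = 1 := by
  have h := congr_arg QuadraticAlgebra.norm (normOneHom_mul_star g)
  rw [map_mul, QuadraticAlgebra.norm_star] at h
  exact (isUnit_iff_norm_isUnit.mp g.isUnit).mul_eq_right.mp h

lemma one_sub_normOneHom (g : (Quad D)ˣ) :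
    1 - (normOneHom D g : Quad D) = ⟨0, -2 * (g : Quad D).im⟩ * ((unitStar g)⁻¹ : (Quad D)ˣ) := by
  rw [Units.eq_mul_inv_iff_mul_eq, sub_mul, coe_unitStar, normOneHom_mul_star]
  ext <;> simp
  ring

lemma char_normOneHom {θ : (Quad D)ˣ →* ℂˣ} (hθ : TrivOn ϖ θ m) (g : (Quad D)ˣ) :
    θ (normOneHom D g) = (θ * θ) g := by
  rw [normOneHom_apply, map_mul, map_inv, char_unitStar hθ, inv_inv, MonoidHom.mul_apply]

/-- The elements of norm `1` congruent to `1` modulo `ϖ ^ (m - 1)`. -/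
def IsNormOne (ϖ : R) (m : ℕ) (z : Quad D) : Prop :=
  norm z = 1 ∧ ∃ ζ, 1 - z = Quad.coe D (ϖ ^ (m - 1)) * ζ

lemma isNormOne_normOneHom {g : (Quad D)ˣ} (hg : ϖ ^ (m - 1) ∣ (g : Quad D).im) :
    IsNormOne ϖ m (normOneHom D g : Quad D) := by
  obtain ⟨β, hβ⟩ := hg
  refine ⟨norm_normOneHom g, ⟨0, -2 * β⟩ * ((unitStar g)⁻¹ : (Quad D)ˣ), ?_⟩
  rw [one_sub_normOneHom, ← mul_assoc]
  congr 1
  rw [hβ]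
  ext <;> simp
  ring

lemma IsNormOne.mul_iff {y z : Quad D} (hy : IsNormOne ϖ m y) :
    IsNormOne ϖ m (y * z) ↔ IsNormOne ϖ m z := by
  obtain ⟨h1, ζ, hζ⟩ := hy
  have hyu : star y * y = 1 := by
    rw [mul_comm, mul_star_eq, h1, Quad.coe_one]
  rw [IsNormOne, IsNormOne, map_mul, h1, one_mul]
  refine and_congr_right fun _ => ⟨?_, ?_⟩
  · rintro ⟨ξ, hξ⟩
    refine ⟨star y * ξ - star y * ζ, ?_⟩
    rw [mul_sub, mul_left_comm, ← hξ, mul_left_comm, ← hζ]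
    linear_combination (z - 1) * hyu
  · rintro ⟨ξ, hξ⟩
    refine ⟨ζ + y * ξ, ?_⟩
    rw [mul_add, ← hζ, mul_left_comm, ← hξ]
    ring

/-- If `z ≠ 1` has norm `1` and `1 - z = ϖ ^ (m - 1) ζ`, then `ζ` is a unit. -/
lemma isUnit_of_isNormOne (hR : IsOddChainRing ϖ m) (hD : IsUnit D) {z ζ : Quad D}
    (hz : norm z = 1) (hζ : 1 - z = Quad.coe D (ϖ ^ (m - 1)) * ζ) (h1 : z ≠ 1) : IsUnit ζ := by
  have h2 := norm_eq_of_eq_one_sub hζ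
  rw [hz, sub_self, eq_comm, hR.pow_pred_mul_eq_zero] at h2
  by_contra h
  rw [isUnit_quad_iff hR, not_not] at h
  have hre : ϖ ∣ ζ.re := by
    apply hR.dvd_two_mul
    rw [← sub_sub_cancel (ϖ ^ (m - 1) * norm ζ) (2 * ζ.re)]
    exact dvd_sub (h.mul_left _) h2
  have him : ϖ ∣ ζ.im := by
    apply hR.dvd_of_dvd_sq
    rw [← hD.dvd_mul_left, ← mul_assoc, ← sub_sub_cancel (ζ.re * ζ.re) (D * ζ.im * ζ.im),
      ← quad_norm]
    exact dvd_sub (hre.mul_left _) h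
  apply h1
  have : 1 - z = 0 := by
    rw [hζ]
    ext
    · simpa using hR.pow_pred_mul_eq_zero.mpr hre
    · simpa using hR.pow_pred_mul_eq_zero.mpr him
  exact (sub_eq_zero.mp this).symm

/-- Every element of norm `1` congruent to `1` modulo `ϖ ^ (m - 1)` is `g / star g` for some `g`
in `R + ϖ ^ (m - 1) R[δ]`: `g = 1 + z`, or `g = δ` if `z = -1`. -/
lemma IsNormOne.exists_eq (hR : IsOddChainRing ϖ m) (hD : IsUnit D) {z : (Quad D)ˣ}
    (hz : IsNormOne ϖ m (z : Quad D)) :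
    ∃ g : (Quad D)ˣ, ϖ ^ (m - 1) ∣ (g : Quad D).im ∧ normOneHom D g = z := by
  obtain ⟨h1, ζ, hζ⟩ := hz
  have hzim : ϖ ^ (m - 1) ∣ (z : Quad D).im := by
    have := congr_arg QuadraticAlgebra.im hζ
    simp at this
    rw [← dvd_neg, this]
    exact dvd_mul_right _ _
  -- The element `1 + z` is a unit unless `m = 1` and `z = -1`.
  suffices h : ∀ g : (Quad D)ˣ, (z : Quad D) * star (g : Quad D) = g → normOneHom D g = z by
    by_cases hu : IsUnit (1 + (z : Quad D))
    · refine ⟨hu.unit, by simpa using hzim, h _ ?_⟩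
      simp only [IsUnit.unit_spec, star_add, star_one, mul_add, mul_one, mul_star_eq, h1,
        Quad.coe_one]
      ring
    · have hm : m = 1 := by
        by_contra hm
        have hp : ϖ ∣ ϖ ^ (m - 1) := dvd_pow_self _ (by have := hR.pos; omega)
        apply hu
        have e : 1 + (z : Quad D) = 2 * (1 + -(Quad.coe D hR.exists_half.choose *
            (Quad.coe D (ϖ ^ (m - 1)) * ζ))) := by
          have h2 : (2 : Quad D) * Quad.coe D hR.exists_half.choose = 1 := by
            have := hR.exists_half.choose_spec
            ext <;> simp [this]
          rw [← hζ]
          linear_combination (1 - (z : Quad D)) * h2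
        obtain ⟨u, hu⟩ := exists_unit_one_add hR (D := D)
          (a := -(Quad.coe D hR.exists_half.choose * (Quad.coe D (ϖ ^ (m - 1)) * ζ)))
          (by simpa using (hp.mul_right _).mul_left _)
          (by simpa using ((hp.mul_right _).mul_left _).mul_left _)
        rw [e, ← hu]
        refine IsUnit.mul ?_ u.isUnit
        simpa only [map_ofNat] using hR.two.map (algebraMap R (Quad D))
      have hz1 : z = -1 := by
        by_contra hz1
        refine hu (isUnit_of_isNormOne hR hD (z := -z) (by rwa [QuadraticAlgebra.norm_neg])
          (by rw [hm, pow_zero, Quad.coe_one, one_mul]; ring) ?_)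
        intro h3
        apply hz1
        ext1
        rw [Units.val_neg, Units.val_one, ← h3, neg_neg]
      have hδ : IsUnit (⟨0, 1⟩ : Quad D) := by
        rw [isUnit_iff_norm_isUnit, quad_norm]
        simpa using hD
      refine ⟨hδ.unit, by simp [hm], h _ ?_⟩
      rw [hz1]
      ext <;> simp
  intro g hg
  rw [normOneHom_apply, mul_inv_eq_iff_eq_mul]
  ext1
  rw [Units.val_mul, coe_unitStar, hg]

variable [Fintype R]

/-- The correlation at the last step `n = m`, for `θ' = θ`. -/
lemma pairSum_self_last (hR : IsOddChainRing ϖ m) (hD : IsUnit D) {Φ : AddChar (Quad D) ℂ}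
    (hΦ : Φ.IsPrimitive) {θ : (Quad D)ˣ →* ℂˣ} (hθ : TrivOn ϖ θ m)
    (hθθ : ¬ TrivOn ϖ (θ * θ) (m - 1)) :
    pairSum ϖ 1 Φ Φ θ θ m
      = Fintype.card (Quad D)ˣ - unitGauss 1 Φ (Quad.coe D (ϖ ^ (m - 1))) := by
  -- Only the `z ≡ 1` modulo `ϖ ^ (m - 1)` of norm `1` contribute. The Gauss sum at `1 - z` is `W` if
  -- `z ≠ 1`, and the number of units if `z = 1`. The sum of `θ(z) W` over all these `z` vanishes.
  set W := unitGauss 1 Φ (Quad.coe D (ϖ ^ (m - 1)))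
  have h1 : ∀ z : (Quad D)ˣ, (if ϖ ^ m ∣ norm (z : Quad D) - 1 then
      (θ z : ℂ) * unitGauss (θ⁻¹ * θ) Φ (1 - z) else 0)
      = (if IsNormOne ϖ m (z : Quad D) then (θ z : ℂ) * W else 0)
        + if z = 1 then (Fintype.card (Quad D)ˣ : ℂ) - W else 0 := by
    intro z
    have hdvd : ϖ ^ m ∣ norm (z : Quad D) - 1 ↔ norm (z : Quad D) = 1 := by
      rw [hR.pow_eq_zero, zero_dvd_iff, sub_eq_zero]
    simp only [hdvd]
    rw [show θ⁻¹ * θ = 1 from inv_mul_cancel θ]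
    by_cases hz1 : z = 1
    · subst hz1
      have : IsNormOne ϖ m ((1 : (Quad D)ˣ) : Quad D) := ⟨by simp, 0, by simp⟩
      rw [if_pos this, if_pos (by simp), if_pos rfl]
      simp [unitGauss]
    rw [if_neg hz1, add_zero]
    split_ifs with h2 h3 h3
    · obtain ⟨-, ζ, hζ⟩ := h3
      obtain ⟨u, rfl⟩ := isUnit_of_isNormOne hR hD h2 hζ (by simpa using hz1)
      rw [hζ, mul_comm _ (u : Quad D), unitGauss_unit_mul]
      simp [W]
    · rw [mul_eq_zero]
      right
      by_contra h4
      exact h3 ⟨h2, dvd_of_unitGauss_one_ne_zero hR hΦ h4⟩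
    · exact absurd h3.1 h2
    · rfl
  rw [pairSum_eq_sum, Finset.sum_congr rfl fun z _ => h1 z, Finset.sum_add_distrib,
    Finset.sum_ite_eq' Finset.univ (1 : (Quad D)ˣ), if_pos (Finset.mem_univ _)]
  simp only [TrivOn, not_forall] at hθθ
  obtain ⟨g, hg, hθg⟩ := hθθ
  rw [sum_eq_zero_of_mul_left (normOneHom D g) (c := (θ (normOneHom D g) : ℂ)), zero_add]
  · rw [char_normOneHom hθ]
    exact fun h => hθg (Units.val_eq_one.mp h)
  · intro z
    rw [Units.val_mul, (isNormOne_normOneHom hg).mul_iff, map_mul]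
    split_ifs
    · push_cast; ring
    · rw [mul_zero]

/-- The correlation at the last step `n = m`, when `η = θ⁻¹ θ'` has conductor `1`. The summand at
`z = g / star g` is `(θ θ')(g)`, up to a constant; the sum of these values over all `g` is `0`, and
the scalars `g`, which give `z = 1`, are missing. -/
lemma norm_pairSum_last (hR : IsOddChainRing ϖ m) (hD : IsUnit D) {Φ : AddChar (Quad D) ℂ}
    (hΦ : Φ.IsPrimitive) {θ θ' : (Quad D)ˣ →* ℂˣ} (hθ : TrivOn ϖ θ m) (hθ' : TrivOn ϖ θ' m)
    (hη : TrivOn ϖ (θ⁻¹ * θ') 1) (hη' : ¬ TrivOn ϖ (θ⁻¹ * θ') 0)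
    (hθθ' : ¬ TrivOn ϖ (θ * θ') (m - 1)) :
    ‖pairSum ϖ 1 Φ Φ θ θ' m‖ = ‖unitGauss (θ⁻¹ * θ') Φ (Quad.coe D (ϖ ^ (m - 1)))‖ := by
  set η := θ⁻¹ * θ' with hηdef
  set W := unitGauss η Φ (Quad.coe D (ϖ ^ (m - 1)))
  have hm := hR.pos
  have hsupp : ∀ y : Quad D, unitGauss η Φ y ≠ 0 →
      ∃ u : (Quad D)ˣ, y = Quad.coe D (ϖ ^ (m - 1)) * u := fun y hy =>
    exists_eq_of_unitGauss_ne_zero hR hΦ le_rfl hm hη hη' hy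
  have hηm : TrivOn ϖ η m := hη.mono hm
  obtain ⟨δ, hδ⟩ : IsUnit (⟨0, 1⟩ : Quad D) := by
    rw [isUnit_iff_norm_isUnit, quad_norm]
    simpa using hD
  -- The summand, restricted to the `z` for which it can be nonzero.
  let f : (Quad D)ˣ → ℂ := fun z => if IsNormOne ϖ m (z : Quad D) then
    (θ' z : ℂ) * unitGauss η Φ (1 - z) else 0
  have h1 : pairSum ϖ 1 Φ Φ θ θ' m = ∑ z, f z := by
    rw [pairSum_eq_sum]
    refine Finset.sum_congr rfl fun z _ => ?_
    have hdvd : ϖ ^ m ∣ norm (z : Quad D) - 1 ↔ norm (z : Quad D) = 1 := by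
      rw [hR.pow_eq_zero, zero_dvd_iff, sub_eq_zero]
    simp only [f, hdvd]
    split_ifs with h2 h3 h3
    · rfl
    · rw [mul_eq_zero]
      right
      by_contra h4
      obtain ⟨u, hu⟩ := hsupp _ h4
      exact h3 ⟨h2, u, hu⟩
    · exact absurd h3.1 h2
    · rfl
  -- At `z = g / star g` the difference `1 - z` is a scalar times `δ ϖ ^ (m - 1) / star g`.
  have h2 : ∀ g : orderUnits ϖ D (m - 1), f (normOneHom D g) = (η δ)⁻¹ * W *
      (((θ * θ') g : ℂˣ) - if ((g : (Quad D)ˣ) : Quad D).im = 0 then 1 else 0) := by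
    rintro ⟨g, hg⟩
    simp only [f]
    rw [if_pos (isNormOne_normOneHom hg)]
    split_ifs with him
    · have h3 : normOneHom D g = 1 := by
        rw [normOneHom_apply, mul_inv_eq_one]
        ext1
        rw [coe_unitStar]
        ext <;> simp [him]
      rw [char_eq_one_of_im_eq_zero (hθ.mul hθ') him, h3]
      simp only [Units.val_one, sub_self, mul_zero, map_one, one_mul]
      by_contra h4
      obtain ⟨u, hu⟩ := hsupp _ h4
      have h5 : Quad.coe D (ϖ ^ (m - 1)) = 0 := by
        have := congr_arg (· * ((u⁻¹ : (Quad D)ˣ) : Quad D)) hu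
        simpa [mul_assoc] using this.symm
      exact hR.pow_ne_zero (by simpa using congr_arg QuadraticAlgebra.re h5)
    · obtain ⟨β, hβ⟩ := mem_orderUnits.mp hg
      have hβu : IsUnit (-2 * β) := by
        refine (hR.two.neg).mul ?_
        rw [hR.isUnit_iff, ← hR.pow_pred_mul_eq_zero, ← hβ]
        exact him
      obtain ⟨b, hb⟩ := hβu
      have h3 : 1 - (normOneHom D g : Quad D) = ((Quad.coeUnit D b * (δ * (unitStar g)⁻¹) :
          (Quad D)ˣ) : Quad D) * Quad.coe D (ϖ ^ (m - 1)) := by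
        rw [one_sub_normOneHom, Units.val_mul, Units.val_mul, ← mul_assoc, mul_right_comm]
        congr 1
        rw [hδ, Quad.val_coeUnit, hb, hβ]
        ext <;> simp
        ring
      have h4 : η (Quad.coeUnit D b * (δ * (unitStar g)⁻¹)) = η (δ * (unitStar g)⁻¹) :=
        char_congr hηm (a := b) rfl
      rw [h3, unitGauss_unit_mul, char_normOneHom hθ', sub_zero,
        h4, map_mul, map_inv, char_unitStar hηm, inv_inv]
      simp only [hηdef, MonoidHom.mul_apply, MonoidHom.inv_apply, W]
      push_cast
      field_simp
  -- The fibres of `g ↦ g / star g` are cosets of the scalars.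
  have hfib : ∑ g : orderUnits ϖ D (m - 1), f (normOneHom D g)
      = Fintype.card {g : orderUnits ϖ D (m - 1) // ((g : (Quad D)ˣ) : Quad D).im = 0}
        * ∑ z, f z := by
    let φ : orderUnits ϖ D (m - 1) →* (Quad D)ˣ := (normOneHom D).comp (orderUnits ϖ D (m - 1)).subtype
    have hφ : ∀ g, φ g = normOneHom D g := fun g => rfl
    rw [← Finset.sum_fiberwise Finset.univ φ, Finset.mul_sum]
    refine Finset.sum_congr rfl fun z _ => ?_
    by_cases hz : IsNormOne ϖ m (z : Quad D)
    · have h4 : ∀ g ∈ Finset.univ.filter (fun g => φ g = z), f (normOneHom D g) = f z := by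
        intro g hg
        rw [← hφ, (Finset.mem_filter.mp hg).2]
      rw [Finset.sum_congr rfl h4, Finset.sum_const, nsmul_eq_mul]
      congr 2
      obtain ⟨g, hg, hgz⟩ := hz.exists_eq hR hD
      rw [MonoidHom.card_fiber_eq_of_mem_range φ (x := z) (y := 1) ⟨⟨g, hg⟩, hgz⟩ ⟨1, map_one _⟩,
        Fintype.card_subtype]
      congr 1
      ext g
      simp only [Finset.mem_filter, Finset.mem_univ, true_and]
      rw [hφ, normOneHom_apply, mul_inv_eq_one]
      constructor
      · intro h
        have := congr_arg (fun u : (Quad D)ˣ => (u : Quad D).im) h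
        simp at this
        exact (hR.two.mul_right_eq_zero).mp (by linear_combination this)
      · intro h
        ext1
        rw [coe_unitStar]
        ext <;> simp [h]
    · have : f z = 0 := if_neg hz
      rw [this, mul_zero]
      refine Finset.sum_eq_zero fun g hg => ?_
      rw [← hφ, (Finset.mem_filter.mp hg).2, this]
  -- The character `θ θ'` is nontrivial on these `g`, so that only the correction at the scalars
  -- remains.
  have hsum : ∑ g : orderUnits ϖ D (m - 1), f (normOneHom D g)
      = -((η δ)⁻¹ * W *
        Fintype.card {g : orderUnits ϖ D (m - 1) // ((g : (Quad D)ˣ) : Quad D).im = 0}) := by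
    rw [Finset.sum_congr rfl fun g _ => h2 g, ← Finset.mul_sum, Finset.sum_sub_distrib]
    simp only [TrivOn, not_forall] at hθθ'
    obtain ⟨g, hg, hθg⟩ := hθθ'
    rw [sum_eq_zero_of_mul_left (⟨g, hg⟩ : orderUnits ϖ D (m - 1))
      (c := (((θ * θ') g : ℂˣ) : ℂ)) (fun h => hθg (Units.val_eq_one.mp h)) (fun x => by
        rw [Subgroup.coe_mul, map_mul, Units.val_mul])]
    rw [Finset.sum_boole, Fintype.card_subtype]
    ring
  rw [hfib, ← h1] at hsum
  have hcard : (Fintype.card {g : orderUnits ϖ D (m - 1) //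
      ((g : (Quad D)ˣ) : Quad D).im = 0} : ℂ) ≠ 0 := by
    rw [Nat.cast_ne_zero]
    exact (Fintype.card_pos_iff.mpr ⟨⟨1, by simp⟩⟩).ne'
  have h6 : pairSum ϖ 1 Φ Φ θ θ' m = -((η δ)⁻¹ * W) := by
    apply mul_left_cancel₀ hcard
    rw [hsum]
    ring
  rw [h6, _root_.norm_neg, norm_mul, Units.val_inv_eq_inv_val, norm_inv, norm_char_eq_one, inv_one,
    one_mul]

end Boundary

/-! ### Evaluation of the Gauss sums of the trivial character -/

section Evaluation

open scoped Classical
open QuadraticAlgebra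

variable {R : Type*} [CommRing R] {D D' : R} {ϖ : R} {m : ℕ}

/-- The additive character `a + b δ ↦ Ψ(a)`. -/
def reChar (D : R) (Ψ : AddChar R ℂ) : AddChar (Quad D) ℂ where
  toFun x := Ψ x.re
  map_zero_eq_one' := by simp
  map_add_eq_mul' x y := by rw [re_add, AddChar.map_add_eq_mul]

/-- The additive character `a + b δ ↦ Ψ(b)`. -/
def imChar (D : R) (Ψ : AddChar R ℂ) : AddChar (Quad D) ℂ where
  toFun x := Ψ x.im
  map_zero_eq_one' := by simp
  map_add_eq_mul' x y := by rw [im_add, AddChar.map_add_eq_mul]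

@[simp] lemma reChar_apply (Ψ : AddChar R ℂ) (x : Quad D) : reChar D Ψ x = Ψ x.re := rfl

@[simp] lemma imChar_apply (Ψ : AddChar R ℂ) (x : Quad D) : imChar D Ψ x = Ψ x.im := rfl

lemma reChar_isPrimitive (hR : IsOddChainRing ϖ m) (hD : IsUnit D) {Ψ : AddChar R ℂ}
    (hΨ : ∃ t, Ψ (ϖ ^ (m - 1) * t) ≠ 1) : (reChar D Ψ).IsPrimitive := by
  intro y hy h
  by_cases hre : y.re = 0
  · have him : D * y.im ≠ 0 := fun h0 => hy (by
      ext
      · exact hre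
      · exact (hD.mul_right_eq_zero).mp h0)
    obtain ⟨t, ht⟩ := hR.exists_addChar_ne_one hΨ him
    have := DFunLike.congr_fun h (⟨0, t⟩ : Quad D)
    rw [AddChar.mulShift_apply, AddChar.one_apply, reChar_apply] at this
    exact ht (by simpa [hre] using this)
  · obtain ⟨t, ht⟩ := hR.exists_addChar_ne_one hΨ hre
    have := DFunLike.congr_fun h (⟨t, 0⟩ : Quad D)
    rw [AddChar.mulShift_apply, AddChar.one_apply, reChar_apply] at this
    exact ht (by simpa using this)

lemma imChar_isPrimitive (hR : IsOddChainRing ϖ m) {Ψ : AddChar R ℂ}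
    (hΨ : ∃ t, Ψ (ϖ ^ (m - 1) * t) ≠ 1) : (imChar D Ψ).IsPrimitive := by
  intro y hy h
  by_cases him : y.im = 0
  · have hre : y.re ≠ 0 := fun h0 => hy (by ext <;> assumption)
    obtain ⟨t, ht⟩ := hR.exists_addChar_ne_one hΨ hre
    have := DFunLike.congr_fun h (⟨0, t⟩ : Quad D)
    rw [AddChar.mulShift_apply, AddChar.one_apply, imChar_apply] at this
    exact ht (by simpa [him] using this)
  · obtain ⟨t, ht⟩ := hR.exists_addChar_ne_one hΨ him
    have := DFunLike.congr_fun h (⟨t, 0⟩ : Quad D)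
    rw [AddChar.mulShift_apply, AddChar.one_apply, imChar_apply] at this
    exact ht (by simpa using this)

lemma sum_units_eq_sum_ite {A : Type*} [CommRing A] [Fintype A] [DecidableEq A] (f : A → ℂ) :
    ∑ x : Aˣ, f x = ∑ x : A, if IsUnit x then f x else 0 := by
  refine Finset.sum_of_injOn (fun u : Aˣ => (u : A)) (fun _ _ _ _ h => Units.ext h) (by simp)
    ?_ (by simp)
  intro y _ hy
  rw [if_neg]
  rintro ⟨u, rfl⟩
  exact hy ⟨u, by simp, rfl⟩

variable [Fintype R]

lemma sum_addChar_mul_eq_zero {Ψ : AddChar R ℂ} {c : R} (h : ∃ t, Ψ (c * t) ≠ 1) :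
    ∑ t, Ψ (c * t) = 0 := by
  have : Ψ.mulShift c ≠ 1 := fun h0 => by
    obtain ⟨t, ht⟩ := h
    exact ht (by rw [← AddChar.mulShift_apply, h0, AddChar.one_apply])
  rw [← AddChar.sum_eq_zero_of_ne_one this]
  rfl

/-- The nonunits are the annihilator of `ϖ ^ (m - 1)`. -/
lemma card_units_add_card (hR : IsOddChainRing ϖ m) :
    Fintype.card Rˣ + Fintype.card {a : R // ϖ ^ (m - 1) * a = 0} = Fintype.card R := by
  have h : (Fintype.card Rˣ : ℂ) = ∑ t : R, (1 - if ϖ ^ (m - 1) * t = 0 then 1 else 0) := by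
    have h1 := sum_units_eq_sum_ite (A := R) (fun _ => 1)
    rw [Finset.sum_const, Finset.card_univ, nsmul_one] at h1
    rw [h1]
    refine Finset.sum_congr rfl fun t _ => ?_
    simp only [hR.isUnit_iff, hR.pow_pred_mul_eq_zero]
    split_ifs <;> simp
  rw [Finset.sum_sub_distrib, Finset.sum_boole, ← Fintype.card_subtype, Finset.sum_const,
    Finset.card_univ, nsmul_one, eq_sub_iff_add_eq] at h
  exact_mod_cast h

/-- The sum over all of `R` vanishes, and each of the nonunits contributes `1`. -/
lemma sum_units_addChar (hR : IsOddChainRing ϖ m) {Ψ : AddChar R ℂ} {c : R}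
    (h : ∃ t, Ψ (ϖ ^ (m - 1) * c * t) ≠ 1) :
    ∑ t : Rˣ, Ψ (ϖ ^ (m - 1) * c * t) = -Fintype.card {a : R // ϖ ^ (m - 1) * a = 0} := by
  rw [sum_units_eq_sum_ite (fun t => Ψ (ϖ ^ (m - 1) * c * t))]
  have h1 : ∀ t : R, (if IsUnit t then Ψ (ϖ ^ (m - 1) * c * t) else 0)
      = Ψ (ϖ ^ (m - 1) * c * t) - if ϖ ^ (m - 1) * t = 0 then 1 else 0 := by
    intro t
    simp only [hR.isUnit_iff, hR.pow_pred_mul_eq_zero]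
    split_ifs with h2
    · rw [mul_right_comm, hR.pow_pred_mul_eq_zero.mpr h2]
      simp
    · simp
  rw [Finset.sum_congr rfl fun t _ => h1 t, Finset.sum_sub_distrib, sum_addChar_mul_eq_zero h,
    Finset.sum_boole, Fintype.card_subtype, zero_sub]

lemma card_units_sub_unitGauss {Ψ : AddChar R ℂ} :
    (Fintype.card (Quad D)ˣ : ℂ) - unitGauss 1 (reChar D Ψ) (Quad.coe D (ϖ ^ (m - 1)))
      = ∑ x : Quad D, if IsUnit x then 1 - Ψ (ϖ ^ (m - 1) * x.re) else 0 := by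
  rw [← sum_units_eq_sum_ite (fun x : Quad D => 1 - Ψ (ϖ ^ (m - 1) * x.re)),
    Finset.sum_sub_distrib, unitGauss]
  simp [mul_comm]

/-- In the inert case a nonunit `x` has `ϖ ∣ re x`. -/
lemma card_units_sub_unitGauss_inert (hR : IsOddChainRing ϖ m)
    (hns : ∀ s : R, ¬ ϖ ∣ s * s - D) {Ψ : AddChar R ℂ}
    (hΨ : ∃ t, Ψ (ϖ ^ (m - 1) * t) ≠ 1) :
    (Fintype.card (Quad D)ˣ : ℂ) - unitGauss 1 (reChar D Ψ) (Quad.coe D (ϖ ^ (m - 1)))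
      = Fintype.card R ^ 2 := by
  rw [card_units_sub_unitGauss]
  have h1 : ∀ x : Quad D, (if IsUnit x then 1 - Ψ (ϖ ^ (m - 1) * x.re) else 0)
      = 1 - Ψ (ϖ ^ (m - 1) * x.re) := by
    intro x
    split_ifs with h
    · rfl
    · have hre : ϖ ∣ x.re := by
        rw [isUnit_quad_iff hR, not_not, quad_norm] at h
        have him : ϖ ∣ x.im := by
          by_contra h2
          obtain ⟨b, hb⟩ := hR.isUnit_iff.mpr h2
          apply hns (x.re * (b⁻¹ : Rˣ))
          rw [← (b * b).isUnit.dvd_mul_left]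
          convert! h using 1
          rw [← hb]
          push_cast
          linear_combination (x.re * x.re * ((b⁻¹ : Rˣ) * b + 1)) * b.inv_mul
        apply hR.dvd_of_dvd_sq
        rw [← sub_add_cancel (x.re * x.re) (D * x.im * x.im)]
        exact dvd_add h (him.mul_left _)
      rw [hR.pow_pred_mul_eq_zero.mpr hre]
      simp
  rw [Finset.sum_congr rfl fun x _ => h1 x, Finset.sum_sub_distrib]
  have h2 : ∑ x : Quad D, Ψ (ϖ ^ (m - 1) * x.re) = 0 := by
    rw [Fintype.sum_equiv (QuadraticAlgebra.equivProd D 0) (fun x => Ψ (ϖ ^ (m - 1) * x.re))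
      (fun p : R × R => Ψ (ϖ ^ (m - 1) * p.1)) (fun _ => rfl), Fintype.sum_prod_type_right]
    exact Finset.sum_eq_zero fun _ _ => sum_addChar_mul_eq_zero hΨ
  rw [h2]
  simp [card_quad]

/-- The coordinates `(a + s b, a - s b)` on a split quadratic algebra. -/
def splitEquiv (D : R) {s c : R} (hs : 2 * s * c = 1) : Quad D ≃ R × R where
  toFun x := (x.re + s * x.im, x.re - s * x.im)
  invFun p := ⟨s * c * (p.1 + p.2), c * (p.1 - p.2)⟩
  left_inv x := by
    ext
    · linear_combination x.re * hs
    · linear_combination x.im * hs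
  right_inv p := by
    ext
    · linear_combination p.1 * hs
    · linear_combination p.2 * hs

/-- In the coordinates of `R × R` both terms are products of sums over the units of `R`. -/
lemma card_units_sub_unitGauss_split (hR : IsOddChainRing ϖ m) {s : R} (hs : IsUnit s)
    (hD : D = s * s) {Ψ : AddChar R ℂ} (hΨ : ∃ t, Ψ (ϖ ^ (m - 1) * t) ≠ 1) :
    (Fintype.card (Quad D)ˣ : ℂ) - unitGauss 1 (reChar D Ψ) (Quad.coe D (ϖ ^ (m - 1)))
      = (Fintype.card Rˣ : ℂ) ^ 2 - (Fintype.card {a : R // ϖ ^ (m - 1) * a = 0} : ℂ) ^ 2 := by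
  obtain ⟨c, hc⟩ := (hR.two.mul hs).exists_right_inv
  rw [card_units_sub_unitGauss]
  let f : R × R → ℂ := fun p =>
    (if IsUnit p.1 then (1 : ℂ) else 0) * (if IsUnit p.2 then 1 else 0)
      - (if IsUnit p.1 then Ψ (ϖ ^ (m - 1) * (s * c) * p.1) else 0)
        * (if IsUnit p.2 then Ψ (ϖ ^ (m - 1) * (s * c) * p.2) else 0)
  have h1 : ∀ x : Quad D, (if IsUnit x then 1 - Ψ (ϖ ^ (m - 1) * x.re) else 0)
      = f (splitEquiv D hc x) := by
    intro x
    have h2 : IsUnit x ↔ IsUnit (x.re + s * x.im) ∧ IsUnit (x.re - s * x.im) := by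
      rw [← IsUnit.mul_iff, isUnit_iff_norm_isUnit, quad_norm]
      congr! 1
      linear_combination (-x.im * x.im) * hD
    have h3 : Ψ (ϖ ^ (m - 1) * x.re) = Ψ (ϖ ^ (m - 1) * (s * c) * (x.re + s * x.im))
        * Ψ (ϖ ^ (m - 1) * (s * c) * (x.re - s * x.im)) := by
      rw [← AddChar.map_add_eq_mul]
      congr 1
      linear_combination (-ϖ ^ (m - 1) * x.re) * hc
    simp only [f, splitEquiv, Equiv.coe_fn_mk]
    by_cases hu : IsUnit (x.re + s * x.im) <;> by_cases hv : IsUnit (x.re - s * x.im) <;>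
      simp [h2, h3, hu, hv]
  have hsc : ∃ t, Ψ (ϖ ^ (m - 1) * (s * c) * t) ≠ 1 := by
    obtain ⟨t, ht⟩ := hΨ
    refine ⟨2 * t, ?_⟩
    convert! ht using 2
    linear_combination (ϖ ^ (m - 1) * t) * hc
  rw [Fintype.sum_equiv (splitEquiv D hc) _ f h1, Fintype.sum_prod_type]
  have h4 : (Fintype.card Rˣ : ℂ) = ∑ t : R, if IsUnit t then 1 else 0 := by
    rw [← sum_units_eq_sum_ite (fun _ => 1)]
    simp
  have h5 := Finset.sum_mul_sum Finset.univ Finset.univ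
    (fun t : R => if IsUnit t then Ψ (ϖ ^ (m - 1) * (s * c) * t) else 0)
    (fun t : R => if IsUnit t then Ψ (ϖ ^ (m - 1) * (s * c) * t) else 0)
  rw [← sum_units_eq_sum_ite (fun t => Ψ (ϖ ^ (m - 1) * (s * c) * t)),
    sum_units_addChar hR hsc] at h5
  simp only [f, Finset.sum_sub_distrib]
  rw [← h5, h4, sq, sq, Finset.sum_mul_sum, neg_mul_neg]

end Evaluation

section NonIsomorphic

open scoped Classical
open QuadraticAlgebra

variable {R : Type*} [CommRing R] [Fintype R] {D D' : R} {ϖ : R} {m : ℕ}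

/-! ### Correlations of Gauss sums of characters of different algebras -/

/-- In the ramified case the sum is empty: norms of units are squares modulo `ϖ`, and `r` is not. -/
lemma pairSum_eq_zero_of_dvd (hR : IsOddChainRing ϖ m) (hD : ϖ ∣ D) (hD' : ϖ ∣ D') {r : R}
    (hr : ∀ a b : R, IsUnit a → ¬ ϖ ∣ a * a - r * (b * b))
    (Φ : AddChar (Quad D) ℂ) (Φ' : AddChar (Quad D') ℂ)
    (θ : (Quad D)ˣ →* ℂˣ) (θ' : (Quad D')ˣ →* ℂˣ) {n : ℕ} (hn : 1 ≤ n) :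
    pairSum ϖ r Φ Φ' θ θ' n = 0 := by
  refine Finset.sum_eq_zero fun x _ => Finset.sum_eq_zero fun y _ => if_neg fun h => ?_
  have hx : IsUnit (x : Quad D).re := by
    have := isUnit_iff_norm_isUnit.mp x.isUnit
    rw [quad_norm, hR.isUnit_iff] at this
    rw [hR.isUnit_iff]
    exact fun h0 => this (dvd_sub (h0.mul_left _) ((hD.mul_right _).mul_right _))
  apply hr _ (y : Quad D').re hx
  have h1 := (dvd_pow_self ϖ (by omega : n ≠ 0)).trans h
  rw [quad_norm, quad_norm] at h1
  have h2 : ϖ ∣ D * ((x : Quad D).im * (x : Quad D).im)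
      - r * (D' * ((y : Quad D').im * (y : Quad D').im)) :=
    dvd_sub (hD.mul_right _) ((hD'.mul_right _).mul_left _)
  convert! dvd_add h1 h2 using 1
  ring

/-- The terms with `ϖ ∣ im x` contribute nothing to a sum against `θ⁻¹(x) Φ(x)`. -/
lemma sum_eq_zero_of_dvd_im (hR : IsOddChainRing ϖ m) (hm : 2 ≤ m) (Ψ : AddChar R ℂ)
    {θ : (Quad D)ˣ →* ℂˣ} (hθ : TrivOn ϖ θ m) (hθ' : ¬ TrivOn ϖ θ (m - 1)) (f : R → ℂ) :
    ∑ x : (Quad D)ˣ, (if ϖ ∣ (x : Quad D).im then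
      f (norm (x : Quad D)) * (θ x * reChar D Ψ x) else 0) = 0 := by
  have hD : ϖ ∣ D * ϖ ^ (m - 1) := (dvd_pow_self ϖ (by omega)).mul_left _
  obtain ⟨t, u, hu, hθu⟩ := exists_char_pow_pred_ne_one hR hD hθ hθ'
  have h0 := mul_pow_pred_sq hR hD
  have hNu : norm (u : Quad D) = 1 := by
    rw [quad_norm, hu]; simp; linear_combination (t * t) * h0
  refine sum_eq_zero_of_mul_left u (c := (θ u : ℂ)) (fun h => hθu (Units.val_eq_one.mp h))
    fun x => ?_
  have him : ϖ ∣ ((u * x : (Quad D)ˣ) : Quad D).im ↔ ϖ ∣ (x : Quad D).im := by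
    rw [Units.val_mul, im_mul, hu]
    simp only [one_mul, zero_mul, add_zero]
    exact (dvd_add_left (((dvd_pow_self ϖ (by omega)).mul_right _).mul_right _))
  simp only [him]
  split_ifs with h
  · have h1 : reChar D Ψ ((u * x : (Quad D)ˣ) : Quad D) = reChar D Ψ x := by
      rw [reChar_apply, reChar_apply, Units.val_mul, re_mul, hu]
      congr 1
      have := hR.pow_pred_mul_eq_zero.mpr h
      simp only [one_mul]
      linear_combination (D * t) * this
    rw [h1, Units.val_mul, map_mul QuadraticAlgebra.norm, hNu, one_mul, map_mul]
    push_cast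
    ring
  · rw [mul_zero]

/-- For `m ≥ 2` only pairs with invertible `im x`, `im y` contribute, and then also only those with
`re x ≡ re y` modulo `ϖ`. There are no such pairs of equal norm, if the algebras are different. -/
lemma pairSum_eq_zero_of_not_square (hR : IsOddChainRing ϖ m) (hm : 2 ≤ m)
    (hDD' : ∀ a b : R, IsUnit a → IsUnit b → ¬ ϖ ∣ D * (a * a) - D' * (b * b)) {Ψ : AddChar R ℂ}
    (hΨ : ∃ t, Ψ (ϖ ^ (m - 1) * t) ≠ 1)
    {θ : (Quad D)ˣ →* ℂˣ} (hθ : TrivOn ϖ θ m) (hθ1 : ¬ TrivOn ϖ θ (m - 1))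
    {θ' : (Quad D')ˣ →* ℂˣ} (hθ' : TrivOn ϖ θ' m) (hθ'1 : ¬ TrivOn ϖ θ' (m - 1))
    {n : ℕ} (hn : 1 ≤ n) :
    pairSum ϖ 1 (reChar D Ψ) (reChar D' Ψ) θ θ' n = 0 := by
  have hpm : ϖ ∣ ϖ ^ (m - 1) := dvd_pow_self ϖ (by omega)
  set F : (Quad D)ˣ → (Quad D')ˣ → ℂ := fun x y =>
    if ϖ ^ n ∣ norm (x : Quad D) - 1 * norm (y : Quad D') then
      (((θ x)⁻¹ : ℂˣ) * reChar D Ψ x : ℂ) * (θ' y * reChar D' Ψ (-y)) else 0 with hF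
  -- The terms with `ϖ ∣ im x` or `ϖ ∣ im y` can be dropped; `G` is the remaining summand.
  have hx0 : ∀ y, ∑ x : (Quad D)ˣ, (if ϖ ∣ (x : Quad D).im then F x y else 0) = 0 := by
    intro y
    have := sum_eq_zero_of_dvd_im hR hm Ψ (θ := θ⁻¹) hθ.inv
      (fun h => hθ1 (by have := h.inv; rwa [show (θ⁻¹)⁻¹ = θ from inv_inv θ] at this))
      (fun N => if ϖ ^ n ∣ N - 1 * norm (y : Quad D') then
        (θ' y * reChar D' Ψ (-y) : ℂ) else 0)
    refine Eq.trans ?_ this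
    refine Finset.sum_congr rfl fun x _ => if_congr Iff.rfl ?_ rfl
    simp only [hF, MonoidHom.inv_apply]
    split_ifs
    · ring
    · rw [zero_mul]
  have hy0 : ∀ x, ∑ y : (Quad D')ˣ, (if ϖ ∣ (y : Quad D').im then F x y else 0) = 0 := by
    intro x
    have := sum_eq_zero_of_dvd_im hR hm Ψ⁻¹ (θ := θ') hθ' hθ'1
      (fun N => if ϖ ^ n ∣ norm (x : Quad D) - 1 * N then
        (((θ x)⁻¹ : ℂˣ) * reChar D Ψ x : ℂ) else 0)
    refine Eq.trans ?_ this
    refine Finset.sum_congr rfl fun y _ => if_congr Iff.rfl ?_ rfl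
    simp only [hF]
    have h1 : reChar D' Ψ (-(y : Quad D')) = reChar D' Ψ⁻¹ y := by
      rw [reChar_apply, reChar_apply, AddChar.inv_apply, re_neg]
    rw [h1]
    split_ifs
    · rfl
    · rw [zero_mul]
  set G : (Quad D)ˣ → (Quad D')ˣ → ℂ := fun x y =>
    if ϖ ∣ (x : Quad D).im then 0 else if ϖ ∣ (y : Quad D').im then 0 else F x y with hG
  have h1 : pairSum ϖ 1 (reChar D Ψ) (reChar D' Ψ) θ θ' n = ∑ x, ∑ y, G x y := by
    have e1 : ∑ x, ∑ y, F x y = ∑ x : (Quad D)ˣ, ∑ y : (Quad D')ˣ, (if ϖ ∣ (x : Quad D).im then 0 else F x y) := by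
      have : ∀ (x : (Quad D)ˣ) (y : (Quad D')ˣ), F x y = (if ϖ ∣ (x : Quad D).im then F x y else 0)
          + (if ϖ ∣ (x : Quad D).im then 0 else F x y) := by
        intro x y; split_ifs <;> simp
      rw [Finset.sum_congr rfl fun x _ => Finset.sum_congr rfl fun y _ => this x y]
      simp only [Finset.sum_add_distrib]
      rw [Finset.sum_comm, Finset.sum_eq_zero fun y _ => hx0 y, zero_add]
    change ∑ x, ∑ y, F x y = _
    rw [e1]
    refine Finset.sum_congr rfl fun x _ => ?_
    by_cases hx : ϖ ∣ (x : Quad D).im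
    · simp [hG, hx]
    · simp only [hG, if_neg hx]
      have : ∀ y : (Quad D')ˣ, F x y = (if ϖ ∣ (y : Quad D').im then F x y else 0)
          + (if ϖ ∣ (y : Quad D').im then 0 else F x y) := by
        intro y; split_ifs <;> simp
      rw [Finset.sum_congr rfl fun y _ => this y, Finset.sum_add_distrib, hy0, zero_add]
  have hc : ∀ t : R, ∃ c : Rˣ, (c : R) = 1 + ϖ ^ (m - 1) * t := fun t =>
    ⟨(hR.isUnit_add isUnit_one (hpm.mul_right t)).unit, rfl⟩
  choose c hc using hc
  -- Scaling both `x` and `y` by `1 + ϖ ^ (m - 1) t` does not change the sum.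
  have h2 : ∀ t : R, ∑ x, ∑ y, G x y
      = ∑ x : (Quad D)ˣ, ∑ y : (Quad D')ˣ, G x y *
        Ψ (t * (ϖ ^ (m - 1) * ((x : Quad D).re - (y : Quad D').re))) := by
    intro t
    refine (Fintype.sum_equiv (Equiv.mulLeft (Quad.coeUnit D (c t))) _ _ fun x =>
      Fintype.sum_equiv (Equiv.mulLeft (Quad.coeUnit D' (c t))) _ _ fun y => ?_).symm
    simp only [hG, hF, Equiv.coe_mulLeft, Units.val_mul, Quad.val_coeUnit]
    have i1 : ϖ ∣ (Quad.coe D (c t) * (x : Quad D)).im ↔ ϖ ∣ (x : Quad D).im := by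
      simp
    have i2 : ϖ ∣ (Quad.coe D' (c t) * (y : Quad D')).im ↔ ϖ ∣ (y : Quad D').im := by
      simp
    have i3 : ϖ ^ n ∣ norm (Quad.coe D (c t) * (x : Quad D))
        - 1 * norm (Quad.coe D' (c t) * (y : Quad D'))
        ↔ ϖ ^ n ∣ norm (x : Quad D) - 1 * norm (y : Quad D') := by
      rw [← ((c t) * (c t)).isUnit.dvd_mul_left (b := norm (x : Quad D) - _)]
      have : norm (Quad.coe D (c t) * (x : Quad D))
        - 1 * norm (Quad.coe D' (c t) * (y : Quad D'))
        = ((c t * c t : Rˣ) : R) * (norm (x : Quad D) - 1 * norm (y : Quad D')) := by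
        rw [map_mul, map_mul, quad_norm (Quad.coe D _), quad_norm (Quad.coe D' _)]
        simp
        ring
      rw [this]
    have i4 : θ (Quad.coeUnit D (c t) * x) = θ x := char_congr hθ (a := c t) rfl
    have i5 : θ' (Quad.coeUnit D' (c t) * y) = θ' y := char_congr hθ' (a := c t) rfl
    simp only [i1, i2, i3, i4, i5]
    split_ifs
    · rw [zero_mul]
    · rw [zero_mul]
    · have e : reChar D Ψ x * reChar D' Ψ (-y) *
          Ψ (t * (ϖ ^ (m - 1) * ((x : Quad D).re - (y : Quad D').re)))
          = reChar D Ψ (Quad.coe D (c t) * x) * reChar D' Ψ (-(Quad.coe D' (c t) * y)) := by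
        simp only [reChar_apply]
        rw [← AddChar.map_add_eq_mul, ← AddChar.map_add_eq_mul, ← AddChar.map_add_eq_mul]
        congr 1
        simp [hc]
        ring
      linear_combination (((θ x)⁻¹ : ℂˣ) * θ' y : ℂ) * e
    · rw [zero_mul]
  -- The sum over `t` vanishes unless `re x ≡ re y` modulo `ϖ`; with `N x ≡ N y` this would give
  -- `D (im x)² ≡ D' (im y)²`.
  have h3 : (Fintype.card R : ℂ) * ∑ x, ∑ y, G x y = 0 := by
    have : ∑ _t : R, ∑ x, ∑ y, G x y = 0 := by
      rw [Finset.sum_congr rfl fun t _ => h2 t, Finset.sum_comm]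
      refine Finset.sum_eq_zero fun x _ => ?_
      rw [Finset.sum_comm]
      refine Finset.sum_eq_zero fun y _ => ?_
      rw [← Finset.mul_sum]
      by_cases hGxy : G x y = 0
      · rw [hGxy, zero_mul]
      · simp only [hG, hF] at hGxy
        split_ifs at hGxy with i1 i2 i3
        · exact absurd rfl hGxy
        · exact absurd rfl hGxy
        · have hne : ϖ ^ (m - 1) * ((x : Quad D).re - (y : Quad D').re) ≠ 0 := by
            rw [Ne, hR.pow_pred_mul_eq_zero]
            intro h
            apply hDD' _ _ (hR.isUnit_iff.mpr i1) (hR.isUnit_iff.mpr i2)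
            have h4 := (dvd_pow_self ϖ (by omega : n ≠ 0)).trans i3
            rw [quad_norm, quad_norm] at h4
            convert! dvd_sub (h.mul_right ((x : Quad D).re + (y : Quad D').re)) h4 using 1
            ring
          obtain ⟨s, hs⟩ := hR.exists_addChar_ne_one hΨ hne
          have := sum_addChar_mul_eq_zero ⟨s, hs⟩
          simp only [mul_comm _ (ϖ ^ (m - 1) * ((x : Quad D).re - (y : Quad D').re))]
          rw [this, mul_zero]
        · exact absurd rfl hGxy
    simpa using this
  rw [h1]
  simpa using h3

/-- Over a field the correlation is computed by averaging over the scalars: only pairs with equal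
norm and trace survive, and these are scalars, if the algebras are different. -/
lemma pairSum_one_of_not_square (hR : IsOddChainRing ϖ 1)
    (hDD' : ∀ a b : R, D * (a * a) = D' * (b * b) → a = 0 ∧ b = 0) {Ψ : AddChar R ℂ}
    (hΨ : ∃ t, Ψ (ϖ ^ (1 - 1) * t) ≠ 1)
    {θ : (Quad D)ˣ →* ℂˣ} (hθ : TrivOn ϖ θ 1)
    {θ' : (Quad D')ˣ →* ℂˣ} (hθ' : TrivOn ϖ θ' 1)
    (hsq : ¬ TrivOn ϖ (θ * θ) 0 ∨ ¬ TrivOn ϖ (θ' * θ') 0) :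
    pairSum ϖ 1 (reChar D Ψ) (reChar D' Ψ) θ θ' 1 = Fintype.card R := by
  have hϖ : ϖ = 0 := by simpa using hR.pow_eq_zero
  have hdvd : ∀ (x : (Quad D)ˣ) (y : (Quad D')ˣ),
      ϖ ^ 1 ∣ norm (x : Quad D) - 1 * norm (y : Quad D')
        ↔ norm (x : Quad D) = norm (y : Quad D') := by
    intro x y
    rw [hϖ, zero_pow one_ne_zero, zero_dvd_iff, one_mul, sub_eq_zero]
  have hcard : (Fintype.card Rˣ : ℂ) ≠ 0 := by simp
  apply mul_left_cancel₀ hcard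
  -- Scaling by `t`.
  have h1 : ∀ t : Rˣ, pairSum ϖ 1 (reChar D Ψ) (reChar D' Ψ) θ θ' 1
      = ∑ x : (Quad D)ˣ, ∑ y : (Quad D')ˣ, if norm (x : Quad D) = norm (y : Quad D') then
        (((θ x)⁻¹ : ℂˣ) * θ' y : ℂ) * Ψ (((x : Quad D).re - (y : Quad D').re) * t) else 0 := by
    intro t
    rw [pairSum]
    refine (Fintype.sum_equiv (Equiv.mulLeft (Quad.coeUnit D t)) _ _ fun x =>
      Fintype.sum_equiv (Equiv.mulLeft (Quad.coeUnit D' t)) _ _ fun y => ?_).symm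
    have i3 : norm ((Equiv.mulLeft (Quad.coeUnit D t) x : (Quad D)ˣ) : Quad D)
        = norm ((Equiv.mulLeft (Quad.coeUnit D' t) y : (Quad D')ˣ) : Quad D')
        ↔ norm (x : Quad D) = norm (y : Quad D') := by
      simp only [Equiv.coe_mulLeft, Units.val_mul, Quad.val_coeUnit, map_mul]
      rw [quad_norm (Quad.coe D _), quad_norm (Quad.coe D' _)]
      simpa using (t * t).isUnit.mul_right_inj
    have i4 : θ (Quad.coeUnit D t * x) = θ x := char_congr hθ (a := t) rfl
    have i5 : θ' (Quad.coeUnit D' t * y) = θ' y := char_congr hθ' (a := t) rfl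
    simp only [hdvd, i3]
    refine if_congr Iff.rfl ?_ rfl
    rw [Equiv.coe_mulLeft, Equiv.coe_mulLeft, i4, i5, mul_mul_mul_comm]
    congr 1
    rw [reChar_apply, reChar_apply, ← AddChar.map_add_eq_mul]
    congr 1
    simp
    ring
  have h2 : ∀ a : R, ∑ t : Rˣ, Ψ (a * t) = (if a = 0 then (Fintype.card R : ℂ) else 0) - 1 := by
    intro a
    have hu : Fintype.card {a : R // ϖ ^ (1 - 1) * a = 0} = 1 := by
      simp
    split_ifs with ha
    · have := card_units_add_card hR
      rw [hu] at this
      rw [← this]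
      simp [ha]
    · have := sum_units_addChar hR (Ψ := Ψ) (c := a) (by
        simpa using hR.exists_addChar_ne_one hΨ ha)
      rw [hu] at this
      simpa using this
  -- One of the characters is nontrivial on the elements `g / star g` of norm `1`.
  have h3 : ∑ x : (Quad D)ˣ, ∑ y : (Quad D')ˣ, (if norm (x : Quad D) = norm (y : Quad D') then
        (((θ x)⁻¹ : ℂˣ) * θ' y : ℂ) else 0) = 0 := by
    rcases hsq with h | h
    · rw [Finset.sum_comm]
      simp only [TrivOn, not_forall] at h
      obtain ⟨g, -, hg⟩ := h
      refine Finset.sum_eq_zero fun y _ => sum_eq_zero_of_mul_left (normOneHom D g)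
        (c := ((θ⁻¹ (normOneHom D g) : ℂˣ) : ℂ)) ?_ fun x => ?_
      · intro h0
        rw [Units.val_eq_one, MonoidHom.inv_apply, inv_eq_one, char_normOneHom hθ] at h0
        exact hg h0
      · rw [Units.val_mul, map_mul QuadraticAlgebra.norm, norm_normOneHom, one_mul, map_mul]
        simp only [MonoidHom.inv_apply]
        split_ifs
        · push_cast
          rw [mul_inv]
          ring
        · rw [mul_zero]
    · simp only [TrivOn, not_forall] at h
      obtain ⟨g, -, hg⟩ := h
      refine Finset.sum_eq_zero fun x _ => sum_eq_zero_of_mul_left (normOneHom D' g)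
        (c := ((θ' (normOneHom D' g) : ℂˣ) : ℂ)) ?_ fun y => ?_
      · intro h0
        rw [Units.val_eq_one, char_normOneHom hθ'] at h0
        exact hg h0
      · rw [Units.val_mul, map_mul QuadraticAlgebra.norm, norm_normOneHom, one_mul, map_mul]
        split_ifs
        · push_cast
          ring
        · rw [mul_zero]
  -- Elements of equal norm and trace are equal scalars, and the characters are trivial on scalars.
  have h4 : ∑ x : (Quad D)ˣ, ∑ y : (Quad D')ˣ, (if norm (x : Quad D) = norm (y : Quad D') ∧
      (x : Quad D).re - (y : Quad D').re = 0 then (((θ x)⁻¹ : ℂˣ) * θ' y : ℂ) else 0)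
      = Fintype.card Rˣ := by
    have h5 : ∀ (x : (Quad D)ˣ) (y : (Quad D')ˣ), (if norm (x : Quad D) = norm (y : Quad D') ∧
        (x : Quad D).re - (y : Quad D').re = 0 then (((θ x)⁻¹ : ℂˣ) * θ' y : ℂ) else 0)
        = ∑ a : Rˣ, if x = Quad.coeUnit D a then (if y = Quad.coeUnit D' a then 1 else 0) else 0 := by
      intro x y
      split_ifs with h
      · obtain ⟨hN, hre⟩ := h
        have hre' : (x : Quad D).re = (y : Quad D').re := sub_eq_zero.mp hre
        obtain ⟨hx, hy⟩ := hDD' (x : Quad D).im (y : Quad D').im (by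
          rw [quad_norm, quad_norm, hre'] at hN
          linear_combination -hN)
        have hu : IsUnit (x : Quad D).re := by
          have := isUnit_iff_norm_isUnit.mp x.isUnit
          rw [quad_norm, hx, mul_zero, sub_zero] at this
          exact isUnit_of_mul_isUnit_left this
        obtain ⟨a, ha⟩ := hu
        have hxa : x = Quad.coeUnit D a := by
          ext1; rw [Quad.val_coeUnit]; ext <;> simp [ha, hx]
        have hya : y = Quad.coeUnit D' a := by
          ext1; rw [Quad.val_coeUnit]; ext <;> simp [ha, hre', hy]
        rw [Finset.sum_eq_single a]
        · rw [if_pos hxa, if_pos hya, char_eq_one_of_im_eq_zero hθ hx,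
            char_eq_one_of_im_eq_zero hθ' hy]
          simp
        · intro b _ hb
          rw [if_neg]
          rintro rfl
          apply hb
          have := congr_arg (fun u : (Quad D)ˣ => (u : Quad D).re) hxa
          ext1
          simpa using this
        · simp
      · refine (Finset.sum_eq_zero fun a _ => ?_).symm
        split_ifs with hx hy
        · exfalso
          apply h
          rw [hx, hy, quad_norm, quad_norm]
          simp
        · rfl
        · rfl
    rw [Finset.sum_congr rfl fun x _ => Finset.sum_congr rfl fun y _ => h5 x y]
    rw [Finset.sum_congr rfl fun x _ => Finset.sum_comm, Finset.sum_comm]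
    have h6 : ∀ a : Rˣ, ∑ x : (Quad D)ˣ, ∑ y : (Quad D')ˣ,
        (if x = Quad.coeUnit D a then (if y = Quad.coeUnit D' a then (1 : ℂ) else 0) else 0)
        = 1 := by
      intro a
      rw [Finset.sum_eq_single (Quad.coeUnit D a)]
      · simp
      · intro b _ hb
        simp [hb]
      · simp
    rw [Finset.sum_congr rfl fun a _ => h6 a]
    simp
  calc (Fintype.card Rˣ : ℂ) * pairSum ϖ 1 (reChar D Ψ) (reChar D' Ψ) θ θ' 1
      = ∑ _t : Rˣ, pairSum ϖ 1 (reChar D Ψ) (reChar D' Ψ) θ θ' 1 := by simp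
    _ = ∑ x : (Quad D)ˣ, ∑ y : (Quad D')ˣ, if norm (x : Quad D) = norm (y : Quad D') then
        (((θ x)⁻¹ : ℂˣ) * θ' y : ℂ) *
          ∑ t : Rˣ, Ψ (((x : Quad D).re - (y : Quad D').re) * t) else 0 := by
        rw [Finset.sum_congr rfl fun t _ => h1 t, Finset.sum_comm]
        refine Finset.sum_congr rfl fun x _ => ?_
        rw [Finset.sum_comm]
        refine Finset.sum_congr rfl fun y _ => ?_
        split_ifs
        · rw [Finset.mul_sum]
        · simp
    _ = (Fintype.card R : ℂ) * (∑ x : (Quad D)ˣ, ∑ y : (Quad D')ˣ,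
          (if norm (x : Quad D) = norm (y : Quad D') ∧
      (x : Quad D).re - (y : Quad D').re = 0 then (((θ x)⁻¹ : ℂˣ) * θ' y : ℂ) else 0))
        - ∑ x : (Quad D)ˣ, ∑ y : (Quad D')ˣ, (if norm (x : Quad D) = norm (y : Quad D') then
        (((θ x)⁻¹ : ℂˣ) * θ' y : ℂ) else 0) := by
        simp only [h2]
        simp only [Finset.mul_sum, ← Finset.sum_sub_distrib]
        refine Finset.sum_congr rfl fun x _ => Finset.sum_congr rfl fun y _ => ?_
        by_cases i1 : norm (x : Quad D) = norm (y : Quad D') <;>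
          by_cases i2 : (x : Quad D).re - (y : Quad D').re = 0 <;> simp [i1, i2]
        ring
    _ = (Fintype.card Rˣ : ℂ) * Fintype.card R := by
        rw [h3, h4, sub_zero, mul_comm]

end NonIsomorphic

/-! ### Discrete valuation rings, their quotients and their quadratic extensions -/

section DVR

variable {O : Type*} [CommRing O] {ϖ : O}

/-- The finite ring `O / ϖ ^ m`. -/
abbrev Res (ϖ : O) (m : ℕ) : Type _ := O ⧸ Ideal.span {ϖ ^ m}

/-- The reduction modulo `ϖ ^ m`. -/
abbrev toRes (ϖ : O) (m : ℕ) : O →+* Res ϖ m := Ideal.Quotient.mk _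

lemma toRes_surjective (ϖ : O) (m : ℕ) : Function.Surjective (toRes ϖ m) :=
  Ideal.Quotient.mk_surjective

lemma toRes_eq_zero {m : ℕ} {x : O} : toRes ϖ m x = 0 ↔ ϖ ^ m ∣ x := by
  rw [Ideal.Quotient.eq_zero_iff_mem, Ideal.mem_span_singleton]

lemma toRes_eq_iff {m : ℕ} {x y : O} : toRes ϖ m x = toRes ϖ m y ↔ ϖ ^ m ∣ x - y := by
  rw [← sub_eq_zero, ← map_sub, toRes_eq_zero]

lemma card_units_res_zero (ϖ : O) : Nat.card (Res ϖ 0)ˣ = 1 := by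
  have : Subsingleton (Res ϖ 0) := by
    rw [Ideal.Quotient.subsingleton_iff, pow_zero, Ideal.span_singleton_one]
  exact Nat.card_unique

lemma toRes_pow_dvd_iff {m n : ℕ} (h : n ≤ m) {x : O} :
    toRes ϖ m ϖ ^ n ∣ toRes ϖ m x ↔ ϖ ^ n ∣ x := by
  refine ⟨?_, fun h => by simpa using map_dvd (toRes ϖ m) h⟩
  rintro ⟨y, hy⟩
  obtain ⟨y, rfl⟩ := toRes_surjective ϖ m y
  rw [← map_pow, ← map_mul, toRes_eq_iff] at hy
  exact (dvd_sub_left (dvd_mul_right _ _)).mp ((pow_dvd_pow ϖ h).trans hy)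

lemma toRes_dvd_iff {m : ℕ} (h : 1 ≤ m) {x : O} : toRes ϖ m ϖ ∣ toRes ϖ m x ↔ ϖ ∣ x := by
  simpa using toRes_pow_dvd_iff (ϖ := ϖ) (x := x) h

variable [IsDomain O] [IsDiscreteValuationRing O]

lemma maximalIdeal_eq_span (hϖ : Irreducible ϖ) :
    IsLocalRing.maximalIdeal O = Ideal.span {ϖ} :=
  (IsDiscreteValuationRing.irreducible_iff_uniformizer ϖ).mp hϖ

lemma isUnit_iff_not_dvd (hϖ : Irreducible ϖ) {x : O} : IsUnit x ↔ ¬ ϖ ∣ x := by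
  rw [← Ideal.mem_span_singleton, ← maximalIdeal_eq_span hϖ, IsLocalRing.mem_maximalIdeal,
    mem_nonunits_iff, not_not]

lemma isUnit_toRes_iff (hϖ : Irreducible ϖ) {m : ℕ} (hm : 1 ≤ m) {x : O} :
    IsUnit (toRes ϖ m x) ↔ IsUnit x := by
  refine ⟨fun h => ?_, fun h => h.map _⟩
  rw [isUnit_iff_not_dvd hϖ]
  intro hd
  obtain ⟨y, hy⟩ := h.exists_right_inv
  obtain ⟨y, rfl⟩ := toRes_surjective ϖ m y
  rw [← map_mul, ← map_one (toRes ϖ m), toRes_eq_iff] at hy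
  have h1 : ϖ ∣ 1 :=
    (dvd_sub_right (hd.mul_right y)).mp ((dvd_pow_self ϖ (by omega : m ≠ 0)).trans hy)
  exact hϖ.not_isUnit (isUnit_of_dvd_one h1)

lemma isOddChainRing_res (hϖ : Irreducible ϖ) (h2 : IsUnit (2 : O)) {m : ℕ} (hm : 1 ≤ m) :
    IsOddChainRing (toRes ϖ m ϖ) m where
  pos := hm
  isUnit_or_dvd x := by
    obtain ⟨x, rfl⟩ := toRes_surjective ϖ m x
    rw [isUnit_toRes_iff hϖ hm, toRes_dvd_iff hm, isUnit_iff_not_dvd hϖ]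
    tauto
  pow_eq_zero := by rw [← map_pow, toRes_eq_zero]
  pow_ne_zero := by
    rw [← map_pow, Ne, toRes_eq_zero, pow_dvd_pow_iff hϖ.ne_zero hϖ.not_isUnit]
    omega
  two := by have := h2.map (toRes ϖ m); rwa [map_ofNat] at this

lemma unitsMap_toRes_surjective (hϖ : Irreducible ϖ) (m : ℕ) :
    Function.Surjective (Units.map (toRes ϖ m : O →* Res ϖ m)) := by
  rcases Nat.eq_zero_or_pos m with rfl | hm
  · have : Subsingleton (Res ϖ 0) := by
      rw [Ideal.Quotient.subsingleton_iff, pow_zero, Ideal.span_singleton_one]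
    exact fun x => ⟨1, Subsingleton.elim _ _⟩
  · intro x
    obtain ⟨y, hy⟩ := toRes_surjective ϖ m x
    have : IsUnit y := (isUnit_toRes_iff hϖ hm).mp (hy ▸ x.isUnit)
    exact ⟨this.unit, Units.ext hy⟩

instance finite_res [Finite (IsLocalRing.ResidueField O)] [hϖ : Fact (Irreducible ϖ)] (m : ℕ) :
    Finite (Res ϖ m) := by
  have h : Ideal.span {ϖ ^ m} = IsLocalRing.maximalIdeal O ^ m := by
    rw [maximalIdeal_eq_span hϖ.out, Ideal.span_singleton_pow]
  rw [Res, h]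
  have : Finite (O ⧸ IsLocalRing.maximalIdeal O) :=
    inferInstanceAs (Finite (IsLocalRing.ResidueField O))
  exact Ideal.finite_quotient_pow (IsNoetherian.noetherian _) m

lemma card_res (hϖ : Irreducible ϖ) (m : ℕ) :
    Nat.card (Res ϖ m) = Nat.card (IsLocalRing.ResidueField O) ^ m := by
  have h : Ideal.span {ϖ ^ m} = IsLocalRing.maximalIdeal O ^ m := by
    rw [maximalIdeal_eq_span hϖ, Ideal.span_singleton_pow]
  rw [Res, h]
  exact cardQuot_pow_of_prime (IsDiscreteValuationRing.not_a_field O)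

/-- The annihilator of `ϖ ^ (m - 1)` in `O / ϖ ^ m` is the maximal ideal. -/
lemma card_ann_res [Finite (IsLocalRing.ResidueField O)] (hϖ : Irreducible ϖ) {m : ℕ}
    (hm : 1 ≤ m) : Nat.card {a : Res ϖ m // toRes ϖ m ϖ ^ (m - 1) * a = 0}
      = Nat.card (IsLocalRing.ResidueField O) ^ (m - 1) := by
  have := Fact.mk hϖ
  -- Multiplication by `ϖ ^ (m - 1)` has this kernel, and its image is the residue field.
  have h1 := (AddMonoidHom.mulLeft (toRes ϖ m ϖ ^ (m - 1))).ker.card_mul_index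
  have h2 : Nat.card (AddMonoidHom.mulLeft (toRes ϖ m ϖ ^ (m - 1))).ker
      = Nat.card {a : Res ϖ m // toRes ϖ m ϖ ^ (m - 1) * a = 0} := rfl
  have h3 : (AddMonoidHom.mulLeft (toRes ϖ m ϖ ^ (m - 1))).ker.index
      = Nat.card (IsLocalRing.ResidueField O) := by
    have h4 : (AddMonoidHom.mulLeft (toRes ϖ m ϖ ^ (m - 1))).ker.index
        = ((AddMonoidHom.mulLeft (toRes ϖ m ϖ ^ (m - 1))).ker.comap
          (toRes ϖ m).toAddMonoidHom).index :=
      (AddSubgroup.index_comap_of_surjective _ (toRes_surjective ϖ m)).symm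
    have h5 : (AddMonoidHom.mulLeft (toRes ϖ m ϖ ^ (m - 1))).ker.comap
          (toRes ϖ m).toAddMonoidHom = (IsLocalRing.maximalIdeal O).toAddSubgroup := by
      ext x
      rw [AddSubgroup.mem_comap, AddMonoidHom.mem_ker, maximalIdeal_eq_span hϖ]
      change toRes ϖ m ϖ ^ (m - 1) * toRes ϖ m x = 0 ↔ x ∈ Ideal.span {ϖ}
      rw [← map_pow, ← map_mul, toRes_eq_zero, Ideal.mem_span_singleton]
      obtain ⟨k, rfl⟩ : ∃ k, m = k + 1 := ⟨m - 1, by omega⟩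
      rw [Nat.add_sub_cancel, pow_succ, mul_dvd_mul_iff_left (pow_ne_zero _ hϖ.ne_zero)]
    rw [h4, h5]
    rfl
  have hq : 0 < Nat.card (IsLocalRing.ResidueField O) := Nat.card_pos
  rw [h2, h3, card_res hϖ] at h1
  apply Nat.eq_of_mul_eq_mul_right hq
  rw [h1, ← pow_succ]
  congr 1
  omega

lemma card_units_res [Finite (IsLocalRing.ResidueField O)] (hϖ : Irreducible ϖ)
    (h2 : IsUnit (2 : O)) {m : ℕ} (hm : 1 ≤ m) :
    Nat.card (Res ϖ m)ˣ + Nat.card (IsLocalRing.ResidueField O) ^ (m - 1)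
      = Nat.card (IsLocalRing.ResidueField O) ^ m := by
  classical
  have := Fact.mk hϖ
  have := Fintype.ofFinite (Res ϖ m)
  have h := card_units_add_card (isOddChainRing_res hϖ h2 hm)
  simp only [← Nat.card_eq_fintype_card] at h
  rw [card_ann_res hϖ hm, card_res hϖ] at h
  exact_mod_cast h

end DVR

section QuadDVR

open QuadraticAlgebra

variable {R S : Type*} [CommRing R] [CommRing S]

/-- The map of quadratic algebras induced by a ring homomorphism. -/
def Quad.map (f : R →+* S) (D : R) : Quad D →+* Quad (f D) where
  toFun x := ⟨f x.re, f x.im⟩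
  map_one' := by ext <;> simp
  map_mul' x y := by ext <;> simp
  map_zero' := by ext <;> simp
  map_add' x y := by ext <;> simp

@[simp] lemma Quad.map_re (f : R →+* S) {D : R} (x : Quad D) : (Quad.map f D x).re = f x.re := rfl

@[simp] lemma Quad.map_im (f : R →+* S) {D : R} (x : Quad D) : (Quad.map f D x).im = f x.im := rfl

lemma Quad.norm_map (f : R →+* S) {D : R} (x : Quad D) :
    norm (Quad.map f D x) = f (norm x) := by
  simp [quad_norm]

variable {O : Type*} [CommRing O] {ϖ D : O}

lemma coe_pow (a : O) (n : ℕ) : Quad.coe D a ^ n = Quad.coe D (a ^ n) :=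
  (map_pow (algebraMap O (Quad D)) a n).symm

lemma dvd_im_of_coe_dvd {a : O} {x : Quad D} (h : Quad.coe D a ∣ x) : a ∣ x.im := by
  obtain ⟨y, rfl⟩ := h
  simp

lemma coe_dvd_iff {a : O} {x : Quad D} : Quad.coe D a ∣ x ↔ a ∣ x.re ∧ a ∣ x.im := by
  constructor
  · rintro ⟨y, rfl⟩
    simp
  · rintro ⟨⟨b, hb⟩, c, hc⟩
    exact ⟨⟨b, c⟩, by ext <;> simp [hb, hc]⟩

lemma delta_sq (D : O) : (⟨0, 1⟩ : Quad D) * ⟨0, 1⟩ = Quad.coe D D := by ext <;> simp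

/-- Division of a unit by its first coordinate does not change the value of a character that is
trivial on the scalars. -/
lemma exists_unit_re_one {θ : (Quad D)ˣ →* ℂˣ} (hθ : ∀ a, θ (Quad.coeUnit D a) = 1)
    (x : (Quad D)ˣ) (hx : IsUnit (x : Quad D).re) :
    ∃ y : (Quad D)ˣ, θ y = θ x ∧ ∃ b, (y : Quad D) = ⟨1, (x : Quad D).im * b⟩ := by
  obtain ⟨a, ha⟩ := hx
  refine ⟨Quad.coeUnit D a⁻¹ * x, by rw [map_mul, hθ, one_mul], (a⁻¹ : Oˣ), ?_⟩
  ext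
  · simp [← ha]
  · simp [mul_comm]

lemma star_mem_jacobson_bot {x : Quad D} (h : x ∈ Ideal.jacobson (⊥ : Ideal (Quad D))) :
    star x ∈ Ideal.jacobson (⊥ : Ideal (Quad D)) := by
  rw [Ideal.mem_jacobson_bot] at h ⊢
  intro y
  have := (h (star y)).map (starRingEnd (Quad D))
  rwa [map_add, map_mul, map_one, starRingEnd_apply, starRingEnd_apply, star_star] at this

lemma two_mul_re_mem_jacobson_bot {x : Quad D}
    (h : x ∈ Ideal.jacobson (⊥ : Ideal (Quad D))) :
    Quad.coe D (2 * x.re) ∈ Ideal.jacobson (⊥ : Ideal (Quad D)) := by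
  convert! Ideal.add_mem _ h (star_mem_jacobson_bot h) using 1
  ext
  · simp; ring
  · simp

variable [IsDomain O] [IsDiscreteValuationRing O]

lemma isUnit_quad_iff_not_dvd (hϖ : Irreducible ϖ) {x : Quad D} :
    IsUnit x ↔ ¬ ϖ ∣ norm x := by
  rw [isUnit_iff_norm_isUnit, isUnit_iff_not_dvd hϖ]

lemma dvd_of_coe_mem_jacobson_bot (hϖ : Irreducible ϖ) {a : O}
    (h : Quad.coe D a ∈ Ideal.jacobson (⊥ : Ideal (Quad D))) : ϖ ∣ a := by
  by_contra hu
  rw [← isUnit_iff_not_dvd hϖ] at hu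
  obtain ⟨b, hb⟩ := hu.exists_right_inv
  have := Ideal.mem_jacobson_bot.mp h (-(Quad.coe D b))
  rw [mul_neg, ← Quad.coe_mul, hb, Quad.coe_one, neg_add_cancel] at this
  exact not_isUnit_zero this

lemma dvd_re_of_mem_jacobson_bot (hϖ : Irreducible ϖ) (h2 : IsUnit (2 : O)) {x : Quad D}
    (h : x ∈ Ideal.jacobson (⊥ : Ideal (Quad D))) : ϖ ∣ x.re :=
  h2.dvd_mul_left.mp (dvd_of_coe_mem_jacobson_bot hϖ (two_mul_re_mem_jacobson_bot h))

/-- For `D` a unit the Jacobson radical is generated by `ϖ`, also if the algebra is split. -/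
lemma jacobson_bot_of_isUnit (hϖ : Irreducible ϖ) (h2 : IsUnit (2 : O)) (hD : IsUnit D) :
    Ideal.jacobson (⊥ : Ideal (Quad D)) = Ideal.span {Quad.coe D ϖ} := by
  ext x
  rw [Ideal.mem_span_singleton]
  constructor
  · intro h
    obtain ⟨a, ha⟩ := dvd_re_of_mem_jacobson_bot hϖ h2 h
    have h1 := dvd_re_of_mem_jacobson_bot hϖ h2 (Ideal.mul_mem_left _ (⟨0, 1⟩ : Quad D) h)
    rw [re_mul] at h1
    simp only [zero_mul, mul_one, zero_add] at h1
    obtain ⟨b, hb⟩ := hD.dvd_mul_left.mp h1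
    exact ⟨⟨a, b⟩, by ext <;> simp [ha, hb]⟩
  · rintro ⟨y, rfl⟩
    rw [Ideal.mem_jacobson_bot]
    intro z
    rw [isUnit_quad_iff_not_dvd hϖ, quad_norm]
    intro h
    apply hϖ.not_isUnit
    apply isUnit_of_dvd_one
    rw [mul_assoc] at h
    set w := y * z
    obtain ⟨k, hk⟩ := h
    refine ⟨k - (ϖ * w.re * w.re + 2 * w.re - D * ϖ * w.im * w.im), ?_⟩
    simp at hk
    linear_combination hk

/-- For `D` a uniformizer the Jacobson radical is generated by `δ`. -/
lemma jacobson_bot_of_ramified (hϖ : Irreducible ϖ) (h2 : IsUnit (2 : O)) {u : O}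
    (hu : IsUnit u) (hD : D = ϖ * u) :
    Ideal.jacobson (⊥ : Ideal (Quad D)) = Ideal.span {(⟨0, 1⟩ : Quad D)} := by
  ext x
  rw [Ideal.mem_span_singleton]
  constructor
  · intro h
    obtain ⟨a, ha⟩ := dvd_re_of_mem_jacobson_bot hϖ h2 h
    obtain ⟨v, hv⟩ := hu.exists_right_inv
    refine ⟨⟨x.im, v * a⟩, ?_⟩
    ext
    · simp [ha, hD]; linear_combination -(ϖ * a) * hv
    · simp
  · rintro ⟨y, rfl⟩
    rw [Ideal.mem_jacobson_bot]
    intro z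
    rw [isUnit_quad_iff_not_dvd hϖ, quad_norm]
    intro h
    apply hϖ.not_isUnit
    apply isUnit_of_dvd_one
    rw [mul_assoc] at h
    set w := y * z
    obtain ⟨k, hk⟩ := h
    refine ⟨k - (ϖ * u * u * w.im * w.im + 2 * u * w.im - u * w.re * w.re), ?_⟩
    simp [hD] at hk
    linear_combination hk

/-- For `D` a unit, `θ` is trivial on `1 + J ^ n`, where `J` is the Jacobson radical, if and only if
it is trivial on the units of the order `O + ϖ ^ n O[δ]`. -/
lemma forall_mem_jacobson_pow_iff_of_isUnit (hϖ : Irreducible ϖ) (h2 : IsUnit (2 : O))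
    (hD : IsUnit D) {θ : (Quad D)ˣ →* ℂˣ} (hθ : ∀ a, θ (Quad.coeUnit D a) = 1) (n : ℕ) :
    (∀ x : (Quad D)ˣ, (x : Quad D) - 1 ∈ Ideal.jacobson (⊥ : Ideal (Quad D)) ^ n → θ x = 1)
      ↔ TrivOn ϖ θ n := by
  rw [jacobson_bot_of_isUnit hϖ h2 hD, Ideal.span_singleton_pow, coe_pow]
  simp only [Ideal.mem_span_singleton, coe_dvd_iff]
  constructor
  · intro h x hx
    rcases Nat.eq_zero_or_pos n with rfl | hn
    · exact h x (by simp)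
    have hre : IsUnit (x : Quad D).re := by
      have := (isUnit_quad_iff_not_dvd hϖ).mp x.isUnit
      rw [isUnit_iff_not_dvd hϖ]
      intro h0
      rw [quad_norm] at this
      exact this (dvd_sub (h0.mul_left _)
        (((dvd_pow_self ϖ hn.ne').trans hx).mul_left _))
    obtain ⟨y, hy, b, hb⟩ := exists_unit_re_one hθ x hre
    rw [← hy]
    apply h
    rw [hb]
    simpa using hx.mul_right b
  · intro h x hx
    apply h
    simpa using hx.2

/-- For `D` a uniformizer the filtration by the powers of the radical is twice as fine. -/
lemma forall_mem_jacobson_pow_iff_of_ramified (hϖ : Irreducible ϖ) (h2 : IsUnit (2 : O)) {u : O}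
    (hu : IsUnit u) (hD : D = ϖ * u) {θ : (Quad D)ˣ →* ℂˣ}
    (hθ : ∀ a, θ (Quad.coeUnit D a) = 1) (n : ℕ) :
    (∀ x : (Quad D)ˣ, (x : Quad D) - 1 ∈ Ideal.jacobson (⊥ : Ideal (Quad D)) ^ n → θ x = 1)
      ↔ TrivOn ϖ θ (n / 2) := by
  rw [jacobson_bot_of_ramified hϖ h2 hu hD, Ideal.span_singleton_pow]
  simp only [Ideal.mem_span_singleton]
  have heven : ∀ k, (⟨0, 1⟩ : Quad D) ^ (2 * k) = Quad.coe D (ϖ ^ k * u ^ k) := by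
    intro k
    rw [pow_mul, pow_two, delta_sq, coe_pow, hD, mul_pow]
  constructor
  · intro h x hx
    have hre : IsUnit (x : Quad D).re := by
      have := (isUnit_quad_iff_not_dvd hϖ).mp x.isUnit
      rw [isUnit_iff_not_dvd hϖ]
      intro h0
      rw [quad_norm] at this
      exact this (dvd_sub (h0.mul_left _) (((Dvd.intro u hD.symm).mul_right _).mul_right _))
    obtain ⟨y, hy, b, hb⟩ := exists_unit_re_one hθ x hre
    rw [← hy]
    apply h
    refine (pow_dvd_pow _ (by omega : n ≤ 2 * (n / 2) + 1)).trans ?_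
    obtain ⟨c, hc⟩ := hx
    obtain ⟨v, hv⟩ := hu.exists_right_inv
    refine ⟨Quad.coe D (v ^ (n / 2) * c * b), ?_⟩
    have hvk : u ^ (n / 2) * v ^ (n / 2) = 1 := by rw [← mul_pow, hv, one_pow]
    rw [pow_succ, heven, hb, hc]
    ext
    · simp
    · simp
      linear_combination -(ϖ ^ (n / 2) * c * b) * hvk
  · intro h x hx
    apply h
    have h1 := (pow_dvd_pow (⟨0, 1⟩ : Quad D) (by omega : 2 * (n / 2) ≤ n)).trans hx
    rw [heven] at h1
    have h2 := dvd_im_of_coe_dvd h1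
    simp only [im_sub, im_one, sub_zero] at h2
    exact (dvd_mul_right _ _).trans h2

end QuadDVR

/-! ### Quadratic étale algebras as `F[δ]` with `δ² = D` -/

section Field

open QuadraticAlgebra

variable {F : Type*} [Field F] {E : Type*} [CommRing E] [Algebra F E]

/-- An element `δ` outside `F` whose square `d` lies in `F` generates a quadratic algebra. -/
lemma nonempty_algEquiv_of_sq (hE : Module.finrank F E = 2) {d : F} {δ : E}
    (h : δ * δ = algebraMap F E d) (hδ : δ ∉ Set.range (algebraMap F E)) :
    Nonempty (Quad d ≃ₐ[F] E) := by
  have : Module.Finite F E := Module.finite_of_finrank_pos (by omega)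
  have : Nontrivial E := Module.nontrivial_of_finrank_pos (R := F) (by omega)
  let f : Quad d →ₐ[F] E := QuadraticAlgebra.lift ⟨δ, by rw [h, Algebra.algebraMap_eq_smul_one]; simp⟩
  have hf : ∀ x, f x = algebraMap F E x.re + algebraMap F E x.im * δ := by
    intro x
    simp [f, QuadraticAlgebra.lift, Algebra.smul_def]
  have hinj : Function.Injective f := by
    rw [injective_iff_map_eq_zero]
    intro x hx
    rw [hf] at hx
    have him : x.im = 0 := by
      by_contra h0
      refine hδ ⟨-x.re / x.im, ?_⟩
      have h1 : algebraMap F E (x.im)⁻¹ * algebraMap F E x.im = 1 := by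
        rw [← map_mul, inv_mul_cancel₀ h0, map_one]
      rw [div_eq_mul_inv, map_mul, map_neg]
      linear_combination (-(algebraMap F E (x.im)⁻¹)) * hx + δ * h1
    rw [him, map_zero, zero_mul, add_zero] at hx
    ext
    · exact (algebraMap F E).injective (by rw [hx]; simp)
    · exact him
  refine ⟨AlgEquiv.ofBijective f ⟨hinj, ?_⟩⟩
  exact (LinearMap.injective_iff_surjective_of_finrank_eq_finrank
    (f := f.toLinearMap) (by rw [hE]; exact QuadraticAlgebra.finrank_eq_two d 0)).mp hinj

/-- A reduced quadratic algebra is generated by an element with nonzero square in `F`. -/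
lemma exists_sq_mem_range (h2 : (2 : F) ≠ 0) [IsReduced E] (hE : Module.finrank F E = 2) :
    ∃ d : F, d ≠ 0 ∧ Nonempty (Quad d ≃ₐ[F] E) := by
  have : Module.Finite F E := Module.finite_of_finrank_pos (by omega)
  have : Nontrivial E := Module.nontrivial_of_finrank_pos (R := F) (by omega)
  obtain ⟨x, hx⟩ : ∃ x : E, x ∉ Set.range (algebraMap F E) := by
    by_contra! h
    have h1 : Function.Surjective (Algebra.linearMap F E) := h
    have := LinearMap.finrank_le_finrank_of_surjective h1
    rw [hE, Module.finrank_self] at this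
    omega
  have hli : LinearIndependent F ![1, x] := by
    rw [LinearIndependent.pair_iff]
    intro s t hst
    have ht : t = 0 := by
      by_contra h0
      refine hx ⟨-s / t, ?_⟩
      have h1 : algebraMap F E t⁻¹ * algebraMap F E t = 1 := by
        rw [← map_mul, inv_mul_cancel₀ h0, map_one]
      rw [Algebra.smul_def, Algebra.smul_def] at hst
      rw [div_eq_mul_inv, map_mul, map_neg]
      linear_combination (-(algebraMap F E t⁻¹)) * hst + x * h1
    refine ⟨?_, ht⟩
    rw [ht, zero_smul, add_zero, Algebra.smul_def, mul_one] at hst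
    exact (algebraMap F E).injective (by rw [hst]; simp)
  have hspan := hli.span_eq_top_of_card_eq_finrank (by simp [hE])
  have hmem : x * x ∈ Submodule.span F (Set.range ![1, x]) := by rw [hspan]; trivial
  have hr : Set.range ![1, x] = {1, x} := by simp [Set.pair_comm]
  rw [hr, Submodule.mem_span_pair] at hmem
  obtain ⟨a, b, hab⟩ := hmem
  rw [Algebra.smul_def, Algebra.smul_def, mul_one] at hab
  -- Completing the square in `x² = a + b x`.
  have h4 : algebraMap F E 2 * algebraMap F E (b / 2) = algebraMap F E b := by
    rw [← map_mul]; congr 1; field_simp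
  have hsq : (x - algebraMap F E (b / 2)) * (x - algebraMap F E (b / 2))
      = algebraMap F E (a + b / 2 * (b / 2)) := by
    rw [map_add, map_mul]
    rw [map_ofNat] at h4
    linear_combination -hab - x * h4
  have hmem : x - algebraMap F E (b / 2) ∉ Set.range (algebraMap F E) := by
    rintro ⟨c, hc⟩
    exact hx ⟨c + b / 2, by rw [map_add, hc]; ring⟩
  refine ⟨_, ?_, nonempty_algEquiv_of_sq hE hsq hmem⟩
  intro h0
  rw [h0, map_zero] at hsq
  have := eq_zero_of_pow_eq_zero (n := 2) (by rw [pow_two]; exact hsq : (x - algebraMap F E (b / 2)) ^ 2 = 0)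
  exact hmem ⟨0, by rw [this, map_zero]⟩

lemma nonempty_algEquiv_mul_sq {d s : F} (hs : s ≠ 0) : Nonempty (Quad (s * s * d) ≃ₐ[F] Quad d) := by
  refine nonempty_algEquiv_of_sq (QuadraticAlgebra.finrank_eq_two d 0) (δ := (⟨0, s⟩ : Quad d)) ?_ ?_
  · ext
    · simp; ring
    · simp
  · rintro ⟨c, hc⟩
    have := congr_arg QuadraticAlgebra.im hc
    simp at this
    exact hs this.symm

lemma trace_quad {d : F} (x : Quad d) : Algebra.trace F (Quad d) x = 2 * x.re := by
  rw [Algebra.trace_eq_matrix_trace (QuadraticAlgebra.basis d 0), Matrix.trace_fin_two,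
    Algebra.leftMulMatrix_eq_repr_mul, Algebra.leftMulMatrix_eq_repr_mul]
  simp [QuadraticAlgebra.basis]
  ring

lemma norm_quad {d : F} (x : Quad d) : Algebra.norm F x = QuadraticAlgebra.norm x := by
  rw [← QuadraticAlgebra.det_toLinearMap_eq_norm, Algebra.norm_apply]
  rfl

end Field

/-- `D` is a unit, or a uniformizer. Then `O[√D]` is the maximal order, and `e` is its ramification
index. -/
def IsDisc {O : Type*} [CommRing O] (ϖ D : O) (e : ℕ) : Prop :=
  (e = 1 ∧ IsUnit D) ∨ (e = 2 ∧ ∃ u, IsUnit u ∧ D = ϖ * u)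

section Local

open QuadraticAlgebra

variable {F : Type*} [Field F] [ValuativeRel F] [TopologicalSpace F] [IsNonarchimedeanLocalField F]
variable {E : Type*} [CommRing E] [Algebra F E] {ϖ D : 𝒪[F]} {e : ℕ}

/-- Every nonzero element of `F` is a unit or a uniformizer up to a square. -/
lemma exists_isDisc (hϖ : Irreducible ϖ) {d : F} (hd : d ≠ 0) :
    ∃ s : F, s ≠ 0 ∧ ∃ (D : 𝒪[F]) (e : ℕ), IsDisc ϖ D e ∧ s * s * d = algebraMap 𝒪[F] F D := by
  obtain ⟨a, b, hb, rfl⟩ := IsFractionRing.div_surjective (A := 𝒪[F]) d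
  have hb0 : algebraMap 𝒪[F] F b ≠ 0 :=
    (map_ne_zero_iff _ (IsFractionRing.injective 𝒪[F] F)).mpr (nonZeroDivisors.ne_zero hb)
  have ha0 : a ≠ 0 := by rintro rfl; simp at hd
  have hϖ0 : algebraMap 𝒪[F] F ϖ ≠ 0 :=
    (map_ne_zero_iff _ (IsFractionRing.injective 𝒪[F] F)).mpr hϖ.ne_zero
  obtain ⟨n, u, hu⟩ := IsDiscreteValuationRing.eq_unit_mul_pow_irreducible
    (mul_ne_zero ha0 (nonZeroDivisors.ne_zero hb)) hϖ
  have hu' := congr_arg (algebraMap 𝒪[F] F) hu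
  simp only [map_mul, map_pow] at hu'
  rcases Nat.even_or_odd' n with ⟨k, rfl | rfl⟩
  · refine ⟨algebraMap 𝒪[F] F b / algebraMap 𝒪[F] F ϖ ^ k, div_ne_zero hb0 (pow_ne_zero _ hϖ0), u, 1,
      Or.inl ⟨rfl, u.isUnit⟩, ?_⟩
    field_simp
    rw [mul_comm, hu']
    ring
  · refine ⟨algebraMap 𝒪[F] F b / algebraMap 𝒪[F] F ϖ ^ k, div_ne_zero hb0 (pow_ne_zero _ hϖ0),
      ϖ * u, 2, Or.inr ⟨rfl, u, u.isUnit, rfl⟩, ?_⟩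
    rw [map_mul]
    field_simp
    rw [mul_comm, hu']
    ring

lemma two_ne_zero_of_isUnit (h2 : IsUnit (2 : 𝒪[F])) : (2 : F) ≠ 0 := by
  have := h2.map (algebraMap 𝒪[F] F)
  rw [map_ofNat] at this
  exact this.ne_zero

lemma exists_algEquiv_quad [Algebra.Etale F E] (hE : Module.finrank F E = 2)
    (h2 : IsUnit (2 : 𝒪[F])) (hϖ : Irreducible ϖ) :
    ∃ (D : 𝒪[F]) (e : ℕ), IsDisc ϖ D e ∧ Nonempty (Quad (algebraMap 𝒪[F] F D) ≃ₐ[F] E) := by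
  have : Module.Finite F E := Module.finite_of_finrank_pos (by omega)
  have : IsReduced E := Algebra.FormallyUnramified.isReduced_of_field F E
  obtain ⟨d, hd, ⟨f⟩⟩ := exists_sq_mem_range (two_ne_zero_of_isUnit h2) hE
  obtain ⟨s, hs, D, e, hD, h⟩ := exists_isDisc hϖ hd
  obtain ⟨g⟩ := nonempty_algEquiv_mul_sq (d := d) hs
  rw [h] at g
  exact ⟨D, e, hD, ⟨g.trans f⟩⟩

/-- Hensel's lemma for square roots. -/
lemma exists_sq_eq_of_dvd (h2 : IsUnit (2 : 𝒪[F])) (hϖ : Irreducible ϖ) {v s : 𝒪[F]}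
    (hv : IsUnit v) (h : ϖ ∣ s * s - v) : ∃ t, IsUnit t ∧ t * t = v := by
  let := IsTopologicalAddGroup.rightUniformSpace F
  have := isUniformAddGroup_of_addCommGroup (G := F)
  have hs : IsUnit s := by
    rw [isUnit_iff_not_dvd hϖ] at hv ⊢
    exact fun h0 => hv ((dvd_sub_right (h0.mul_left s)).mp h)
  have hH : HenselianRing 𝒪[F] 𝓂[F] := inferInstance
  obtain ⟨t, ht, -⟩ := hH.is_henselian (Polynomial.X ^ 2 - Polynomial.C v)
    (Polynomial.monic_X_pow_sub_C v two_ne_zero) s (by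
      rw [maximalIdeal_eq_span hϖ, Ideal.mem_span_singleton]
      simpa [pow_two] using h) (by
      simp only [Polynomial.derivative_sub, Polynomial.derivative_X_pow, Polynomial.derivative_C]
      simpa using (h2.mul hs).map (Ideal.Quotient.mk 𝓂[F]))
  have ht' : t * t = v := by
    simpa [Polynomial.IsRoot, pow_two, sub_eq_zero] using ht
  exact ⟨t, isUnit_of_mul_isUnit_left (ht' ▸ hv), ht'⟩

/-- The embedding of `O_F[δ]` in `E`. -/
noncomputable def intEmb (f : Quad (algebraMap 𝒪[F] F D) ≃ₐ[F] E) : Quad D →+* E :=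
  (f : Quad (algebraMap 𝒪[F] F D) →+* E).comp (Quad.map (algebraMap 𝒪[F] F) D)

lemma intEmb_apply (f : Quad (algebraMap 𝒪[F] F D) ≃ₐ[F] E) (x : Quad D) :
    intEmb f x = f (Quad.map (algebraMap 𝒪[F] F) D x) := rfl

lemma intEmb_coe (f : Quad (algebraMap 𝒪[F] F D) ≃ₐ[F] E) (a : 𝒪[F]) :
    intEmb f (Quad.coe D a) = algebraMap F E a := by
  rw [intEmb_apply, ← f.commutes]
  congr 1

lemma intEmb_injective (f : Quad (algebraMap 𝒪[F] F D) ≃ₐ[F] E) :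
    Function.Injective (intEmb f) := by
  refine f.injective.comp fun x y h => ?_
  ext
  · simpa using congr_arg QuadraticAlgebra.re h
  · simpa using congr_arg QuadraticAlgebra.im h

/-- If `D b²` is integral, then `b` is integral: its valuation is at least `-1 / 2`. -/
lemma mem_range_of_isDisc (hϖ : Irreducible ϖ) (hD : IsDisc ϖ D e) {b : F}
    (h : IsIntegral 𝒪[F] (algebraMap 𝒪[F] F D * (b * b))) : ∃ y, algebraMap 𝒪[F] F y = b := by
  rcases hD with ⟨-, hD⟩ | ⟨-, u, hu, hD⟩
  · obtain ⟨v, hv⟩ := hD.exists_left_inv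
    have h1 : IsIntegral 𝒪[F] (b ^ 2) := by
      have := (isIntegral_algebraMap (R := 𝒪[F]) (A := F) (x := v)).mul h
      rwa [← mul_assoc, ← map_mul, hv, map_one, one_mul, ← pow_two] at this
    exact IsIntegrallyClosed.isIntegral_iff.mp (h1.of_pow two_pos)
  · obtain ⟨v, hv⟩ := hu.exists_left_inv
    have h1 : IsIntegral 𝒪[F] (algebraMap 𝒪[F] F ϖ * (b * b)) := by
      have := (isIntegral_algebraMap (R := 𝒪[F]) (A := F) (x := v)).mul h
      rwa [hD, ← mul_assoc, ← map_mul, show v * (ϖ * u) = ϖ * (v * u) by ring, hv, mul_one] at this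
    have h2 : IsIntegral 𝒪[F] ((algebraMap 𝒪[F] F ϖ * b) ^ 2) := by
      have := (isIntegral_algebraMap (R := 𝒪[F]) (A := F) (x := ϖ)).mul h1
      convert! this using 1
      ring
    obtain ⟨y, hy⟩ := IsIntegrallyClosed.isIntegral_iff.mp (h2.of_pow two_pos)
    obtain ⟨z, hz⟩ := IsIntegrallyClosed.isIntegral_iff.mp h1
    have h3 : y * y = ϖ * z := by
      apply IsFractionRing.injective 𝒪[F] F
      rw [map_mul, map_mul, hy, hz]; ring
    have h4 : ϖ ∣ y := by
      have := hϖ.prime.dvd_or_dvd (Dvd.intro z h3.symm)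
      tauto
    obtain ⟨w, hw⟩ := h4
    refine ⟨w, ?_⟩
    rw [hw, map_mul] at hy
    exact mul_left_cancel₀ ((map_ne_zero_iff _ (IsFractionRing.injective 𝒪[F] F)).mpr hϖ.ne_zero) hy

/-- The ring of integers of `E` is `O_F[δ]`. -/
lemma mem_ringOfInt_iff (h2 : IsUnit (2 : 𝒪[F])) (hϖ : Irreducible ϖ) (hD : IsDisc ϖ D e)
    (f : Quad (algebraMap 𝒪[F] F D) ≃ₐ[F] E) {z : E} :
    z ∈ ringOfInt F E ↔ ∃ x, intEmb f x = z := by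
  rw [mem_integralClosure_iff]
  constructor
  · intro hz
    obtain ⟨w, rfl⟩ := f.surjective z
    have hw : IsIntegral 𝒪[F] w := by
      have := hz.map f.symm
      rwa [f.symm_apply_apply] at this
    -- The trace and the norm of `w = a + b δ` are integral, hence `a` and `D b²`.
    have hws : IsIntegral 𝒪[F] (star w) := by
      obtain ⟨p, hp, hpw⟩ := hw
      refine ⟨p, hp, ?_⟩
      have h1 : (starRingEnd _).comp (algebraMap 𝒪[F] (Quad (algebraMap 𝒪[F] F D)))
          = algebraMap 𝒪[F] (Quad (algebraMap 𝒪[F] F D)) := by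
        ext a <;> simp [starRingEnd_apply, IsScalarTower.algebraMap_apply 𝒪[F] F (Quad (algebraMap 𝒪[F] F D))]
      have := congr_arg (starRingEnd _) hpw
      rwa [map_zero, Polynomial.hom_eval₂, h1] at this
    have hinj : Function.Injective (algebraMap F (Quad (algebraMap 𝒪[F] F D))) :=
      (algebraMap F _).injective
    have h3 : IsIntegral 𝒪[F] (2 * w.re) := by
      rw [← isIntegral_algebraMap_iff hinj]
      convert! hw.add hws using 1
      ext
      · simp; ring
      · simp
    obtain ⟨v, hv⟩ := h2.exists_left_inv
    have h4 : IsIntegral 𝒪[F] w.re := by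
      have := (isIntegral_algebraMap (R := 𝒪[F]) (A := F) (x := v)).mul h3
      have hv' := congr_arg (algebraMap 𝒪[F] F) hv
      rw [map_mul, map_ofNat, map_one] at hv'
      rwa [← mul_assoc, hv', one_mul] at this
    have h5 : IsIntegral 𝒪[F] (algebraMap 𝒪[F] F D * (w.im * w.im)) := by
      have h6 : IsIntegral 𝒪[F] (norm w) := by
        rw [← isIntegral_algebraMap_iff hinj, algebraMap_norm_eq_mul_star]
        exact hw.mul hws
      convert! (h4.mul h4).sub h6 using 1
      rw [quad_norm]
      ring
    obtain ⟨a, ha⟩ := IsIntegrallyClosed.isIntegral_iff.mp h4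
    obtain ⟨b, hb⟩ := mem_range_of_isDisc hϖ hD h5
    refine ⟨⟨a, b⟩, ?_⟩
    rw [intEmb_apply]
    congr 1
    ext
    · exact ha
    · exact hb
  · rintro ⟨x, rfl⟩
    have h1 : IsIntegral 𝒪[F] (⟨0, 1⟩ : Quad (algebraMap 𝒪[F] F D)) := by
      apply IsIntegral.of_pow two_pos
      convert! isIntegral_algebraMap (R := 𝒪[F]) (A := Quad (algebraMap 𝒪[F] F D)) (x := D) using 1
      rw [pow_two, IsScalarTower.algebraMap_apply 𝒪[F] F (Quad (algebraMap 𝒪[F] F D))]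
      ext <;> simp
    have h3 : ∀ a : 𝒪[F], IsIntegral 𝒪[F] (algebraMap 𝒪[F] (Quad (algebraMap 𝒪[F] F D)) a) :=
      fun a => isIntegral_algebraMap
    have h4 : IsIntegral 𝒪[F] (Quad.map (algebraMap 𝒪[F] F) D x) := by
      convert! (h3 x.re).add ((h3 x.im).mul h1) using 1
      rw [IsScalarTower.algebraMap_apply 𝒪[F] F (Quad (algebraMap 𝒪[F] F D)),
        IsScalarTower.algebraMap_apply 𝒪[F] F (Quad (algebraMap 𝒪[F] F D))]
      ext <;> simp
    exact h4.map f

/-- The ring of integers of `E`, identified with `O_F[δ]`. -/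
noncomputable def intEquiv (h2 : IsUnit (2 : 𝒪[F])) (hϖ : Irreducible ϖ) (hD : IsDisc ϖ D e)
    (f : Quad (algebraMap 𝒪[F] F D) ≃ₐ[F] E) : Quad D ≃+* ringOfInt F E :=
  RingEquiv.ofBijective
    ((intEmb f).codRestrict (ringOfInt F E) fun x => (mem_ringOfInt_iff h2 hϖ hD f).mpr ⟨x, rfl⟩)
    ⟨fun _ _ h => intEmb_injective f (congr_arg Subtype.val h), fun z => by
      obtain ⟨x, hx⟩ := (mem_ringOfInt_iff h2 hϖ hD f).mp z.2
      exact ⟨x, Subtype.ext hx⟩⟩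

@[simp] lemma coe_intEquiv (h2 : IsUnit (2 : 𝒪[F])) (hϖ : Irreducible ϖ) (hD : IsDisc ϖ D e)
    (f : Quad (algebraMap 𝒪[F] F D) ≃ₐ[F] E) (x : Quad D) :
    (intEquiv h2 hϖ hD f x : E) = intEmb f x := rfl

/-- If `E` is an unramified field extension, then `D` is not a square modulo `ϖ`. -/
lemma not_dvd_of_isField (h2 : IsUnit (2 : 𝒪[F])) (hϖ : Irreducible ϖ)
    (f : Quad (algebraMap 𝒪[F] F D) ≃ₐ[F] E) (hD : IsUnit D) (hE : IsField E) (s : 𝒪[F]) :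
    ¬ ϖ ∣ s * s - D := by
  intro h
  obtain ⟨t, -, ht⟩ := exists_sq_eq_of_dvd h2 hϖ hD h
  have hE' : IsField (Quad (algebraMap 𝒪[F] F D)) := f.toMulEquiv.isField hE
  let := hE'.toField
  have h0 : (⟨algebraMap 𝒪[F] F t, 1⟩ : Quad (algebraMap 𝒪[F] F D))
      * ⟨algebraMap 𝒪[F] F t, -1⟩ = 0 := by
    ext
    · simp [← ht]
    · simp
  rcases mul_eq_zero.mp h0 with h | h
  · simpa using congr_arg QuadraticAlgebra.im h
  · simpa using congr_arg QuadraticAlgebra.im h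

/-- A quadratic algebra with a nonzero nonunit `z` has `N z = 0`, so that `D` is the square of
`re z / im z`. -/
lemma exists_sq_of_not_isField
    (f : Quad (algebraMap 𝒪[F] F D) ≃ₐ[F] E) (hD : IsDisc ϖ D e) (hE : ¬ IsField E) :
    e = 1 → ∃ s, IsUnit s ∧ D = s * s := by
  intro he
  have hD' : IsUnit D := by
    rcases hD with ⟨-, hD⟩ | ⟨h, -⟩
    · exact hD
    · omega
  have hE' : ¬ IsField (Quad (algebraMap 𝒪[F] F D)) := fun h => hE (f.symm.toMulEquiv.isField h)
  have hnt : Nontrivial (Quad (algebraMap 𝒪[F] F D)) := inferInstance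
  obtain ⟨z, hz, hzu⟩ : ∃ z : Quad (algebraMap 𝒪[F] F D), z ≠ 0 ∧ ¬ IsUnit z := by
    by_contra! h
    apply hE'
    refine ⟨exists_pair_ne _, mul_comm, fun {a} ha => ?_⟩
    exact (h a ha).exists_right_inv
  have hN : norm z = 0 := by
    by_contra h
    exact hzu (isUnit_iff_norm_isUnit.mpr (Ne.isUnit h))
  rw [quad_norm] at hN
  have hb : z.im ≠ 0 := by
    intro h
    rw [h] at hN
    apply hz
    ext
    · simpa using hN
    · exact h
  have h1 : (z.re / z.im) ^ 2 = algebraMap 𝒪[F] F D := by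
    field_simp
    linear_combination hN
  obtain ⟨s, hs⟩ := IsIntegrallyClosed.isIntegral_iff.mp
    (IsIntegral.of_pow (x := z.re / z.im) two_pos (h1 ▸ isIntegral_algebraMap (R := 𝒪[F]) (x := D)))
  have h3 : D = s * s := by
    apply IsFractionRing.injective 𝒪[F] F
    rw [map_mul, hs, ← pow_two, h1]
  exact ⟨s, isUnit_of_mul_isUnit_left (h3 ▸ hD'), h3⟩

end Local

/-! ### Levels of characters -/

section Transfer

variable {F : Type*} [Field F] [ValuativeRel F] [TopologicalSpace F] [IsNonarchimedeanLocalField F]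
variable {E : Type*} [CommRing E] [Algebra F E]
variable {B : Type*} [CommRing B] (f : B ≃+* ringOfInt F E)

lemma mem_rad_pow_iff {n : ℕ} {x : B} :
    f x ∈ rad F E ^ n ↔ x ∈ Ideal.jacobson (⊥ : Ideal B) ^ n := by
  have h : rad F E ^ n = (Ideal.jacobson (⊥ : Ideal B) ^ n).map (f : B →+* ringOfInt F E) := by
    rw [Ideal.map_pow, Ideal.map_jacobson_of_bijective f.bijective, Ideal.map_bot, rad]
  rw [h, Ideal.mem_map_iff_of_surjective (f : B →+* ringOfInt F E) f.surjective]
  constructor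
  · rintro ⟨y, hy, hyx⟩
    rwa [← f.injective hyx]
  · exact fun hx => ⟨x, hx, rfl⟩

/-- The embedding of `O_E^×` in `E^×`, for a ring `B` identified with `O_E`. -/
noncomputable def unitEmb : Bˣ →* Eˣ :=
  (Units.map (ringOfInt F E).val.toMonoidHom).comp (Units.mapEquiv f.toMulEquiv).toMonoidHom

@[simp] lemma coe_unitEmb (w : Bˣ) : (unitEmb f w : E) = (f w : ringOfInt F E) := rfl

lemma mem_unitFiltration_iff {n : ℕ} {u : Eˣ} :
    u ∈ unitFiltration F E n
      ↔ ∃ w : Bˣ, unitEmb f w = u ∧ (w : B) - 1 ∈ Ideal.jacobson (⊥ : Ideal B) ^ n := by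
  constructor
  · rintro ⟨w, hw, hwn⟩
    refine ⟨(Units.mapEquiv f.toMulEquiv).symm w, ?_, ?_⟩
    · rw [← hw]
      ext
      simp
    · rw [← mem_rad_pow_iff f]
      simpa using hwn
  · rintro ⟨w, hw, hwn⟩
    refine ⟨Units.mapEquiv f.toMulEquiv w, hw, ?_⟩
    rw [← mem_rad_pow_iff f] at hwn
    simpa using hwn

lemma mem_intUnits_iff {u : Eˣ} : u ∈ intUnits F E ↔ ∃ w : Bˣ, unitEmb f w = u := by
  constructor
  · rintro ⟨w, hw⟩
    refine ⟨(Units.mapEquiv f.toMulEquiv).symm w, ?_⟩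
    rw [← hw]
    ext
    simp
  · rintro ⟨w, hw⟩
    exact ⟨Units.mapEquiv f.toMulEquiv w, hw⟩

lemma isUnif_iff {ϖE : Eˣ} :
    IsUnif F E ϖE ↔ ∃ w : B, (f w : E) = ϖE ∧ Ideal.jacobson (⊥ : Ideal B) = Ideal.span {w} := by
  have h : ∀ w : B, rad F E = Ideal.span {f w} ↔ Ideal.jacobson (⊥ : Ideal B) = Ideal.span {w} := by
    intro w
    have h1 := fun x => mem_rad_pow_iff f (n := 1) (x := x)
    simp only [pow_one] at h1
    constructor
    · intro h
      ext x
      rw [← h1, h, Ideal.mem_span_singleton, Ideal.mem_span_singleton, map_dvd_iff]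
    · intro h
      ext x
      obtain ⟨x, rfl⟩ := f.surjective x
      rw [h1, h, Ideal.mem_span_singleton, Ideal.mem_span_singleton, map_dvd_iff]
  constructor
  · rintro ⟨w, hw, hr⟩
    refine ⟨f.symm w, by simpa using hw, ?_⟩
    rw [← h]
    simpa using hr
  · rintro ⟨w, hw, hr⟩
    exact ⟨f w, hw, (h w).mpr hr⟩

/-- The elements of valuation `k` are `γ ^ k O_E^×` for one generator `γ` of the radical. -/
lemma mem_valSet_iff {g : B} (hg : Ideal.jacobson (⊥ : Ideal B) = Ideal.span {g}) {γ : Eˣ}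
    (hγ : (f g : E) = γ) {k : ℤ} {u : Eˣ} :
    u ∈ valSet F E k ↔ ∃ w : Bˣ, u = γ ^ k * unitEmb f w := by
  constructor
  · rintro ⟨ϖE, hϖE, ε, hε, rfl⟩
    obtain ⟨w, hw, hJ⟩ := (isUnif_iff f).mp hϖE
    obtain ⟨ε, rfl⟩ := (mem_intUnits_iff f).mp hε
    obtain ⟨a, ha⟩ := Ideal.mem_span_singleton.mp (hJ ▸ hg ▸ Ideal.mem_span_singleton_self g)
    obtain ⟨b, hb⟩ := Ideal.mem_span_singleton.mp (hg ▸ hJ ▸ Ideal.mem_span_singleton_self w)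
    have h1 : (γ : E) * ((f (a * b) : ringOfInt F E) : E) = γ * 1 := by
      rw [← hγ, ← MulMemClass.coe_mul, ← map_mul, mul_one]
      congr 2
      rw [mul_comm a b, ← mul_assoc, ← hb, ← ha]
    have hab : a * b = 1 := by
      have h2 := γ.isUnit.mul_left_cancel h1
      apply f.injective
      rw [map_one]
      exact Subtype.ext h2
    have h3 : ϖE = γ * unitEmb f (Units.mkOfMulEqOne b a (by rw [mul_comm, hab])) := by
      ext
      rw [← hw, Units.val_mul, coe_unitEmb, ← hγ, hb, map_mul]
      rfl
    refine ⟨(Units.mkOfMulEqOne b a (by rw [mul_comm, hab])) ^ k * ε, ?_⟩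
    rw [h3, mul_zpow, map_mul, map_zpow, mul_assoc]
  · rintro ⟨w, rfl⟩
    exact ⟨γ, (isUnif_iff f).mpr ⟨g, hγ, hg⟩, _, (mem_intUnits_iff f).mpr ⟨w, rfl⟩, rfl⟩

lemma ramIdx_eq_sSup :
    ramIdx F E = sSup {n : ℕ | ∀ x ∈ 𝓂[F], f.symm (algebraMap 𝒪[F] (ringOfInt F E) x)
      ∈ Ideal.jacobson (⊥ : Ideal B) ^ n} := by
  rw [ramIdx]
  congr 1
  ext n
  simp only [← mem_rad_pow_iff f, RingEquiv.apply_symm_apply, Set.mem_ofPred_eq]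

end Transfer

section Base

variable {F : Type*} [Field F] [ValuativeRel F] [TopologicalSpace F] [IsNonarchimedeanLocalField F]

/-- `O_F` is the ring of integers of the algebra `F`. -/
noncomputable def baseEquiv (F : Type*) [Field F] [ValuativeRel F] [TopologicalSpace F]
    [IsNonarchimedeanLocalField F] : 𝒪[F] ≃+* ringOfInt F F :=
  RingEquiv.ofBijective (algebraMap 𝒪[F] (ringOfInt F F))
    ⟨fun _ _ h => IsFractionRing.injective 𝒪[F] F (congr_arg (fun z : ringOfInt F F => (z : F)) h), fun z => by
      obtain ⟨y, hy⟩ := IsIntegrallyClosed.isIntegral_iff.mp z.2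
      exact ⟨y, Subtype.ext hy⟩⟩

/-- The inclusion of `O_F^×` in `F^×`. -/
noncomputable def baseUnit (F : Type*) [Field F] [ValuativeRel F] : 𝒪[F]ˣ →* Fˣ :=
  Units.map (algebraMap 𝒪[F] F).toMonoidHom

@[simp] lemma coe_baseUnit (w : 𝒪[F]ˣ) : (baseUnit F w : F) = algebraMap 𝒪[F] F w := rfl

lemma mem_unitFiltration_base_iff {ϖ : 𝒪[F]} (hϖ : Irreducible ϖ) {n : ℕ} {u : Fˣ} :
    u ∈ unitFiltration F F n ↔ ∃ w : 𝒪[F]ˣ, baseUnit F w = u ∧ ϖ ^ n ∣ (w : 𝒪[F]) - 1 := by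
  rw [mem_unitFiltration_iff (baseEquiv F), IsLocalRing.jacobson_eq_maximalIdeal ⊥ bot_ne_top,
    maximalIdeal_eq_span hϖ, Ideal.span_singleton_pow]
  simp only [Ideal.mem_span_singleton]
  rfl

end Base

section Quadratic

open QuadraticAlgebra

variable {F : Type*} [Field F] [ValuativeRel F] [TopologicalSpace F] [IsNonarchimedeanLocalField F]
variable {E : Type*} [CommRing E] [Algebra F E] {ϖ D : 𝒪[F]} {e : ℕ}

/-- The least `j` such that `θ` is trivial on the units of the order `O_F + ϖ ^ j O_F[δ]`. -/
noncomputable def cond (ϖ : 𝒪[F]) (θ : (Quad D)ˣ →* ℂˣ) : ℕ := sInf {j | TrivOn ϖ θ j}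

variable (h2 : IsUnit (2 : 𝒪[F])) (hϖ : Irreducible ϖ) (hD : IsDisc ϖ D e)
  (f : Quad (algebraMap 𝒪[F] F D) ≃ₐ[F] E)

/-- The restriction to `O_E^×`, identified with `O_F[δ]^×`, of a character of `E^×`. -/
noncomputable def restr (f : Quad (algebraMap 𝒪[F] F D) ≃ₐ[F] E) (θ : Eˣ →* ℂˣ) :
    (Quad D)ˣ →* ℂˣ := θ.comp (Units.map (intEmb f).toMonoidHom)

lemma restr_apply (θ : Eˣ →* ℂˣ) (w : (Quad D)ˣ) :
    restr f θ w = θ (Units.map (intEmb f).toMonoidHom w) := rfl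

lemma restr_mul (θ θ' : Eˣ →* ℂˣ) : restr f (θ * θ') = restr f θ * restr f θ' := rfl

lemma restr_inv (θ : Eˣ →* ℂˣ) : restr f θ⁻¹ = (restr f θ)⁻¹ := rfl

lemma restr_coeUnit {θ : Eˣ →* ℂˣ}
    (hθ : ∀ a : Fˣ, θ (Units.map (algebraMap F E).toMonoidHom a) = 1) (a : 𝒪[F]ˣ) :
    restr f θ (Quad.coeUnit D a) = 1 := by
  rw [restr_apply, ← hθ (baseUnit F a)]
  congr 1
  ext
  exact intEmb_coe f a

include h2 hϖ hD in
lemma forall_mem_unitFiltration_iff {θ : Eˣ →* ℂˣ}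
    (hθ : ∀ a : Fˣ, θ (Units.map (algebraMap F E).toMonoidHom a) = 1) (n : ℕ) :
    (∀ u ∈ unitFiltration F E n, θ u = 1) ↔ TrivOn ϖ (restr f θ) (n / e) := by
  have h : (∀ u ∈ unitFiltration F E n, θ u = 1) ↔
      ∀ x : (Quad D)ˣ, (x : Quad D) - 1 ∈ Ideal.jacobson (⊥ : Ideal (Quad D)) ^ n →
        restr f θ x = 1 := by
    simp only [mem_unitFiltration_iff (intEquiv h2 hϖ hD f)]
    constructor
    · intro h x hx
      exact h _ ⟨x, rfl, hx⟩
    · rintro h _ ⟨x, rfl, hx⟩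
      exact h x hx
  rw [h]
  rcases hD with ⟨rfl, hD⟩ | ⟨rfl, u, hu, hD⟩
  · rw [Nat.div_one]
    exact forall_mem_jacobson_pow_iff_of_isUnit hϖ h2 hD (restr_coeUnit f hθ) n
  · exact forall_mem_jacobson_pow_iff_of_ramified hϖ h2 hu hD (restr_coeUnit f hθ) n

/-- The least `n` whose quotient `n / e` satisfies `P` is `e` times the least such quotient. If there
is none, both sides are `sInf ∅ = 0`. -/
lemma sInf_div_eq {P : ℕ → Prop} {e : ℕ} (he : 0 < e) :
    sInf {n | P (n / e)} = e * sInf {k | P k} := by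
  rcases Set.eq_empty_or_nonempty {k | P k} with h | h
  · have : {n | P (n / e)} = ∅ := by
      ext n
      simpa using fun hn => (Set.ext_iff.mp h (n / e)).mp hn
    rw [h, this, Nat.sInf_empty, mul_zero]
  · apply le_antisymm
    · apply Nat.sInf_le
      have := Nat.sInf_mem h
      simpa [Nat.mul_div_cancel_left _ he] using this
    · have hne : {n | P (n / e)}.Nonempty := by
        obtain ⟨k, hk⟩ := h
        exact ⟨e * k, by simpa [Nat.mul_div_cancel_left _ he] using hk⟩
      have h1 : sInf {k | P k} ≤ sInf {n | P (n / e)} / e := Nat.sInf_le (Nat.sInf_mem hne)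
      exact (Nat.mul_le_mul_left e h1).trans (Nat.mul_div_le _ _)

lemma IsDisc.pos (hD : IsDisc ϖ D e) : 0 < e := by
  rcases hD with ⟨rfl, -⟩ | ⟨rfl, -⟩ <;> norm_num

include h2 hϖ hD in
lemma level_eq {θ : Eˣ →* ℂˣ}
    (hθ : ∀ a : Fˣ, θ (Units.map (algebraMap F E).toMonoidHom a) = 1) :
    level F θ = e * cond ϖ (restr f θ) := by
  rw [level, cond, ← sInf_div_eq hD.pos]
  simp only [forall_mem_unitFiltration_iff h2 hϖ hD f hθ]

include h2 hϖ hD in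
lemma ramIdx_eq (f : Quad (algebraMap 𝒪[F] F D) ≃ₐ[F] E) : ramIdx F E = e := by
  rw [ramIdx_eq_sSup (intEquiv h2 hϖ hD f)]
  have h : ∀ x, (intEquiv h2 hϖ hD f).symm (algebraMap 𝒪[F] (ringOfInt F E) x) = Quad.coe D x := by
    intro x
    rw [RingEquiv.symm_apply_eq]
    apply Subtype.ext
    rw [coe_intEquiv, intEmb_coe]
    rfl
  simp only [h]
  have h3 : ∀ n, (∀ x ∈ 𝓂[F], Quad.coe D x ∈ Ideal.jacobson (⊥ : Ideal (Quad D)) ^ n) ↔ n ≤ e := by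
    intro n
    rw [maximalIdeal_eq_span hϖ]
    have h4 : (∀ x ∈ Ideal.span {ϖ}, Quad.coe D x ∈ Ideal.jacobson (⊥ : Ideal (Quad D)) ^ n)
        ↔ Quad.coe D ϖ ∈ Ideal.jacobson (⊥ : Ideal (Quad D)) ^ n := by
      refine ⟨fun h => h ϖ (Ideal.mem_span_singleton_self ϖ), fun h x hx => ?_⟩
      obtain ⟨y, rfl⟩ := Ideal.mem_span_singleton.mp hx
      rw [Quad.coe_mul]
      exact Ideal.mul_mem_right _ _ h
    rw [h4]
    rcases hD with ⟨rfl, hD⟩ | ⟨rfl, u, hu, hD⟩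
    · rw [jacobson_bot_of_isUnit hϖ h2 hD, Ideal.span_singleton_pow, coe_pow,
        Ideal.mem_span_singleton, coe_dvd_iff]
      have := pow_dvd_pow_iff (n := n) (m := 1) hϖ.ne_zero hϖ.not_isUnit
      rw [pow_one] at this
      simpa using this
    · rw [jacobson_bot_of_ramified hϖ h2 hu hD, Ideal.span_singleton_pow,
        Ideal.mem_span_singleton]
      constructor
      · intro h
        by_contra hn
        have h5 := (pow_dvd_pow _ (by omega : 3 ≤ n)).trans h
        rw [pow_succ, pow_two, delta_sq] at h5
        obtain ⟨y, hy⟩ := h5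
        have h6 := congr_arg QuadraticAlgebra.re hy
        simp at h6
        apply hϖ.not_isUnit
        apply isUnit_of_dvd_one
        refine ⟨u * (u * y.im), ?_⟩
        apply mul_left_cancel₀ hϖ.ne_zero
        linear_combination h6 + (D + ϖ * u) * y.im * hD
      · intro hn
        refine (pow_dvd_pow _ hn).trans ?_
        rw [pow_two, delta_sq, coe_dvd_iff, hD]
        exact ⟨hu.mul_right_dvd.mpr dvd_rfl, dvd_zero _⟩
  simp only [h3]
  exact csSup_Iic

include h2 hϖ hD in
lemma condExp_eq {θ : Eˣ →* ℂˣ}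
    (hθ : ∀ a : Fˣ, θ (Units.map (algebraMap F E).toMonoidHom a) = 1) :
    condExp F θ = 2 * cond ϖ (restr f θ) + e - 1 := by
  rw [condExp, level_eq h2 hϖ hD f hθ, ramIdx_eq h2 hϖ hD f]
  congr 2
  rw [mul_left_comm, Nat.mul_div_cancel_left _ hD.pos]

end Quadratic

/-! ### Congruence subgroups in topological rings -/

section NoSmallSubgroups

/-- `ℂˣ` has no small subgroups: squaring increases the distance to `1` by a factor `≥ 3 / 2`, as
long as this distance is at most `1 / 2`. -/
lemma eq_one_of_forall_norm_pow_sub_one_le {z : ℂ} (h : ∀ n : ℕ, ‖z ^ n - 1‖ ≤ 1 / 2) : z = 1 := by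
  by_contra hz
  have h1 : ∀ j : ℕ, (3 / 2 : ℝ) ^ j * ‖z - 1‖ ≤ ‖z ^ 2 ^ j - 1‖ := by
    intro j
    induction j with
    | zero => simp
    | succ j ih =>
      have h2 : z ^ 2 ^ (j + 1) - 1 = (z ^ 2 ^ j - 1) * (z ^ 2 ^ j + 1) := by
        rw [pow_succ, pow_mul]; ring
      have h3 : 3 / 2 ≤ ‖z ^ 2 ^ j + 1‖ := by
        have h4 : ‖(2 : ℂ)‖ ≤ ‖z ^ 2 ^ j + 1‖ + ‖z ^ 2 ^ j - 1‖ := by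
          convert! norm_sub_le (z ^ 2 ^ j + 1) (z ^ 2 ^ j - 1) using 2
          ring
        have := h (2 ^ j)
        norm_num at h4
        linarith
      rw [h2, norm_mul, pow_succ]
      calc (3 / 2 : ℝ) ^ j * (3 / 2) * ‖z - 1‖ = ((3 / 2 : ℝ) ^ j * ‖z - 1‖) * (3 / 2) := by ring
        _ ≤ _ := mul_le_mul ih h3 (by norm_num) (norm_nonneg _)
  have hpos : 0 < ‖z - 1‖ := norm_pos_iff.mpr (sub_ne_zero.mpr hz)
  obtain ⟨j, hj⟩ := pow_unbounded_of_one_lt (1 / ‖z - 1‖) (by norm_num : (1 : ℝ) < 3 / 2)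
  rw [div_lt_iff₀ hpos] at hj
  have h5 := h1 j
  have h6 := h (2 ^ j)
  linarith

/-- A continuous character is trivial on some member of a descending sequence of compact open
subgroups with trivial intersection. -/
lemma exists_forall_eq_one_of_continuous {G : Type*} [Group G] [TopologicalSpace G] [T2Space G]
    {U : ℕ → Subgroup G} (hU : Antitone U) (hc : ∀ n, IsCompact (U n : Set G))
    (h1 : ∀ x, (∀ n, x ∈ U n) → x = 1) {χ : G →* ℂˣ} (hχ : Continuous χ) :
    ∃ n, ∀ x ∈ U n, χ x = 1 := by
  have hV : IsOpen {z : ℂˣ | ‖(z : ℂ) - 1‖ < 1 / 2} :=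
    isOpen_lt (by fun_prop) continuous_const
  have hd : Directed (fun x1 x2 => x1 ⊇ x2) fun n => (U n : Set G) :=
    directed_of_isDirected_le fun i j hij => hU hij
  obtain ⟨n, hn⟩ := exists_subset_nhds_of_isCompact hd hc
    (U := χ ⁻¹' {z : ℂˣ | ‖(z : ℂ) - 1‖ < 1 / 2}) (by
      intro x hx
      have hx1 : x = 1 := h1 x fun n => Set.mem_iInter.mp hx n
      apply (hV.preimage hχ).mem_nhds
      simp [hx1])
  refine ⟨n, fun x hx => Units.ext (eq_one_of_forall_norm_pow_sub_one_le fun k => ?_)⟩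
  have := hn ((U n).pow_mem hx k)
  simp only [Set.mem_preimage, map_pow, Set.mem_ofPred_eq] at this
  exact_mod_cast this.le

end NoSmallSubgroups

section Congruence

variable {B L : Type*} [CommRing B] [CommRing L]

/-- The subgroup of the units of `B` that are congruent to `1` modulo `π ^ n`, embedded in `Lˣ`. -/
def congSubgroup (g : B →+* L) (π : B) (n : ℕ) : Subgroup Lˣ where
  carrier := {u | ∃ w : Bˣ, Units.map g.toMonoidHom w = u ∧ π ^ n ∣ (w : B) - 1}
  one_mem' := ⟨1, by simp, by simp⟩
  mul_mem' := by
    rintro _ _ ⟨v, rfl, hv⟩ ⟨w, rfl, hw⟩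
    refine ⟨v * w, map_mul _ _ _, ?_⟩
    convert! dvd_add (hv.mul_right (w : B)) hw using 1
    push_cast
    ring
  inv_mem' := by
    rintro _ ⟨v, rfl, hv⟩
    refine ⟨v⁻¹, map_inv _ _, ?_⟩
    convert! hv.mul_right (-((v⁻¹ : Bˣ) : B)) using 1
    linear_combination v.mul_inv

lemma congSubgroup_antitone (g : B →+* L) (π : B) : Antitone (congSubgroup g π) := by
  rintro i j hij _ ⟨w, hw, h⟩
  exact ⟨w, hw, (pow_dvd_pow π hij).trans h⟩

lemma map_mem_congSubgroup_iff {g : B →+* L} (hg : Function.Injective g) {π : B} {n : ℕ}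
    {w : Bˣ} : Units.map g.toMonoidHom w ∈ congSubgroup g π n ↔ π ^ n ∣ (w : B) - 1 := by
  constructor
  · rintro ⟨v, hv, h⟩
    rwa [← Units.map_injective (f := g.toMonoidHom) hg hv]
  · exact fun h => ⟨w, rfl, h⟩

/-- The ring `g(B)` is a compact open subring of `L`, as are its ideals generated by the powers of
`π`. -/
structure IsIntegralModel [TopologicalSpace L] (g : B →+* L) (π : B) : Prop where
  injective : Function.Injective g
  isOpen : ∀ n, IsOpen (g '' {x | π ^ n ∣ x})
  isCompact : IsCompact (Set.range g)
  separated : ∀ x, (∀ n, π ^ n ∣ x) → x = 0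

variable [TopologicalSpace L] {g : B →+* L} {π : B} (hg : IsIntegralModel g π)
include hg

lemma IsIntegralModel.mem_iff {n : ℕ} {u : Lˣ} :
    u ∈ congSubgroup g π n ↔ (u : L) ∈ Set.range g ∧ ((u⁻¹ : Lˣ) : L) ∈ Set.range g
      ∧ (u : L) - 1 ∈ g '' {x | π ^ n ∣ x} := by
  constructor
  · rintro ⟨w, rfl, hw⟩
    refine ⟨⟨w, rfl⟩, ⟨(w⁻¹ : Bˣ), ?_⟩, ⟨w - 1, hw, by simp⟩⟩
    rw [← map_inv]
    rfl
  · rintro ⟨⟨x, hx⟩, ⟨y, hy⟩, ⟨z, hz, hzu⟩⟩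
    have hxy : x * y = 1 := hg.injective (by rw [map_mul, hx, hy, map_one, Units.mul_inv])
    refine ⟨⟨x, y, hxy, by rw [mul_comm, hxy]⟩, Units.ext hx, ?_⟩
    have : z = x - 1 := hg.injective (by rw [hzu, map_sub, hx, map_one])
    rwa [← this]

variable [IsTopologicalRing L]

lemma IsIntegralModel.isOpen_congSubgroup (n : ℕ) : IsOpen (congSubgroup g π n : Set Lˣ) := by
  have h0 : IsOpen (Set.range g) := by
    have := hg.isOpen 0
    simpa using this
  have : (congSubgroup g π n : Set Lˣ) = ((fun u : Lˣ => (u : L)) ⁻¹' Set.range g)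
      ∩ (((fun u : Lˣ => ((u⁻¹ : Lˣ) : L)) ⁻¹' Set.range g)
      ∩ ((fun u : Lˣ => (u : L) - 1) ⁻¹' (g '' {x | π ^ n ∣ x}))) := by
    ext u
    exact hg.mem_iff
  rw [this]
  refine (h0.preimage Units.continuous_val).inter ((h0.preimage ?_).inter
    ((hg.isOpen n).preimage ?_))
  · exact Units.continuous_val.comp continuous_inv
  · exact Units.continuous_val.sub continuous_const

lemma IsIntegralModel.isCompact_congSubgroup [T2Space L] (n : ℕ) :
    IsCompact (congSubgroup g π n : Set Lˣ) := by
  have h0 : (congSubgroup g π 0 : Set Lˣ)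
      = Units.embedProduct L ⁻¹' (Set.range g ×ˢ (MulOpposite.unop ⁻¹' Set.range g)) := by
    ext u
    rw [SetLike.mem_coe, hg.mem_iff]
    constructor
    · rintro ⟨h1, h2, -⟩
      exact ⟨h1, h2⟩
    · rintro ⟨⟨x, hx⟩, h2⟩
      exact ⟨⟨x, hx⟩, h2, ⟨x - 1, by simp, by rw [map_sub, hx]; simp⟩⟩
  have hK : IsCompact (MulOpposite.unop ⁻¹' Set.range g : Set Lᵐᵒᵖ) :=
    (MulOpposite.opHomeomorph (M := L)).symm.isClosedEmbedding.isCompact_preimage hg.isCompact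
  have hc0 : IsCompact (congSubgroup g π 0 : Set Lˣ) := by
    rw [h0]
    exact Units.isClosedEmbedding_embedProduct.isCompact_preimage (hg.isCompact.prod hK)
  exact hc0.of_isClosed_subset ((congSubgroup g π n).isClosed_of_isOpen (hg.isOpen_congSubgroup n))
    (congSubgroup_antitone g π (Nat.zero_le n))

/-- A continuous character of `Lˣ` is trivial on a congruence subgroup. -/
lemma IsIntegralModel.exists_forall_eq_one [T2Space L] {χ : Lˣ →* ℂˣ} (hχ : Continuous χ) :
    ∃ n, ∀ w : Bˣ, π ^ n ∣ (w : B) - 1 → χ (Units.map g.toMonoidHom w) = 1 := by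
  obtain ⟨n, hn⟩ := exists_forall_eq_one_of_continuous (congSubgroup_antitone g π)
    hg.isCompact_congSubgroup (by
      intro u hu
      obtain ⟨w, rfl, -⟩ := hu 0
      have := hg.separated ((w : B) - 1) fun n => (map_mem_congSubgroup_iff hg.injective).mp (hu n)
      have hw : w = 1 := Units.ext (sub_eq_zero.mp this)
      rw [hw, map_one]) hχ
  exact ⟨n, fun w hw => hn _ ⟨w, rfl, hw⟩⟩

omit [IsTopologicalRing L] in
lemma IsIntegralModel.continuous_of_forall_eq_one [IsTopologicalRing L] {χ : Lˣ →* ℂˣ} {n : ℕ}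
    (h : ∀ w : Bˣ, π ^ n ∣ (w : B) - 1 → χ (Units.map g.toMonoidHom w) = 1) : Continuous χ := by
  apply continuous_of_continuousAt_one
  rw [ContinuousAt, map_one]
  apply Filter.Tendsto.congr' (f₁ := fun _ => 1) _ tendsto_const_nhds
  filter_upwards [(hg.isOpen_congSubgroup n).mem_nhds (congSubgroup g π n).one_mem]
  rintro _ ⟨w, rfl, hw⟩
  exact (h w hw).symm

open MeasureTheory in
lemma IsIntegralModel.measureReal_congSubgroup_pos [T2Space L] [MeasurableSpace Lˣ]
    [BorelSpace Lˣ] (μ : Measure Lˣ) [μ.IsHaarMeasure] (n : ℕ) :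
    0 < μ.real (congSubgroup g π n) := by
  rw [measureReal_def, ENNReal.toReal_pos_iff]
  exact ⟨(hg.isOpen_congSubgroup n).measure_pos μ ⟨1, (congSubgroup g π n).one_mem⟩,
    (hg.isCompact_congSubgroup n).measure_lt_top⟩

open MeasureTheory Pointwise in
/-- The integral over a coset of the units of `B` of a function that only depends on the residue
class modulo `π ^ n` is a finite sum. -/
lemma IsIntegralModel.setIntegral_eq_sum [T2Space L] [MeasurableSpace Lˣ] [BorelSpace Lˣ]
    (μ : Measure Lˣ) [μ.IsHaarMeasure] {n : ℕ} {Q : Type*} [CommGroup Q] [Fintype Q]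
    {red : Bˣ →* Q} (hsurj : Function.Surjective red)
    (hker : ∀ w, red w = 1 ↔ π ^ n ∣ (w : B) - 1) (τ : Lˣ) {h : Lˣ → ℂ} {H : Q → ℂ}
    (hH : ∀ w, h (τ * Units.map g.toMonoidHom w) = H (red w)) :
    ∫ u in {u | ∃ w : Bˣ, u = τ * Units.map g.toMonoidHom w}, h u ∂μ
      = μ.real (congSubgroup g π n) * ∑ x, H x := by
  obtain ⟨s, hs⟩ := hsurj.hasRightInverse
  set S : Q → Set Lˣ := fun x => (τ * Units.map g.toMonoidHom (s x)) •
    (congSubgroup g π n : Set Lˣ) with hS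
  have hmem : ∀ x w, τ * Units.map g.toMonoidHom w ∈ S x ↔ red w = x := by
    intro x w
    rw [hS, Set.mem_smul_set_iff_inv_smul_mem, smul_eq_mul, mul_inv_rev, mul_assoc,
      inv_mul_cancel_left, ← map_inv, ← map_mul, SetLike.mem_coe,
      map_mem_congSubgroup_iff hg.injective, ← hker, map_mul, map_inv, hs, inv_mul_eq_one, eq_comm]
  have hunion : {u | ∃ w : Bˣ, u = τ * Units.map g.toMonoidHom w} = ⋃ x, S x := by
    ext u
    rw [Set.mem_iUnion]
    constructor
    · rintro ⟨w, rfl⟩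
      exact ⟨red w, (hmem _ w).mpr rfl⟩
    · rintro ⟨x, u, ⟨w, rfl, -⟩, rfl⟩
      exact ⟨s x * w, by simp only [smul_eq_mul, map_mul, mul_assoc]⟩
  have hsub : ∀ x u, u ∈ S x → ∃ w : Bˣ, u = τ * Units.map g.toMonoidHom w := by
    intro x u hu
    have : u ∈ ⋃ x, S x := Set.mem_iUnion.mpr ⟨x, hu⟩
    rwa [← hunion] at this
  have hmeas : ∀ x, MeasurableSet (S x) := fun x =>
    ((hg.isOpen_congSubgroup n).smul _).measurableSet
  have hμ : ∀ x, μ (S x) = μ (congSubgroup g π n) := fun x => measure_smul _ _ _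
  have heq : ∀ x, Set.EqOn h (fun _ => H x) (S x) := by
    intro x u hu
    obtain ⟨w, rfl⟩ := hsub x u hu
    rw [hH, (hmem x w).mp hu]
  rw [hunion, integral_iUnion_fintype hmeas, Finset.mul_sum]
  · refine Finset.sum_congr rfl fun x _ => ?_
    rw [setIntegral_congr_fun (hmeas x) (heq x), setIntegral_const, measureReal_def, hμ,
      Complex.real_smul, measureReal_def]
  · intro x y hxy
    rw [Function.onFun, Set.disjoint_left]
    intro u hx hy
    obtain ⟨w, rfl⟩ := hsub x u hx
    exact hxy (((hmem x w).mp hx).symm.trans ((hmem y w).mp hy))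
  · intro x
    rw [integrableOn_congr_fun (heq x) (hmeas x)]
    refine integrableOn_const ?_ (by simp)
    rw [hμ]
    exact (hg.isCompact_congSubgroup n).measure_lt_top.ne

end Congruence

section Models

open QuadraticAlgebra

variable {F : Type*} [Field F] [ValuativeRel F] [TopologicalSpace F] [IsNonarchimedeanLocalField F]

lemma t2Space_of_isNonarchimedeanLocalField : T2Space F := by
  let := IsTopologicalAddGroup.rightUniformSpace F
  have := isUniformAddGroup_of_addCommGroup (G := F)
  infer_instance

lemma isOpen_range_algebraMap : IsOpen (Set.range (algebraMap 𝒪[F] F)) := by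
  have : Set.range (algebraMap 𝒪[F] F) = (𝒪[F] : Set F) := Subtype.range_coe
  rw [this]
  exact Valuation.isOpen_integer

lemma isCompact_range_algebraMap : IsCompact (Set.range (algebraMap 𝒪[F] F)) := by
  have : Set.range (algebraMap 𝒪[F] F) = (𝒪[F] : Set F) := Subtype.range_coe
  rw [this]
  exact isCompact_iff_compactSpace.mpr (inferInstanceAs (CompactSpace 𝒪[F]))

lemma isOpen_image_dvd {a : 𝒪[F]} (ha : a ≠ 0) : IsOpen (algebraMap 𝒪[F] F '' {x | a ∣ x}) := by
  have ha0 : algebraMap 𝒪[F] F a ≠ 0 :=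
    (map_ne_zero_iff _ (IsFractionRing.injective 𝒪[F] F)).mpr ha
  have : algebraMap 𝒪[F] F '' {x | a ∣ x}
      = (fun x => (algebraMap 𝒪[F] F a)⁻¹ * x) ⁻¹' Set.range (algebraMap 𝒪[F] F) := by
    ext x
    constructor
    · rintro ⟨_, ⟨y, rfl⟩, rfl⟩
      refine ⟨y, ?_⟩
      simp only [map_mul]
      rw [inv_mul_cancel_left₀ ha0]
    · rintro ⟨y, hy⟩
      refine ⟨a * y, dvd_mul_right _ _, ?_⟩
      simp only at hy
      rw [map_mul, hy, mul_inv_cancel_left₀ ha0]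
  rw [this]
  exact isOpen_range_algebraMap.preimage (continuous_const_mul _)

lemma eq_zero_of_forall_pow_dvd {ϖ : 𝒪[F]} (hϖ : Irreducible ϖ) {x : 𝒪[F]}
    (h : ∀ n, ϖ ^ n ∣ x) : x = 0 := by
  by_contra hx
  have := FiniteMultiplicity.of_not_isUnit hϖ.not_isUnit hx
  obtain ⟨n, hn⟩ := this
  exact hn (h _)

lemma isIntegralModel_base {ϖ : 𝒪[F]} (hϖ : Irreducible ϖ) :
    IsIntegralModel (algebraMap 𝒪[F] F) ϖ where
  injective := IsFractionRing.injective 𝒪[F] F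
  isOpen n := isOpen_image_dvd (pow_ne_zero n hϖ.ne_zero)
  isCompact := isCompact_range_algebraMap
  separated _ h := eq_zero_of_forall_pow_dvd hϖ h

variable {E : Type*} [CommRing E] [Algebra F E] [TopologicalSpace E] [IsModuleTopology F E]
  {ϖ D : 𝒪[F]}

/-- The coordinates with respect to the basis `1, δ`. -/
noncomputable def coordHomeo (f : Quad (algebraMap 𝒪[F] F D) ≃ₐ[F] E) : F × F ≃ₜ E :=
  let l : (F × F) ≃ₗ[F] E :=
    { toFun := fun x => f ⟨x.1, x.2⟩
      map_add' := fun x y => by rw [← map_add]; rfl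
      map_smul' := fun c x => by rw [RingHom.id_apply, ← map_smul]; rfl
      invFun := fun y => ((f.symm y).re, (f.symm y).im)
      left_inv := fun x => by simp
      right_inv := fun y => by simp }
  { toEquiv := l.toEquiv
    continuous_toFun := by
      have := IsModuleTopology.toContinuousAdd F E
      exact IsModuleTopology.continuous_of_linearMap (l : F × F →ₗ[F] E)
    continuous_invFun := IsModuleTopology.continuous_of_linearMap (l.symm : E →ₗ[F] F × F) }

lemma t2Space_of_algEquiv (f : Quad (algebraMap 𝒪[F] F D) ≃ₐ[F] E) : T2Space E := by
  have := t2Space_of_isNonarchimedeanLocalField (F := F)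
  exact (coordHomeo f).symm.isEmbedding.t2Space

lemma isTopologicalRing_of_algEquiv (f : Quad (algebraMap 𝒪[F] F D) ≃ₐ[F] E) :
    IsTopologicalRing E := by
  have : Module.Finite F E := Module.Finite.equiv f.toLinearEquiv
  exact IsModuleTopology.isTopologicalRing F E

lemma isIntegralModel_intEmb (hϖ : Irreducible ϖ) (f : Quad (algebraMap 𝒪[F] F D) ≃ₐ[F] E) :
    IsIntegralModel (intEmb f) (Quad.coe D ϖ) where
  injective := intEmb_injective f
  isOpen n := by
    have : intEmb f '' {x | Quad.coe D ϖ ^ n ∣ x} = coordHomeo f ''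
        ((algebraMap 𝒪[F] F '' {x | ϖ ^ n ∣ x}) ×ˢ (algebraMap 𝒪[F] F '' {x | ϖ ^ n ∣ x})) := by
      simp only [coe_pow, coe_dvd_iff]
      ext z
      constructor
      · rintro ⟨x, ⟨h1, h2⟩, rfl⟩
        exact ⟨(algebraMap 𝒪[F] F x.re, algebraMap 𝒪[F] F x.im), ⟨⟨_, h1, rfl⟩, ⟨_, h2, rfl⟩⟩, rfl⟩
      · rintro ⟨⟨_, _⟩, ⟨⟨a, ha, rfl⟩, ⟨b, hb, rfl⟩⟩, rfl⟩
        exact ⟨⟨a, b⟩, ⟨ha, hb⟩, rfl⟩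
    rw [this, Homeomorph.isOpen_image]
    have h := isOpen_image_dvd (pow_ne_zero n hϖ.ne_zero)
    exact h.prod h
  isCompact := by
    have : Set.range (intEmb f) = coordHomeo f ''
        (Set.range (algebraMap 𝒪[F] F) ×ˢ Set.range (algebraMap 𝒪[F] F)) := by
      ext z
      constructor
      · rintro ⟨x, rfl⟩
        exact ⟨(algebraMap 𝒪[F] F x.re, algebraMap 𝒪[F] F x.im), ⟨⟨_, rfl⟩, ⟨_, rfl⟩⟩, rfl⟩
      · rintro ⟨⟨_, _⟩, ⟨⟨a, rfl⟩, ⟨b, rfl⟩⟩, rfl⟩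
        exact ⟨⟨a, b⟩, rfl⟩
    rw [this, Homeomorph.isCompact_image]
    exact isCompact_range_algebraMap.prod isCompact_range_algebraMap
  separated x h := by
    simp only [coe_pow, coe_dvd_iff] at h
    exact QuadraticAlgebra.ext (eq_zero_of_forall_pow_dvd hϖ fun n => (h n).1)
      (eq_zero_of_forall_pow_dvd hϖ fun n => (h n).2)

end Models

/-! ### The twisting characters -/

section Orthogonality

/-- Orthogonality of the characters of a finite abelian group. -/
lemma sum_monoidHom_apply {G : Type*} [CommGroup G] [Finite G] [Fintype (G →* ℂˣ)]
    [DecidableEq G] (u : G) :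
    ∑ ξ : G →* ℂˣ, (ξ u : ℂ) = if u = 1 then (Nat.card G : ℂ) else 0 := by
  split_ifs with hu
  · simp only [hu, map_one, Units.val_one, Finset.sum_const, Finset.card_univ, nsmul_eq_mul, mul_one,
      ← Nat.card_eq_fintype_card, CommGroup.card_monoidHom_of_hasEnoughRootsOfUnity]
  · obtain ⟨η, hη⟩ := CommGroup.exists_apply_ne_one_of_hasEnoughRootsOfUnity G ℂ hu
    refine sum_eq_zero_of_mul_left η (c := (η u : ℂ)) (fun h => hη (Units.val_eq_one.mp h)) ?_
    intro ξ
    rw [MonoidHom.mul_apply, Units.val_mul]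

end Orthogonality

variable {F : Type*} [Field F] [ValuativeRel F] [TopologicalSpace F] [IsNonarchimedeanLocalField F]
variable {ϖ : 𝒪[F]}

/-- The uniformizer as an element of `F^×`. -/
noncomputable def unifUnit (hϖ : Irreducible ϖ) : Fˣ :=
  Units.mk0 (algebraMap 𝒪[F] F ϖ)
    ((map_ne_zero_iff _ (IsFractionRing.injective 𝒪[F] F)).mpr hϖ.ne_zero)

@[simp] lemma coe_unifUnit (hϖ : Irreducible ϖ) : (unifUnit hϖ : F) = algebraMap 𝒪[F] F ϖ := rfl

/-- The map `(w, k) ↦ w ϖ ^ k`. -/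
noncomputable def decompHom (hϖ : Irreducible ϖ) : 𝒪[F]ˣ × Multiplicative ℤ →* Fˣ :=
  (baseUnit F).coprod (zpowersHom Fˣ (unifUnit hϖ))

lemma decompHom_apply (hϖ : Irreducible ϖ) (x : 𝒪[F]ˣ × Multiplicative ℤ) :
    decompHom hϖ x = baseUnit F x.1 * unifUnit hϖ ^ x.2.toAdd := by
  simp [decompHom]

lemma eq_zero_of_baseUnit_mul_pow (hϖ : Irreducible ϖ) {w : 𝒪[F]ˣ} {k : ℕ}
    (h : baseUnit F w * unifUnit hϖ ^ k = 1) : k = 0 := by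
  by_contra hk
  have h1 : (w : 𝒪[F]) * ϖ ^ k = 1 := by
    apply IsFractionRing.injective 𝒪[F] F
    have := congr_arg Units.val h
    simpa using this
  have h2 : ϖ ∣ 1 := (dvd_pow_self ϖ hk).trans (Dvd.intro_left _ h1)
  exact hϖ.not_isUnit (isUnit_of_dvd_one h2)

lemma decompHom_bijective (hϖ : Irreducible ϖ) : Function.Bijective (decompHom hϖ) := by
  constructor
  · rw [injective_iff_map_eq_one]
    rintro ⟨w, k⟩ h
    rw [decompHom_apply] at h
    simp only at h
    have hk : k.toAdd = 0 := by
      rcases Int.eq_nat_or_neg k.toAdd with ⟨n, hn | hn⟩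
      · rw [hn, zpow_natCast] at h
        rw [hn, eq_zero_of_baseUnit_mul_pow hϖ h]
        rfl
      · rw [hn, zpow_neg, zpow_natCast] at h
        have h' : baseUnit F w⁻¹ * unifUnit hϖ ^ n = 1 := by
          have := congr_arg (·⁻¹) h
          simpa [mul_inv, mul_comm] using this
        rw [hn, eq_zero_of_baseUnit_mul_pow hϖ h']
        rfl
    rw [hk, zpow_zero, mul_one] at h
    have hw : w = 1 := by
      apply Units.ext
      apply IsFractionRing.injective 𝒪[F] F
      simpa using congr_arg Units.val h
    rw [hw]
    exact Prod.ext rfl hk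
  · intro u
    obtain ⟨a, b, hb, hab⟩ := IsFractionRing.div_surjective (A := 𝒪[F]) (u : F)
    have hb0 : b ≠ 0 := nonZeroDivisors.ne_zero hb
    have ha0 : a ≠ 0 := by
      rintro rfl
      rw [map_zero, zero_div] at hab
      exact u.ne_zero hab.symm
    obtain ⟨i, v, hv⟩ := IsDiscreteValuationRing.eq_unit_mul_pow_irreducible ha0 hϖ
    obtain ⟨j, w, hw⟩ := IsDiscreteValuationRing.eq_unit_mul_pow_irreducible hb0 hϖ
    refine ⟨(v / w, Multiplicative.ofAdd ((i : ℤ) - j)), ?_⟩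
    rw [decompHom_apply]
    ext
    rw [← hab, hv, hw]
    simp only [map_div, toAdd_ofAdd, zpow_sub, zpow_natCast]
    simp only [Units.val_mul, Units.val_div_eq_div_val, Units.val_inv_eq_inv_val, Units.val_pow_eq_pow_val,
      coe_baseUnit, coe_unifUnit, map_mul, map_pow]
    rw [mul_div_mul_comm, div_eq_mul_inv (algebraMap 𝒪[F] F ϖ ^ i)]

/-- The unit `w` in `u = w ϖ ^ k`. -/
noncomputable def unitPart (hϖ : Irreducible ϖ) : Fˣ →* 𝒪[F]ˣ :=
  (MonoidHom.fst _ _).comp (MulEquiv.ofBijective _ (decompHom_bijective hϖ)).symm.toMonoidHom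

lemma unitPart_decomp (hϖ : Irreducible ϖ) (w : 𝒪[F]ˣ) (k : ℤ) :
    unitPart hϖ (baseUnit F w * unifUnit hϖ ^ k) = w := by
  have : (MulEquiv.ofBijective _ (decompHom_bijective hϖ)).symm (baseUnit F w * unifUnit hϖ ^ k)
      = (w, Multiplicative.ofAdd k) := by
    rw [MulEquiv.symm_apply_eq]
    exact (decompHom_apply hϖ (w, Multiplicative.ofAdd k)).symm
  rw [unitPart, MonoidHom.comp_apply]
  exact congr_arg Prod.fst this

lemma unitPart_baseUnit (hϖ : Irreducible ϖ) (w : 𝒪[F]ˣ) : unitPart hϖ (baseUnit F w) = w := by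
  simpa using unitPart_decomp hϖ w 0

lemma unitPart_unifUnit (hϖ : Irreducible ϖ) : unitPart hϖ (unifUnit hϖ) = 1 := by
  simpa using unitPart_decomp hϖ 1 1

lemma exists_eq_baseUnit_mul (hϖ : Irreducible ϖ) (u : Fˣ) :
    ∃ k : ℤ, u = baseUnit F (unitPart hϖ u) * unifUnit hϖ ^ k := by
  obtain ⟨⟨w, k⟩, rfl⟩ := (decompHom_bijective hϖ).surjective u
  refine ⟨k.toAdd, ?_⟩
  rw [decompHom_apply, unitPart_decomp]

/-- The character of `F^×` with value `1` at `ϖ` that extends a character of `(O_F / ϖ ^ n)^×`. -/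
noncomputable def twistOf (hϖ : Irreducible ϖ) (n : ℕ) (ξ : (Res ϖ n)ˣ →* ℂˣ) : Fˣ →* ℂˣ :=
  ξ.comp ((Units.map (toRes ϖ n : 𝒪[F] →* Res ϖ n)).comp (unitPart hϖ))

lemma twistOf_apply (hϖ : Irreducible ϖ) {n : ℕ} (ξ : (Res ϖ n)ˣ →* ℂˣ) (u : Fˣ) :
    twistOf hϖ n ξ u = ξ (Units.map (toRes ϖ n : 𝒪[F] →* Res ϖ n) (unitPart hϖ u)) := rfl

lemma twistOf_injective (hϖ : Irreducible ϖ) (n : ℕ) : Function.Injective (twistOf hϖ n) := by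
  intro ξ ξ' h
  ext1 x
  obtain ⟨w, rfl⟩ := unitsMap_toRes_surjective hϖ n x
  have := DFunLike.congr_fun h (baseUnit F w)
  rwa [twistOf_apply, twistOf_apply, unitPart_baseUnit] at this

lemma map_toRes_eq_one_iff {n : ℕ} {w : 𝒪[F]ˣ} :
    Units.map (toRes ϖ n : 𝒪[F] →* Res ϖ n) w = 1 ↔ ϖ ^ n ∣ (w : 𝒪[F]) - 1 := by
  rw [Units.ext_iff]
  change toRes ϖ n w = 1 ↔ _
  rw [← map_one (toRes ϖ n), toRes_eq_iff]

lemma mem_range_twistOf_iff (hϖ : Irreducible ϖ) {n : ℕ} {χ : Fˣ →* ℂˣ} :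
    χ ∈ Set.range (twistOf hϖ n) ↔ χ (unifUnit hϖ) = 1 ∧
      ∀ w : 𝒪[F]ˣ, ϖ ^ n ∣ (w : 𝒪[F]) - 1 → χ (baseUnit F w) = 1 := by
  constructor
  · rintro ⟨ξ, rfl⟩
    refine ⟨?_, fun w hw => ?_⟩
    · rw [twistOf_apply, unitPart_unifUnit, map_one, map_one]
    · rw [twistOf_apply, unitPart_baseUnit, map_toRes_eq_one_iff.mpr hw, map_one]
  · rintro ⟨h1, h2⟩
    have hker : (Units.map (toRes ϖ n : 𝒪[F] →* Res ϖ n)).ker ≤ (χ.comp (baseUnit F)).ker := by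
      intro w hw
      exact h2 w (map_toRes_eq_one_iff.mp hw)
    refine ⟨MonoidHom.liftOfSurjective _ (unitsMap_toRes_surjective hϖ n) ⟨_, hker⟩, ?_⟩
    ext1 u
    have h3 := MonoidHom.liftOfRightInverse_comp_apply (Units.map (toRes ϖ n : 𝒪[F] →* Res ϖ n))
      _ (Function.rightInverse_surjInv (unitsMap_toRes_surjective hϖ n)) ⟨_, hker⟩ (unitPart hϖ u)
    obtain ⟨k, hk⟩ := exists_eq_baseUnit_mul hϖ u
    rw [twistOf_apply]
    refine h3.trans ?_
    conv_rhs => rw [hk]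
    rw [map_mul, map_zpow, h1, one_zpow, mul_one]
    rfl

lemma range_twistOf_mono (hϖ : Irreducible ϖ) {i j : ℕ} (hij : i ≤ j) :
    Set.range (twistOf hϖ i) ⊆ Set.range (twistOf hϖ j) := by
  intro χ
  simp only [mem_range_twistOf_iff]
  exact fun ⟨h1, h2⟩ => ⟨h1, fun w hw => h2 w ((pow_dvd_pow ϖ hij).trans hw)⟩

lemma level_base_eq (hϖ : Irreducible ϖ) (χ : Fˣ →* ℂˣ) :
    level F χ = sInf {n | ∀ w : 𝒪[F]ˣ, ϖ ^ n ∣ (w : 𝒪[F]) - 1 → χ (baseUnit F w) = 1} := by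
  rw [level]
  congr 1
  ext n
  simp only [mem_unitFiltration_base_iff hϖ, Set.mem_ofPred_eq]
  constructor
  · intro h w hw
    exact h _ ⟨w, rfl, hw⟩
  · rintro h _ ⟨w, rfl, hw⟩
    exact h w hw

/-- The characters of level `n` are those that factor through `(O_F / ϖ ^ n)^×`, but not through
`(O_F / ϖ ^ (n - 1))^×`. Continuity corresponds to the existence of a level, as `ℂˣ` has no small
subgroups. -/
lemma mem_twists_iff (hϖ : Irreducible ϖ) {n : ℕ} {χ : Fˣ →* ℂˣ} :
    χ ∈ twists ϖ n ↔ χ ∈ Set.range (twistOf hϖ n) ∧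
      (1 ≤ n → χ ∉ Set.range (twistOf hϖ (n - 1))) := by
  have hϖ1 : (∀ u : Fˣ, (u : F) = ϖ → χ u = 1) ↔ χ (unifUnit hϖ) = 1 :=
    ⟨fun h => h _ rfl, fun h u hu => by rwa [show u = unifUnit hϖ from Units.ext hu]⟩
  have hm := isIntegralModel_base hϖ
  have := t2Space_of_isNonarchimedeanLocalField (F := F)
  simp only [twists, Set.mem_ofPred_eq, hϖ1, level_base_eq hϖ, mem_range_twistOf_iff]
  set S := {n | ∀ w : 𝒪[F]ˣ, ϖ ^ n ∣ (w : 𝒪[F]) - 1 → χ (baseUnit F w) = 1} with hS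
  have hup : ∀ i j, i ≤ j → i ∈ S → j ∈ S := fun i j hij hi w hw =>
    hi w ((pow_dvd_pow ϖ hij).trans hw)
  constructor
  · rintro ⟨hc, h1, rfl⟩
    have hne : S.Nonempty := hm.exists_forall_eq_one hc
    refine ⟨⟨h1, Nat.sInf_mem hne⟩, fun hn ⟨_, h⟩ => ?_⟩
    have := Nat.sInf_le (s := S) h
    omega
  · rintro ⟨⟨h1, hn⟩, hn'⟩
    refine ⟨hm.continuous_of_forall_eq_one hn, h1, le_antisymm (Nat.sInf_le hn) ?_⟩
    by_contra! hlt
    exact hn' (by omega) ⟨h1, hup _ (n - 1) (by omega) (Nat.sInf_mem (s := S) ⟨n, hn⟩)⟩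

lemma twists_zero (hϖ : Irreducible ϖ) : twists ϖ 0 = Set.range (twistOf hϖ 0) := by
  ext χ
  rw [mem_twists_iff hϖ]
  simp

lemma twists_eq_diff (hϖ : Irreducible ϖ) {n : ℕ} (hn : 1 ≤ n) :
    twists ϖ n = Set.range (twistOf hϖ n) \ Set.range (twistOf hϖ (n - 1)) := by
  ext χ
  rw [mem_twists_iff hϖ, Set.mem_sdiff]
  simp [hn]

instance finite_units_res_hom [Fact (Irreducible ϖ)] (n : ℕ) : Finite ((Res ϖ n)ˣ →* ℂˣ) := by
  have h : Nat.card ((Res ϖ n)ˣ →* ℂˣ) ≠ 0 := by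
    rw [CommGroup.card_monoidHom_of_hasEnoughRootsOfUnity]
    exact Nat.card_pos.ne'
  exact Nat.finite_of_card_ne_zero h

lemma ncard_range_twistOf (hϖ : Irreducible ϖ) (n : ℕ) :
    (Set.range (twistOf hϖ n)).ncard = Nat.card (Res ϖ n)ˣ := by
  have := Fact.mk hϖ
  rw [Set.ncard_range_of_injective (twistOf_injective hϖ n),
    CommGroup.card_monoidHom_of_hasEnoughRootsOfUnity]

lemma finite_range_twistOf (hϖ : Irreducible ϖ) (n : ℕ) : (Set.range (twistOf hϖ n)).Finite := by
  have := Fact.mk hϖ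
  exact Set.finite_range _

lemma ncard_twists (hϖ : Irreducible ϖ) {n : ℕ} (hn : 1 ≤ n) :
    (twists ϖ n).ncard + Nat.card (Res ϖ (n - 1))ˣ = Nat.card (Res ϖ n)ˣ := by
  rw [twists_eq_diff hϖ hn, ← ncard_range_twistOf hϖ, ← ncard_range_twistOf hϖ]
  exact Set.ncard_sdiff_add_ncard_of_subset (range_twistOf_mono hϖ (by omega))
    (finite_range_twistOf hϖ n)

lemma finsum_mem_twists (hϖ : Irreducible ϖ) {n : ℕ} (hn : 1 ≤ n) (g : (Fˣ →* ℂˣ) → ℂ) :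
    ∑ᶠ χ ∈ twists ϖ n, g χ = ∑ᶠ ξ, g (twistOf hϖ n ξ) - ∑ᶠ ξ, g (twistOf hϖ (n - 1) ξ) := by
  rw [twists_eq_diff hϖ hn, ← finsum_mem_range (twistOf_injective hϖ n),
    ← finsum_mem_range (twistOf_injective hϖ (n - 1)), eq_sub_iff_add_eq, add_comm]
  exact finsum_mem_add_sdiff (range_twistOf_mono hϖ (by omega)) (finite_range_twistOf hϖ n)

/-! ### Gauss integrals as Gauss sums over `O_F / ϖ ^ m` -/

open QuadraticAlgebra

section Reduction

variable {O : Type*} [CommRing O] {ϖ D : O}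

/-- The projection from `O / ϖ ^ m` to `O / ϖ ^ n`. -/
def resTo (ϖ : O) {m n : ℕ} (h : n ≤ m) : Res ϖ m →+* Res ϖ n :=
  Ideal.Quotient.factor (by
    rw [Ideal.span_singleton_le_span_singleton]
    exact pow_dvd_pow ϖ h)

@[simp] lemma resTo_toRes {m n : ℕ} (h : n ≤ m) (x : O) :
    resTo ϖ h (toRes ϖ m x) = toRes ϖ n x := rfl

lemma resTo_eq_iff {m n : ℕ} (h : n ≤ m) {x y : Res ϖ m} :
    resTo ϖ h x = resTo ϖ h y ↔ toRes ϖ m ϖ ^ n ∣ x - y := by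
  obtain ⟨x, rfl⟩ := toRes_surjective ϖ m x
  obtain ⟨y, rfl⟩ := toRes_surjective ϖ m y
  rw [resTo_toRes, resTo_toRes, toRes_eq_iff, ← map_sub, toRes_pow_dvd_iff h]

/-- The reduction of units of the quadratic algebra. -/
def redUnits (ϖ D : O) (m : ℕ) : (Quad D)ˣ →* (Quad (toRes ϖ m D))ˣ :=
  Units.map (Quad.map (toRes ϖ m) D).toMonoidHom

@[simp] lemma coe_redUnits {m : ℕ} (w : (Quad D)ˣ) :
    (redUnits ϖ D m w : Quad (toRes ϖ m D)) = Quad.map (toRes ϖ m) D w := rfl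

lemma redUnits_eq_one_iff {m : ℕ} (w : (Quad D)ˣ) :
    redUnits ϖ D m w = 1 ↔ Quad.coe D ϖ ^ m ∣ (w : Quad D) - 1 := by
  rw [coe_pow, coe_dvd_iff, Units.ext_iff, coe_redUnits, QuadraticAlgebra.ext_iff]
  simp only [Quad.map_re, Quad.map_im, Units.val_one, re_one, im_one, re_sub, im_sub, sub_zero]
  rw [← map_one (toRes ϖ m), toRes_eq_iff, toRes_eq_zero]

variable [IsDomain O] [IsDiscreteValuationRing O]

lemma redUnits_surjective (hϖ : Irreducible ϖ) {m : ℕ} (hm : 1 ≤ m) :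
    Function.Surjective (redUnits ϖ D m) := by
  intro x
  obtain ⟨a, ha⟩ := toRes_surjective ϖ m (x : Quad (toRes ϖ m D)).re
  obtain ⟨b, hb⟩ := toRes_surjective ϖ m (x : Quad (toRes ϖ m D)).im
  have h : Quad.map (toRes ϖ m) D ⟨a, b⟩ = x := QuadraticAlgebra.ext ha hb
  have hu : IsUnit (⟨a, b⟩ : Quad D) := by
    have := isUnit_iff_norm_isUnit.mp x.isUnit
    rw [← h, Quad.norm_map, isUnit_toRes_iff hϖ hm] at this
    exact isUnit_iff_norm_isUnit.mpr this
  exact ⟨hu.unit, Units.ext h⟩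

lemma isUnit_re_of_dvd_im (hϖ : Irreducible ϖ) (x : (Quad D)ˣ) (h : ϖ ∣ (x : Quad D).im) :
    IsUnit (x : Quad D).re := by
  have := (isUnit_quad_iff_not_dvd hϖ).mp x.isUnit
  rw [isUnit_iff_not_dvd hϖ]
  intro h0
  rw [quad_norm] at this
  exact this (dvd_sub (h0.mul_left _) (h.mul_left _))

lemma trivOn_of_forall (hϖ : Irreducible ϖ) {θ : (Quad D)ˣ →* ℂˣ}
    (hθ : ∀ a, θ (Quad.coeUnit D a) = 1) {m : ℕ} (hm : 1 ≤ m)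
    (h : ∀ w : (Quad D)ˣ, Quad.coe D ϖ ^ m ∣ (w : Quad D) - 1 → θ w = 1) : TrivOn ϖ θ m := by
  intro x hx
  obtain ⟨y, hy, b, hb⟩ := exists_unit_re_one hθ x
    (isUnit_re_of_dvd_im hϖ x ((dvd_pow_self ϖ (by omega)).trans hx))
  rw [← hy]
  apply h
  rw [hb, coe_pow, coe_dvd_iff]
  simpa using hx.mul_right b

/-- A character of conductor at most `m` factors through the units of the residue algebra. -/
lemma exists_redUnits_lift (hϖ : Irreducible ϖ) {m : ℕ} (hm : 1 ≤ m) {θ : (Quad D)ˣ →* ℂˣ}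
    (hθ : TrivOn ϖ θ m) :
    ∃ θr : (Quad (toRes ϖ m D))ˣ →* ℂˣ, ∀ w, θr (redUnits ϖ D m w) = θ w := by
  have hker : (redUnits ϖ D m).ker ≤ θ.ker := by
    intro w hw
    have h := (redUnits_eq_one_iff w).mp hw
    rw [coe_pow, coe_dvd_iff] at h
    exact hθ w (by simpa using h.2)
  exact ⟨_, MonoidHom.liftOfRightInverse_comp_apply (redUnits ϖ D m) _
    (Function.rightInverse_surjInv (redUnits_surjective hϖ hm)) ⟨θ, hker⟩⟩

lemma trivOn_redUnits_iff (hϖ : Irreducible ϖ) {m : ℕ} (hm : 1 ≤ m) {θ : (Quad D)ˣ →* ℂˣ}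
    {θr : (Quad (toRes ϖ m D))ˣ →* ℂˣ} (h : ∀ w, θr (redUnits ϖ D m w) = θ w) {j : ℕ}
    (hj : j ≤ m) : TrivOn (toRes ϖ m ϖ) θr j ↔ TrivOn ϖ θ j := by
  constructor
  · intro h1 w hw
    rw [← h]
    apply h1
    rw [coe_redUnits, Quad.map_im, toRes_pow_dvd_iff hj]
    exact hw
  · intro h1 x hx
    obtain ⟨w, rfl⟩ := redUnits_surjective hϖ hm x
    rw [h]
    apply h1
    rwa [coe_redUnits, Quad.map_im, toRes_pow_dvd_iff hj] at hx

end Reduction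

section AddChar

variable {F : Type*} [Field F] [ValuativeRel F] [TopologicalSpace F] [IsNonarchimedeanLocalField F]
variable {ϖ : 𝒪[F]}

/-- The character `x ↦ ψ(v x / ϖ ^ m)` of `O_F / ϖ ^ m` is primitive if `ψ` is unramified and `v` is
a unit. -/
lemma exists_addChar_res (hϖ : Irreducible ϖ) {ψ : AddChar F Circle} (hψ : IsUnramified ψ)
    {m : ℕ} (hm : 1 ≤ m) {c : F} (v : 𝒪[F]ˣ)
    (hc : c * algebraMap 𝒪[F] F ϖ ^ m = algebraMap 𝒪[F] F v) :
    ∃ Ψ : AddChar (Res ϖ m) ℂ, (∀ a, Ψ (toRes ϖ m a) = ψ (algebraMap 𝒪[F] F a * c)) ∧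
      ∃ t, Ψ (toRes ϖ m ϖ ^ (m - 1) * t) ≠ 1 := by
  obtain ⟨h1, x, hx, hψx⟩ := hψ
  have hϖ0 : algebraMap 𝒪[F] F ϖ ≠ 0 :=
    (map_ne_zero_iff _ (IsFractionRing.injective 𝒪[F] F)).mpr hϖ.ne_zero
  have hwd : ∀ a b : 𝒪[F], toRes ϖ m a = toRes ϖ m b →
      ψ (algebraMap 𝒪[F] F a * c) = ψ (algebraMap 𝒪[F] F b * c) := by
    intro a b hab
    obtain ⟨k, hk⟩ := toRes_eq_iff.mp hab
    have : algebraMap 𝒪[F] F a * c = algebraMap 𝒪[F] F b * c + algebraMap 𝒪[F] F (k * v) := by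
      have hk' := congr_arg (algebraMap 𝒪[F] F) hk
      rw [map_sub, map_mul, map_pow] at hk'
      rw [map_mul, ← hc]
      linear_combination c * hk'
    rw [this, AddChar.map_add_eq_mul]
    have h2 : ψ (algebraMap 𝒪[F] F (k * v)) = 1 := h1 (k * v)
    rw [h2, mul_one]
  have hs := Function.surjInv_eq (toRes_surjective ϖ m)
  refine ⟨⟨fun y => ψ (algebraMap 𝒪[F] F (Function.surjInv (toRes_surjective ϖ m) y) * c), ?_, ?_⟩,
    ?_, ?_⟩
  · rw [hwd _ 0 (by rw [hs, map_zero])]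
    simp
  · intro y z
    rw [hwd _ (Function.surjInv (toRes_surjective ϖ m) y + Function.surjInv (toRes_surjective ϖ m) z)
      (by rw [hs, map_add, hs, hs]), map_add, add_mul, AddChar.map_add_eq_mul, Circle.coe_mul]
  · intro a
    change (ψ _ : ℂ) = _
    rw [hwd _ a (hs _)]
  · obtain ⟨t, ht⟩ : ∃ t : 𝒪[F], algebraMap 𝒪[F] F t = algebraMap 𝒪[F] F ϖ * x := by
      have := hx ϖ (by rw [maximalIdeal_eq_span hϖ]; exact Ideal.mem_span_singleton_self ϖ)
      exact ⟨⟨_, this⟩, rfl⟩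
    refine ⟨toRes ϖ m ((v⁻¹ : 𝒪[F]ˣ) * t), ?_⟩
    rw [← map_pow, ← map_mul]
    change (ψ _ : ℂ) ≠ 1
    rw [hwd _ _ (hs _)]
    have h3 : algebraMap 𝒪[F] F (ϖ ^ (m - 1) * ((v⁻¹ : 𝒪[F]ˣ) * t)) * c = x := by
      have h4 : algebraMap 𝒪[F] F (v⁻¹ : 𝒪[F]ˣ) * algebraMap 𝒪[F] F v = 1 := by
        rw [← map_mul, Units.inv_mul, map_one]
      have h5 : algebraMap 𝒪[F] F ϖ ^ (m - 1) * algebraMap 𝒪[F] F ϖ = algebraMap 𝒪[F] F ϖ ^ m := by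
        rw [← pow_succ]
        congr 1
        omega
      rw [map_mul, map_mul, map_pow, ht]
      linear_combination x * h4 + algebraMap 𝒪[F] F (v⁻¹ : 𝒪[F]ˣ) * x * hc
        + algebraMap 𝒪[F] F (v⁻¹ : 𝒪[F]ˣ) * x * c * h5
    rw [h3]
    exact fun h => hψx (Circle.ext h)

end AddChar

/-- The additive character of the residue algebra through which `ψ ∘ Tr` factors: it depends on the
coordinate `a` of `a + b δ` in the unramified case, and on `b` in the ramified case. -/
def trChar {R : Type*} [CommRing R] (e : ℕ) (D : R) (Ψ : AddChar R ℂ) : AddChar (Quad D) ℂ :=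
  if e = 1 then reChar D Ψ else imChar D Ψ

section GaussInt

variable {F : Type*} [Field F] [ValuativeRel F] [TopologicalSpace F] [IsNonarchimedeanLocalField F]
variable {E : Type*} [CommRing E] [Algebra F E] {ϖ D : 𝒪[F]} {e : ℕ}

lemma algebraMap_ne_zero {a : 𝒪[F]} (ha : a ≠ 0) : algebraMap 𝒪[F] F a ≠ 0 :=
  (map_ne_zero_iff _ (IsFractionRing.injective 𝒪[F] F)).mpr ha

lemma IsDisc.ne_zero (hϖ : Irreducible ϖ) (hD : IsDisc ϖ D e) : D ≠ 0 := by
  rcases hD with ⟨-, hD⟩ | ⟨-, u, hu, rfl⟩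
  · exact hD.ne_zero
  · exact mul_ne_zero hϖ.ne_zero hu.ne_zero

/-- The generator of the radical: `ϖ` in the unramified and `δ` in the ramified case. -/
noncomputable def radGen (ϖ D : 𝒪[F]) (e : ℕ) : Quad D := if e = 1 then Quad.coe D ϖ else ⟨0, 1⟩

lemma jacobson_bot_eq_span_radGen (h2 : IsUnit (2 : 𝒪[F])) (hϖ : Irreducible ϖ)
    (hD : IsDisc ϖ D e) : Ideal.jacobson (⊥ : Ideal (Quad D)) = Ideal.span {radGen ϖ D e} := by
  rcases hD with ⟨rfl, hD⟩ | ⟨rfl, u, hu, hD⟩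
  · exact jacobson_bot_of_isUnit hϖ h2 hD
  · exact jacobson_bot_of_ramified hϖ h2 hu hD

/-- The norm of the generator of the radical is `ϖ²` or `-D`. -/
noncomputable def normRadGen (hϖ : Irreducible ϖ) (hD : IsDisc ϖ D e) : Fˣ :=
  if e = 1 then unifUnit hϖ ^ 2 else -Units.mk0 _ (algebraMap_ne_zero (hD.ne_zero hϖ))

lemma norm_radGen (hϖ : Irreducible ϖ) (hD : IsDisc ϖ D e) :
    algebraMap 𝒪[F] F (norm (radGen ϖ D e)) = normRadGen hϖ hD := by
  rw [radGen, normRadGen]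
  split_ifs <;> simp [quad_norm, pow_two]

lemma norm_intEmb (f : Quad (algebraMap 𝒪[F] F D) ≃ₐ[F] E) (x : Quad D) :
    Algebra.norm F (intEmb f x) = algebraMap 𝒪[F] F (norm x) := by
  rw [intEmb_apply, Algebra.norm_eq_of_algEquiv, norm_quad, Quad.norm_map]

lemma exists_radGen_unit (hϖ : Irreducible ϖ) (hD : IsDisc ϖ D e)
    (f : Quad (algebraMap 𝒪[F] F D) ≃ₐ[F] E) :
    ∃ γ : Eˣ, (γ : E) = intEmb f (radGen ϖ D e) ∧
      Units.map (Algebra.norm F) γ = normRadGen hϖ hD := by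
  have h : IsUnit (intEmb f (radGen ϖ D e)) := by
    apply IsUnit.map f
    rw [isUnit_iff_norm_isUnit, Quad.norm_map, norm_radGen hϖ hD]
    exact Units.isUnit _
  refine ⟨h.unit, rfl, Units.ext ?_⟩
  rw [Units.coe_map, IsUnit.unit_spec]
  change Algebra.norm F _ = _
  rw [norm_intEmb, norm_radGen hϖ hD]

/-- The constant `c` such that `Tr(γ ^ k x) = c ℓ(x)` for the coordinate `ℓ` used in `trChar`. -/
noncomputable def trConst (ϖ D : 𝒪[F]) (e m : ℕ) : F :=
  if e = 1 then 2 * (algebraMap 𝒪[F] F ϖ ^ m)⁻¹ else 2 * (algebraMap 𝒪[F] F D ^ m)⁻¹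

lemma exists_trConst (h2 : IsUnit (2 : 𝒪[F])) (hϖ : Irreducible ϖ) (hD : IsDisc ϖ D e) (m : ℕ) :
    ∃ v : 𝒪[F]ˣ, trConst ϖ D e m * algebraMap 𝒪[F] F ϖ ^ m = algebraMap 𝒪[F] F v := by
  have hϖ0 := pow_ne_zero m (algebraMap_ne_zero hϖ.ne_zero)
  rcases hD with ⟨rfl, hD⟩ | ⟨rfl, u, hu, hD⟩
  · refine ⟨h2.unit, ?_⟩
    rw [trConst, if_pos rfl, mul_assoc, inv_mul_cancel₀ hϖ0, mul_one, IsUnit.unit_spec, map_ofNat]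
  · refine ⟨h2.unit * (hu.unit⁻¹) ^ m, ?_⟩
    have hu0 := algebraMap_ne_zero hu.ne_zero
    have h1 : algebraMap 𝒪[F] F (hu.unit⁻¹ : 𝒪[F]ˣ) = (algebraMap 𝒪[F] F u)⁻¹ := by
      apply eq_inv_of_mul_eq_one_left
      rw [← map_mul, IsUnit.val_inv_mul, map_one]
    rw [trConst, if_neg (by norm_num), hD]
    rw [Units.val_mul, Units.val_pow_eq_pow_val, map_mul, map_mul, map_pow, h1, IsUnit.unit_spec, map_ofNat,
      mul_pow, mul_inv, inv_pow]
    field_simp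

/-- The trace of `γ ^ k x` for the exponent `k` in the Gauss integral. -/
lemma trace_zpow_mul (hϖ : Irreducible ϖ) (hD : IsDisc ϖ D e)
    (f : Quad (algebraMap 𝒪[F] F D) ≃ₐ[F] E) {γ : Eˣ} (hγ : (γ : E) = intEmb f (radGen ϖ D e))
    (m : ℕ) (x : Quad D) :
    Algebra.trace F E ((γ ^ (-((e * m : ℕ) : ℤ) - e + 1) : Eˣ) * intEmb f x)
      = algebraMap 𝒪[F] F (if e = 1 then x.re else x.im) * trConst ϖ D e m := by
  -- Up to the scalar `s`, the element `γ ^ k` is `1` or `δ`.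
  have key : ∀ (s : F) (g : Quad D), s ≠ 0 →
      (γ ^ ((e * m : ℕ) + e - 1 : ℕ) : Eˣ) * (intEmb f g) = algebraMap F E s →
      Algebra.trace F E ((γ ^ (-((e * m : ℕ) : ℤ) - e + 1) : Eˣ) * intEmb f x)
        = s⁻¹ * (2 * algebraMap 𝒪[F] F (g * x).re) := by
    intro s g hs h
    have he := hD.pos
    have hk : (-((e * m : ℕ) : ℤ) - e + 1) = -((e * m + e - 1 : ℕ) : ℤ) := by
      rw [Nat.cast_sub (by nlinarith)]
      push_cast
      ring
    have h1 : ((γ ^ (-((e * m : ℕ) : ℤ) - e + 1) : Eˣ) : E) = algebraMap F E s⁻¹ * intEmb f g := by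
      rw [hk, zpow_neg, zpow_natCast, ← Units.mul_right_inj (γ ^ (e * m + e - 1)), Units.mul_inv,
        mul_left_comm, h, ← map_mul, inv_mul_cancel₀ hs, map_one]
    rw [h1, mul_assoc, ← map_mul, ← Algebra.smul_def, map_smul, smul_eq_mul, intEmb_apply,
      Algebra.trace_eq_of_algEquiv, trace_quad, Quad.map_re]
  have hϖ0 := algebraMap_ne_zero hϖ.ne_zero
  have hD0 := algebraMap_ne_zero (hD.ne_zero hϖ)
  rcases hD with ⟨rfl, hD⟩ | ⟨rfl, u, hu, hD⟩
  · rw [key (algebraMap 𝒪[F] F ϖ ^ m) 1 (pow_ne_zero _ hϖ0) ?_]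
    · rw [trConst, if_pos rfl, if_pos rfl, one_mul]
      ring
    · rw [map_one, mul_one, Units.val_pow_eq_pow_val, hγ, radGen, if_pos rfl, intEmb_coe, map_pow,
        show 1 * m + 1 - 1 = m by omega]
      rfl
  · rw [key (algebraMap 𝒪[F] F D ^ (m + 1)) ⟨0, 1⟩ (pow_ne_zero _ hD0) ?_]
    · rw [trConst, if_neg (by norm_num), if_neg (by norm_num)]
      simp only [re_mul, zero_mul, mul_one, zero_add, map_mul]
      field_simp
      ring
    · have h1 : (γ : E) = intEmb f ⟨0, 1⟩ := by rw [hγ, radGen, if_neg (by norm_num)]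
      have h3 : (γ : E) * γ = algebraMap F E (algebraMap 𝒪[F] F D) := by
        rw [h1, ← map_mul, delta_sq, intEmb_coe]
        rfl
      rw [← h1, Units.val_pow_eq_pow_val, ← pow_succ,
        show 2 * m + 2 - 1 + 1 = 2 * (m + 1) by omega, pow_mul, pow_two, h3, map_pow]

variable [TopologicalSpace E] [IsModuleTopology F E] [MeasurableSpace Eˣ] [BorelSpace Eˣ]

open Classical in
/-- The twisted Gauss integral is, up to a nonzero constant that does not depend on the twist, a
twisted Gauss sum over the units of the residue algebra. -/
lemma exists_gaussInt_eq (h2 : IsUnit (2 : 𝒪[F])) (hϖ : Irreducible ϖ) (hD : IsDisc ϖ D e)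
    (f : Quad (algebraMap 𝒪[F] F D) ≃ₐ[F] E)
    {m : ℕ} [Fintype (Quad (toRes ϖ m D))ˣ] (hm : 1 ≤ m) (μ : MeasureTheory.Measure Eˣ) [μ.IsHaarMeasure]
    {ψ : AddChar F Circle} {Ψ : AddChar (Res ϖ m) ℂ}
    (hΨ : ∀ a, Ψ (toRes ϖ m a) = ψ (algebraMap 𝒪[F] F a * trConst ϖ D e m)) {θ : Eˣ →* ℂˣ}
    (hθ : ∀ a : Fˣ, θ (Units.map (algebraMap F E).toMonoidHom a) = 1)
    (hcond : cond ϖ (restr f θ) = m) {θr : (Quad (toRes ϖ m D))ˣ →* ℂˣ}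
    (hθr : ∀ w, θr (redUnits ϖ D m w) = restr f θ w) :
    ∃ κ : ℂ, κ ≠ 0 ∧ ∀ (n : ℕ) (hn : n ≤ m) (ξ : (Res ϖ n)ˣ →* ℂˣ),
      gaussInt ψ μ θ (twistOf hϖ n ξ) = κ *
        ∑ x : (Quad (toRes ϖ m D))ˣ, ((θr x)⁻¹ : ℂˣ) * trChar e (toRes ϖ m D) Ψ x *
          (ξ (Units.map (toRes ϖ n : 𝒪[F] →* Res ϖ n)
              (unitPart hϖ (normRadGen hϖ hD))) ^ (-((e * m : ℕ) : ℤ) - e + 1) *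
            ξ (Units.map (resTo ϖ hn : Res ϖ m →* Res ϖ n)
              (Units.map (QuadraticAlgebra.norm) x)) : ℂˣ) := by
  obtain ⟨γ, hγ, hNγ⟩ := exists_radGen_unit hϖ hD f
  set k : ℤ := -((e * m : ℕ) : ℤ) - e + 1 with hk
  have hmodel := isIntegralModel_intEmb hϖ f
  have := isTopologicalRing_of_algEquiv f
  have := t2Space_of_algEquiv f
  refine ⟨(μ.real (congSubgroup (intEmb f) (Quad.coe D ϖ) m) : ℂ) * ((θ (γ ^ k))⁻¹ : ℂˣ),
    mul_ne_zero ?_ (Units.ne_zero _), fun n hn ξ => ?_⟩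
  · exact_mod_cast (hmodel.measureReal_congSubgroup_pos μ m).ne'
  have hset : valSet F E (-(level F θ : ℤ) - ramIdx F E + 1)
      = {u | ∃ w : (Quad D)ˣ, u = γ ^ k * Units.map (intEmb f).toMonoidHom w} := by
    ext u
    rw [level_eq h2 hϖ hD f hθ, ramIdx_eq h2 hϖ hD f, hcond,
      mem_valSet_iff (intEquiv h2 hϖ hD f) (jacobson_bot_eq_span_radGen h2 hϖ hD) hγ.symm]
    rfl
  rw [gaussInt, hset, hmodel.setIntegral_eq_sum μ (redUnits_surjective hϖ hm)
    redUnits_eq_one_iff (γ ^ k) (H := fun x => ((θ (γ ^ k))⁻¹ : ℂˣ) *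
      (((θr x)⁻¹ : ℂˣ) * trChar e (toRes ϖ m D) Ψ x *
          (ξ (Units.map (toRes ϖ n : 𝒪[F] →* Res ϖ n)
              (unitPart hϖ (normRadGen hϖ hD))) ^ k *
            ξ (Units.map (resTo ϖ hn : Res ϖ m →* Res ϖ n)
              (Units.map (QuadraticAlgebra.norm) x)) : ℂˣ))) ?_, ← Finset.mul_sum, mul_assoc]
  intro w
  have h3 : twistOf hϖ n ξ (Units.map (Algebra.norm F) (γ ^ k * Units.map (intEmb f).toMonoidHom w))
      = ξ (Units.map (toRes ϖ n : 𝒪[F] →* Res ϖ n) (unitPart hϖ (normRadGen hϖ hD))) ^ k *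
        ξ (Units.map (resTo ϖ hn : Res ϖ m →* Res ϖ n)
          (Units.map (QuadraticAlgebra.norm) (redUnits ϖ D m w))) := by
    have h4 : Units.map (Algebra.norm F) (Units.map (intEmb f).toMonoidHom w)
        = baseUnit F (Units.map (QuadraticAlgebra.norm) w) := Units.ext (norm_intEmb f w)
    rw [map_mul, map_zpow, hNγ, h4, map_mul, map_zpow, twistOf_apply, twistOf_apply,
      unitPart_baseUnit]
    congr 2
  have h5 : (ψ (Algebra.trace F E ((γ ^ k * Units.map (intEmb f).toMonoidHom w : Eˣ) : E)) : ℂ)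
      = trChar e (toRes ϖ m D) Ψ (redUnits ϖ D m w : (Quad (toRes ϖ m D))ˣ) := by
    rw [Units.val_mul]
    have := trace_zpow_mul hϖ hD f hγ m (w : Quad D)
    rw [← hk] at this
    change (ψ (Algebra.trace F E ((γ ^ k : Eˣ) * intEmb f (w : Quad D))) : ℂ) = _
    rw [this, ← hΨ, trChar]
    split_ifs <;> simp
  rw [h3, h5, map_mul, hθr, restr_apply, mul_inv]
  push_cast
  ring

end GaussInt

/-! ### The normalized correlation in terms of sums over pairs of equal norm -/

open QuadraticAlgebra ComplexConjugate

variable {F : Type*} [Field F] [ValuativeRel F] [TopologicalSpace F] [IsNonarchimedeanLocalField F]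

/-- The product of a twisted Gauss sum and the conjugate of another one, as a double sum. -/
lemma twisted_sum_mul_conj {A B G : Type*} [CommRing A] [Fintype Aˣ] [CommRing B] [Fintype B]
    [Fintype Bˣ] [CommGroup G] [Finite G] (θ : Aˣ →* ℂˣ) (θ' : Bˣ →* ℂˣ) (Φ : AddChar A ℂ)
    (Φ' : AddChar B ℂ) (ξ : G →* ℂˣ) (α α' : G) (N : Aˣ → G) (N' : Bˣ → G) (κ κ' : ℂ) :
    (κ * ∑ x, ((θ x)⁻¹ : ℂˣ) * Φ x * (ξ α * ξ (N x) : ℂˣ))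
      * conj (κ' * ∑ y, ((θ' y)⁻¹ : ℂˣ) * Φ' y * (ξ α' * ξ (N' y) : ℂˣ)) = κ * conj κ' *
      ∑ x : Aˣ, ∑ y : Bˣ,
        (((θ x)⁻¹ : ℂˣ) * Φ x : ℂ) * (θ' y * Φ' (-y)) * ξ (α * N x * (α' * N' y)⁻¹) := by
  rw [map_mul (starRingEnd ℂ), mul_mul_mul_comm, map_sum, Finset.sum_mul_sum]
  congr 1
  refine Finset.sum_congr rfl fun x _ => Finset.sum_congr rfl fun y _ => ?_
  have h3 : conj ((((θ' y)⁻¹ : ℂˣ)) : ℂ) = θ' y := by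
    have := conj_char θ'⁻¹ y
    simpa using this
  rw [← map_mul ξ, ← map_mul ξ, map_mul (starRingEnd ℂ), map_mul (starRingEnd ℂ), conj_char ξ,
    conj_addChar, h3, map_mul ξ (α * N x), map_inv]
  push_cast
  ring

set_option maxHeartbeats 1600000 in
open Classical in
/-- By orthogonality of the twists, the sum over all twists of level at most `n` only involves pairs
of units of equal norm modulo `ϖ ^ n`. -/
lemma exists_finsum_gaussInt_eq {E : Type*} [CommRing E] [Algebra F E] [TopologicalSpace E]
    [IsModuleTopology F E] [MeasurableSpace Eˣ] [BorelSpace Eˣ]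
    {E' : Type*} [CommRing E'] [Algebra F E'] [TopologicalSpace E']
    [IsModuleTopology F E'] [MeasurableSpace E'ˣ] [BorelSpace E'ˣ] {ϖ D D' : 𝒪[F]} {e : ℕ}
    (h2 : IsUnit (2 : 𝒪[F])) (hϖ : Irreducible ϖ) (hD : IsDisc ϖ D e) (hD' : IsDisc ϖ D' e)
    (f : Quad (algebraMap 𝒪[F] F D) ≃ₐ[F] E) (f' : Quad (algebraMap 𝒪[F] F D') ≃ₐ[F] E')
    {m : ℕ} [Fintype (Res ϖ m)] (hm : 1 ≤ m) (μ : MeasureTheory.Measure Eˣ) [μ.IsHaarMeasure]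
    (μ' : MeasureTheory.Measure E'ˣ) [μ'.IsHaarMeasure]
    {ψ : AddChar F Circle} {Ψ Ψ' : AddChar (Res ϖ m) ℂ}
    (hΨ : ∀ a, Ψ (toRes ϖ m a) = ψ (algebraMap 𝒪[F] F a * trConst ϖ D e m))
    (hΨ' : ∀ a, Ψ' (toRes ϖ m a) = ψ (algebraMap 𝒪[F] F a * trConst ϖ D' e m))
    {θ : Eˣ →* ℂˣ} {θ' : E'ˣ →* ℂˣ}
    (hθ : ∀ a : Fˣ, θ (Units.map (algebraMap F E).toMonoidHom a) = 1)
    (hθ' : ∀ a : Fˣ, θ' (Units.map (algebraMap F E').toMonoidHom a) = 1)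
    (hcond : cond ϖ (restr f θ) = m) (hcond' : cond ϖ (restr f' θ') = m)
    {θr : (Quad (toRes ϖ m D))ˣ →* ℂˣ} {θr' : (Quad (toRes ϖ m D'))ˣ →* ℂˣ}
    (hθr : ∀ w, θr (redUnits ϖ D m w) = restr f θ w)
    (hθr' : ∀ w, θr' (redUnits ϖ D' m w) = restr f' θ' w)
    {ρ : 𝒪[F]ˣ} (hρ : unitPart hϖ (normRadGen hϖ hD') ^ (-((e * m : ℕ) : ℤ) - e + 1)
      = unitPart hϖ (normRadGen hϖ hD) ^ (-((e * m : ℕ) : ℤ) - e + 1) * ρ) :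
    ∃ K : ℂ, K ≠ 0 ∧ ∀ n ≤ m,
      ∑ᶠ ξ : (Res ϖ n)ˣ →* ℂˣ, gaussInt ψ μ θ (twistOf hϖ n ξ)
        * conj (gaussInt ψ μ' θ' (twistOf hϖ n ξ))
      = K * (Nat.card (Res ϖ n)ˣ * pairSum (toRes ϖ m ϖ) (toRes ϖ m ρ)
          (trChar e (toRes ϖ m D) Ψ) (trChar e (toRes ϖ m D') Ψ') θr θr' n) := by
  obtain ⟨κ, hκ, h⟩ := exists_gaussInt_eq h2 hϖ hD f hm μ hΨ hθ hcond hθr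
  obtain ⟨κ', hκ', h'⟩ := exists_gaussInt_eq h2 hϖ hD' f' hm μ' hΨ' hθ' hcond' hθr'
  refine ⟨κ * conj κ', mul_ne_zero hκ ((map_ne_zero _).mpr hκ'), fun n hn => ?_⟩
  have := Fact.mk hϖ
  have := Fintype.ofFinite ((Res ϖ n)ˣ →* ℂˣ)
  have : Finite (Res ϖ n)ˣ := inferInstance
  set k : ℤ := -((e * m : ℕ) : ℤ) - e + 1 with hk
  set α := Units.map (toRes ϖ n : 𝒪[F] →* Res ϖ n) (unitPart hϖ (normRadGen hϖ hD)) ^ k with hα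
  set α' := Units.map (toRes ϖ n : 𝒪[F] →* Res ϖ n) (unitPart hϖ (normRadGen hϖ hD')) ^ k with hα'
  set N : (Quad (toRes ϖ m D))ˣ → (Res ϖ n)ˣ := fun x =>
    Units.map (resTo ϖ hn : Res ϖ m →* Res ϖ n) (Units.map (QuadraticAlgebra.norm) x) with hN
  set N' : (Quad (toRes ϖ m D'))ˣ → (Res ϖ n)ˣ := fun x =>
    Units.map (resTo ϖ hn : Res ϖ m →* Res ϖ n) (Units.map (QuadraticAlgebra.norm) x) with hN'
  set Φ := trChar e (toRes ϖ m D) Ψ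
  set Φ' := trChar e (toRes ϖ m D') Ψ'
  have hαα' : α' = α * Units.map (toRes ϖ n : 𝒪[F] →* Res ϖ n) ρ := by
    set u := Units.map (toRes ϖ n : 𝒪[F] →* Res ϖ n)
    rw [hα, hα', ← map_zpow u, ← map_zpow u, hρ, map_mul u]
  have h1 : ∀ ξ : (Res ϖ n)ˣ →* ℂˣ, gaussInt ψ μ θ (twistOf hϖ n ξ)
        * conj (gaussInt ψ μ' θ' (twistOf hϖ n ξ)) = κ * conj κ' *
      ∑ x : (Quad (toRes ϖ m D))ˣ, ∑ y : (Quad (toRes ϖ m D'))ˣ,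
        (((θr x)⁻¹ : ℂˣ) * Φ x : ℂ) * (θr' y * Φ' (-y)) * ξ (α * N x * (α' * N' y)⁻¹) := by
    intro ξ
    have e1 : gaussInt ψ μ θ (twistOf hϖ n ξ)
        = κ * ∑ x, ((θr x)⁻¹ : ℂˣ) * Φ x * (ξ α * ξ (N x) : ℂˣ) := by
      rw [h n hn ξ]
      congr 1
      refine Finset.sum_congr rfl fun x _ => ?_
      rw [hα, map_zpow ξ]
    have e2 : gaussInt ψ μ' θ' (twistOf hϖ n ξ)
        = κ' * ∑ x, ((θr' x)⁻¹ : ℂˣ) * Φ' x * (ξ α' * ξ (N' x) : ℂˣ) := by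
      rw [h' n hn ξ]
      congr 1
      refine Finset.sum_congr rfl fun x _ => ?_
      rw [hα', map_zpow ξ]
    rw [e1, e2]
    exact twisted_sum_mul_conj θr θr' Φ Φ' ξ _ _ N N' κ κ'
  have h4 : ∀ x y, (α * N x * (α' * N' y)⁻¹ = 1) ↔
      toRes ϖ m ϖ ^ n ∣ norm (x : Quad (toRes ϖ m D))
        - toRes ϖ m ρ * norm (y : Quad (toRes ϖ m D')) := by
    intro x y
    rw [mul_inv_eq_one, hαα', mul_assoc, mul_right_inj, Units.ext_iff, ← resTo_eq_iff hn, map_mul,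
      resTo_toRes]
    rfl
  rw [finsum_eq_sum_of_fintype, Finset.sum_congr rfl fun ξ _ => h1 ξ, ← Finset.mul_sum]
  congr 1
  rw [Finset.sum_comm, pairSum, Finset.mul_sum]
  refine Finset.sum_congr rfl fun x _ => ?_
  rw [Finset.sum_comm, Finset.mul_sum]
  refine Finset.sum_congr rfl fun y _ => ?_
  rw [← Finset.mul_sum, sum_monoidHom_apply]
  simp only [h4]
  split_ifs
  · ring
  · ring

/-- The number of units of `O_F / ϖ ^ n`, for a residue field with `q` elements. -/
noncomputable def unitCount (q : ℝ) (n : ℕ) : ℝ := if n = 0 then 1 else q ^ n - q ^ (n - 1)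

lemma card_units_res_eq {ϖ : 𝒪[F]} (hϖ : Irreducible ϖ) (h2 : IsUnit (2 : 𝒪[F])) (n : ℕ) :
    (Nat.card (Res ϖ n)ˣ : ℝ) = unitCount (Nat.card 𝓀[F]) n := by
  rw [unitCount]
  split_ifs with hn
  · subst hn
    rw [card_units_res_zero, Nat.cast_one]
  · rw [eq_sub_iff_add_eq]
    exact_mod_cast card_units_res hϖ h2 (by omega)

/-- The normalized correlation in terms of the sums `T n` over pairs of equal norm modulo `ϖ ^ n`.
The twists of exact level `n ≥ 1` are those of level at most `n` without those of level at most
`n - 1`; for `n = 0` there is only the trivial twist. -/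
noncomputable def corrOf (q : ℝ) (T : ℕ → ℂ) (n : ℕ) : ℂ :=
  if n = 0 then 1 else (unitCount q n * T n - unitCount q (n - 1) * T (n - 1))
    / ((unitCount q n - unitCount q (n - 1) : ℝ) * T 0)

lemma unitCount_pos {q : ℝ} (hq : 3 ≤ q) (n : ℕ) : 0 < unitCount q n := by
  rw [unitCount]
  split_ifs with hn
  · norm_num
  · obtain ⟨k, rfl⟩ : ∃ k, n = k + 1 := ⟨n - 1, by omega⟩
    rw [Nat.add_sub_cancel, pow_succ]
    have : 0 < q ^ k := by positivity
    nlinarith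

lemma unitCount_one (q : ℝ) : unitCount q 1 = q - 1 := by simp [unitCount]

lemma unitCount_zero (q : ℝ) : unitCount q 0 = 1 := by simp [unitCount]

lemma unitCount_succ (q : ℝ) {n : ℕ} (hn : 2 ≤ n) :
    unitCount q n = q * unitCount q (n - 1) := by
  obtain ⟨k, rfl⟩ : ∃ k, n = k + 2 := ⟨n - 2, by omega⟩
  rw [show k + 2 - 1 = k + 1 from rfl, unitCount, unitCount, if_neg (by omega), if_neg (by omega),
    Nat.add_sub_cancel, show k + 2 - 1 = k + 1 from rfl]
  ring

/-- The number of twists of exact level `n`. -/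
lemma unitCount_sub_pos {q : ℝ} (hq : 3 ≤ q) {n : ℕ} (hn : 1 ≤ n) :
    0 < unitCount q n - unitCount q (n - 1) := by
  rcases hn.eq_or_lt with rfl | hn
  · rw [unitCount_one, unitCount_zero]
    linarith
  · rw [unitCount_succ q hn]
    nlinarith [unitCount_pos hq (n - 1)]

/-- The sums over all twists of level at most `n` determine the normalized correlation. -/
lemma gaussNorm_ne_zero_and_gaussCorr_eq {E : Type*} [CommRing E] [Algebra F E]
    [TopologicalSpace E] [MeasurableSpace Eˣ]
    {E' : Type*} [CommRing E'] [Algebra F E'] [TopologicalSpace E'] [MeasurableSpace E'ˣ]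
    {ϖ : 𝒪[F]} (hϖ : Irreducible ϖ) (h2 : IsUnit (2 : 𝒪[F])) (hq : (3 : ℝ) ≤ Nat.card 𝓀[F])
    {μ : MeasureTheory.Measure Eˣ} {μ' : MeasureTheory.Measure E'ˣ} {ψ : AddChar F Circle}
    {θ : Eˣ →* ℂˣ} {θ' : E'ˣ →* ℂˣ} {T : ℕ → ℂ} (hT : T 0 ≠ 0) {m : ℕ} {K : ℂ} (hK : K ≠ 0)
    (hS : ∀ n ≤ m, ∑ᶠ ξ : (Res ϖ n)ˣ →* ℂˣ, gaussInt ψ μ θ (twistOf hϖ n ξ)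
        * conj (gaussInt ψ μ' θ' (twistOf hϖ n ξ)) = K * (Nat.card (Res ϖ n)ˣ * T n))
    {n : ℕ} (hn : n ≤ m) :
    gaussNorm ϖ ψ μ μ' θ θ' n ≠ 0 ∧
      gaussCorr ϖ ψ μ μ' θ θ' n = corrOf (Nat.card 𝓀[F]) T n := by
  have h0 : gaussInt ψ μ θ 1 * conj (gaussInt ψ μ' θ' 1) = K * T 0 := by
    have h1 := hS 0 (Nat.zero_le _)
    rw [card_units_res_zero, Nat.cast_one, one_mul] at h1
    rw [← h1]
    have hsub : Subsingleton (Res ϖ 0)ˣ := by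
      have : Subsingleton (Res ϖ 0) := by
        rw [Ideal.Quotient.subsingleton_iff, pow_zero, Ideal.span_singleton_one]
      infer_instance
    have hu : ∀ ξ : (Res ϖ 0)ˣ →* ℂˣ, ξ = 1 := by
      intro ξ
      ext1 x
      rw [Subsingleton.elim x 1, map_one, map_one]
    rw [finsum_eq_single _ 1 fun ξ hξ => absurd (hu ξ) hξ]
    rfl
  have hcast : ∀ n, (Nat.card (Res ϖ n)ˣ : ℂ) = (unitCount (Nat.card 𝓀[F]) n : ℝ) := by
    intro n
    rw [← card_units_res_eq hϖ h2]
    norm_cast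
  rw [gaussCorr, gaussNorm, gaussSum, h0, corrOf]
  split_ifs with hn0
  · subst hn0
    have h3 : (twists ϖ 0).ncard = 1 := by
      rw [twists_zero hϖ, ncard_range_twistOf, card_units_res_zero]
    have h4 : ∑ᶠ χ ∈ twists ϖ 0, gaussInt ψ μ θ χ * conj (gaussInt ψ μ' θ' χ) = K * T 0 := by
      rw [twists_zero hϖ, finsum_mem_range (twistOf_injective hϖ 0), hS 0 (Nat.zero_le _),
        card_units_res_zero, Nat.cast_one, one_mul]
    rw [h3, h4, Nat.cast_one, one_mul]
    exact ⟨mul_ne_zero hK hT, div_self (mul_ne_zero hK hT)⟩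
  · have hn1 : 1 ≤ n := by omega
    have hpos := unitCount_sub_pos hq hn1
    have h3 : ((twists ϖ n).ncard : ℂ)
        = (unitCount (Nat.card 𝓀[F]) n - unitCount (Nat.card 𝓀[F]) (n - 1) : ℝ) := by
      rw [Complex.ofReal_sub, ← hcast, ← hcast, eq_sub_iff_add_eq]
      exact_mod_cast ncard_twists hϖ hn1
    have hne : ((unitCount (Nat.card 𝓀[F]) n - unitCount (Nat.card 𝓀[F]) (n - 1) : ℝ) : ℂ) ≠ 0 := by
      exact_mod_cast hpos.ne'
    rw [h3, finsum_mem_twists hϖ hn1, hS n hn, hS (n - 1) (by omega), hcast, hcast]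
    refine ⟨mul_ne_zero hne (mul_ne_zero hK hT), ?_⟩
    field_simp

section Values

variable {q : ℝ} (hq : 3 ≤ q) {T : ℕ → ℂ} {n : ℕ}

lemma corrOf_zero : corrOf q T 0 = 1 := if_pos rfl

lemma corrOf_eq_zero (hn : 1 ≤ n) (h : T n = 0) (h' : T (n - 1) = 0) :
    corrOf q T n = 0 := by
  rw [corrOf, if_neg (by omega), h, h', mul_zero, mul_zero, sub_zero, zero_div]

include hq

lemma corrOf_eq_one (hT : T 0 ≠ 0) (h : T n = T 0) (h' : T (n - 1) = T 0) :
    corrOf q T n = 1 := by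
  rcases Nat.eq_zero_or_pos n with rfl | hn
  · exact corrOf_zero
  · rw [corrOf, if_neg hn.ne', h, h', ← sub_mul, ← Complex.ofReal_sub]
    have := unitCount_sub_pos hq hn
    exact div_self (mul_ne_zero (by exact_mod_cast this.ne') hT)

/-- The effect of the first twists that destroy the correlation. -/
lemma corrOf_eq_neg_inv (hT : T 0 ≠ 0) (hn : 2 ≤ n) (h : T n = 0) (h' : T (n - 1) = T 0) :
    corrOf q T n = -1 / (q - 1) := by
  have h1 := (unitCount_pos hq (n - 1)).ne'
  have h2 : q - 1 ≠ 0 := by linarith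
  rw [corrOf, if_neg (by omega), h, h', unitCount_succ q hn]
  have h1' : ((unitCount q (n - 1) : ℝ) : ℂ) ≠ 0 := by exact_mod_cast h1
  have h2' : (q : ℂ) - 1 ≠ 0 := by exact_mod_cast h2
  push_cast
  rw [show (q : ℂ) * (unitCount q (n - 1) : ℝ) - (unitCount q (n - 1) : ℝ)
    = (q - 1) * (unitCount q (n - 1) : ℝ) by ring]
  field_simp
  ring

lemma corrOf_one_eq_neg_inv (hT : T 0 ≠ 0) (h : T 1 = 0) :
    corrOf q T 1 = -1 / (q - 2) := by
  have h2 : q - 2 ≠ 0 := by linarith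
  have h2' : (q : ℂ) - 2 ≠ 0 := by exact_mod_cast h2
  rw [corrOf, if_neg (by omega), h, unitCount_one, Nat.sub_self, unitCount_zero]
  push_cast
  rw [show (q : ℂ) - 1 - 1 = q - 2 by ring]
  field_simp
  ring

/-- A bound for the normalized correlation if `T (n - 1) = T 0` and `q |T n| ≤ |T 0|`. -/
lemma norm_corrOf_le (hT : T 0 ≠ 0) (hn : 2 ≤ n) (h : q * ‖T n‖ ≤ ‖T 0‖) (h' : T (n - 1) = T 0) :
    ‖corrOf q T n‖ ≤ 2 / (q - 1) := by
  have h1 := unitCount_pos hq (n - 1)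
  have hT' : 0 < ‖T 0‖ := norm_pos_iff.mpr hT
  have hd := unitCount_sub_pos hq (by omega : 1 ≤ n)
  rw [corrOf, if_neg (by omega), h', norm_div, norm_mul, Complex.norm_real, Real.norm_of_nonneg hd.le]
  have h3 : ‖(unitCount q n : ℂ) * T n - (unitCount q (n - 1) : ℝ) * T 0‖
      ≤ 2 * unitCount q (n - 1) * ‖T 0‖ := by
    refine (norm_sub_le _ _).trans ?_
    rw [norm_mul, norm_mul, Complex.norm_real, Complex.norm_real, Real.norm_of_nonneg h1.le,
      Real.norm_of_nonneg (unitCount_pos hq n).le, unitCount_succ q hn]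
    nlinarith [mul_le_mul_of_nonneg_left h h1.le]
  rw [div_le_div_iff₀ (mul_pos hd hT') (by linarith)]
  refine (mul_le_mul_of_nonneg_right h3 (by linarith)).trans (le_of_eq ?_)
  rw [unitCount_succ q hn]
  ring

/-- The denominator is `(q - 2) T 0`, and `2 / (q - 2) ≤ 6 / q` as `q ≥ 3`. -/
lemma norm_corrOf_one_le (hT : T 0 ≠ 0) (h : q * ‖T 1‖ ≤ ‖T 0‖) :
    ‖corrOf q T 1‖ ≤ 6 / q := by
  have hT' : 0 < ‖T 0‖ := norm_pos_iff.mpr hT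
  have hd := unitCount_sub_pos hq le_rfl
  rw [corrOf, if_neg (by omega), norm_div, norm_mul, Complex.norm_real, Real.norm_of_nonneg hd.le]
  have h3 : ‖(unitCount q 1 : ℂ) * T 1 - (unitCount q (1 - 1) : ℝ) * T (1 - 1)‖
      ≤ 2 * ‖T 0‖ := by
    refine (norm_sub_le _ _).trans ?_
    rw [norm_mul, norm_mul, Complex.norm_real, Complex.norm_real, Nat.sub_self, unitCount_one,
      unitCount_zero, Real.norm_of_nonneg (by linarith), NormOneClass.norm_one, one_mul]
    nlinarith [norm_nonneg (T 1)]
  rw [div_le_div_iff₀ (mul_pos hd hT') (by linarith)]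
  refine (mul_le_mul_of_nonneg_right h3 (by linarith)).trans ?_
  rw [Nat.sub_self, unitCount_one, unitCount_zero]
  nlinarith

/-- The value in the split case at the edge, where `q T n = (q - 2) T 0`. -/
lemma corrOf_eq_of_split (hT : T 0 ≠ 0) (hn : 2 ≤ n) (h : q * T n = (q - 2) * T 0)
    (h' : T (n - 1) = T 0) : corrOf q T n = (q - 3) / (q - 1) := by
  have h1 := (unitCount_pos hq (n - 1)).ne'
  have h2 : q - 1 ≠ 0 := by linarith
  rw [corrOf, if_neg (by omega), h', unitCount_succ q hn]
  have h1' : ((unitCount q (n - 1) : ℝ) : ℂ) ≠ 0 := by exact_mod_cast h1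
  have h2' : (q : ℂ) - 1 ≠ 0 := by exact_mod_cast h2
  push_cast
  rw [show (q : ℂ) * (unitCount q (n - 1) : ℝ) - (unitCount q (n - 1) : ℝ)
    = (q - 1) * (unitCount q (n - 1) : ℝ) by ring, div_eq_div_iff (by positivity) h2']
  linear_combination (unitCount q (n - 1) : ℝ) * (q - 1) * h

lemma corrOf_one_eq_of_split (hT : T 0 ≠ 0) (h : q * T 1 = (q - 2) * T 0) :
    corrOf q T 1 = (q - 3) / (q - 1) - 2 / (q * (q - 1) * (q - 2)) := by
  have h0 : (q : ℂ) ≠ 0 := by exact_mod_cast (by linarith : q ≠ 0)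
  have h1 : (q : ℂ) - 1 ≠ 0 := by exact_mod_cast (by linarith : q - 1 ≠ 0)
  have h2 : (q : ℂ) - 2 ≠ 0 := by exact_mod_cast (by linarith : q - 2 ≠ 0)
  have h3 : T 1 = (q - 2) * T 0 / q := by
    rw [eq_div_iff h0, mul_comm, h]
  rw [corrOf, if_neg (by omega), unitCount_one, Nat.sub_self, unitCount_zero, h3]
  push_cast
  rw [show (q : ℂ) - 1 - 1 = q - 2 by ring]
  field_simp
  ring

end Values

/-! ### The table of values -/

/-- The values of a normalized correlation `P` in terms of `c = c(π₁) = c(π₂)`, the index `i` and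
`R = c(π₁ × π₂)`; the propositions `A` and `B` say that `π₁` and `π₂` are supercuspidal.
The constant in the last bound is the one of `norm_corrOf_one_le`. -/
def ExpectedValues (q : ℝ) (c i R : ℕ) (A B : Prop) (P : ℂ) : Prop :=
  (2 < c →
    (R ≤ 2 * i → ¬ (2 * i = c ∧ ¬ A ∧ ¬ B) → P = 1) ∧
    (2 * i = R → 2 * i = c → ¬ A → ¬ B → P = (q - 3) / (q - 1)) ∧
    (2 * i + 2 = R → c < 2 * i → i + 1 < c → P = -1 / (q - 1)) ∧
    (2 * i + 2 = R → c < 2 * i → i + 1 = c → P = -1 / (q - 2)) ∧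
    (2 * i + 2 = R → 2 * i = c → ‖P‖ ≤ 2 / (q - 1)) ∧
    (¬ (R ≤ 2 * i ∧ ¬ (2 * i = c ∧ ¬ A ∧ ¬ B)) →
      ¬ (2 * i = R ∧ 2 * i = c ∧ ¬ A ∧ ¬ B) →
      2 * i + 2 ≠ R → P = 0)) ∧
  (c = 2 →
    (R ≤ 2 * i → ¬ (2 * i = c ∧ ¬ A ∧ ¬ B) → P = 1) ∧
    (2 * i = R → 2 * i = c → ¬ A → ¬ B →
      P = (q - 3) / (q - 1) - 2 / (q * (q - 1) * (q - 2))) ∧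
    (R = 4 → i = 1 → ‖P‖ ≤ 6 / q))

/-- The table for two characters `θ, θ'` of the same algebra, where `θ θ'` has conductor `m` and
`θ⁻¹ θ'` has conductor `l`. -/
lemma expectedValues_of_same_algebra {q : ℝ} (hq : 3 ≤ q) {T : ℕ → ℂ} (hT : T 0 ≠ 0)
    {m l e n : ℕ} {A B : Prop} (he : e = 1 ∨ e = 2) (hm : 1 ≤ m) (hl : l ≤ m) (hn : n ≤ m)
    (h0 : ∀ n, n + l ≤ m → 1 ≤ l ∨ e = 2 ∨ n + 1 ≤ m → T n = T 0)
    (h1 : ∀ n, n ≤ m → 1 ≤ l → 2 ≤ l ∨ e = 2 → m + 1 ≤ l + n → T n = 0)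
    (h2 : l = 0 → e = 1 → A ∨ B → T m = T 0)
    (h3 : l = 0 → e = 1 → ¬ A → ¬ B → q * T m = (q - 2) * T 0)
    (h4 : l = 1 → e = 1 → q * ‖T m‖ ≤ ‖T 0‖) :
    ExpectedValues q (2 * m + e - 1) (2 * m + e - 1 - n) (2 * (m + l + e - 1)) A B
      (corrOf q T n) := by
  have hone : 2 * (m + l + e - 1) ≤ 2 * (2 * m + e - 1 - n) →
      ¬ (2 * (2 * m + e - 1 - n) = 2 * m + e - 1 ∧ ¬ A ∧ ¬ B) → corrOf q T n = 1 := by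
    intro hR hAB
    have hle : n + l ≤ m := by omega
    rcases Nat.eq_zero_or_pos n with rfl | hn0
    · exact corrOf_zero
    refine corrOf_eq_one hq hT ?_ (h0 _ (by omega) (by omega))
    by_cases hs : 1 ≤ l ∨ e = 2 ∨ n + 1 ≤ m
    · exact h0 n hle hs
    · push Not at hs
      obtain rfl : n = m := by omega
      refine h2 (by omega) (by omega) ?_
      by_contra hc
      push Not at hc
      exact hAB ⟨by omega, hc⟩
  constructor
  · intro hc
    refine ⟨hone, ?_, ?_, ?_, ?_, ?_⟩
    · intro hR hi hA hB
      obtain rfl : n = m := by omega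
      exact corrOf_eq_of_split hq hT (by omega) (h3 (by omega) (by omega) hA hB)
        (h0 _ (by omega) (by omega))
    · intro hR hi hi'
      exact corrOf_eq_neg_inv hq hT (by omega) (h1 n hn (by omega) (by omega) (by omega))
        (h0 _ (by omega) (by omega))
    · intro hR hi hi'
      obtain rfl : n = 1 := by omega
      exact corrOf_one_eq_neg_inv hq hT (h1 1 hn (by omega) (by omega) (by omega))
    · intro hR hi
      obtain rfl : n = m := by omega
      exact norm_corrOf_le hq hT (by omega) (h4 (by omega) (by omega))
        (h0 _ (by omega) (by omega))
    · intro hR1 hR2 hR3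
      have hle : ¬ n + l ≤ m := by
        intro hle
        refine hR1 ⟨by omega, fun h => hR2 ⟨by omega, h⟩⟩
      exact corrOf_eq_zero (by omega) (h1 n hn (by omega) (by omega) (by omega))
        (h1 (n - 1) (by omega) (by omega) (by omega) (by omega))
  · intro hc
    refine ⟨hone, ?_, ?_⟩
    · intro hR hi hA hB
      obtain rfl : m = 1 := by omega
      obtain rfl : n = 1 := by omega
      exact corrOf_one_eq_of_split hq hT (h3 (by omega) (by omega) hA hB)
    · intro hR hi
      obtain rfl : m = 1 := by omega
      obtain rfl : n = 1 := by omega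
      exact norm_corrOf_one_le hq hT (h4 (by omega) (by omega))

/-- The table for characters of two algebras that are not isomorphic. -/
lemma expectedValues_of_not_iso {q : ℝ} (hq : 3 ≤ q) {T : ℕ → ℂ} (hT : T 0 ≠ 0)
    {m e n : ℕ} (A B : Prop) (he : e = 1 ∨ e = 2) (hm : 1 ≤ m) (hn : n ≤ m)
    (h1 : ∀ n, n ≤ m → 1 ≤ n → 2 < 2 * m + e - 1 → T n = 0)
    (h2 : m = 1 → e = 1 → q * ‖T 1‖ ≤ ‖T 0‖) :
    ExpectedValues q (2 * m + e - 1) (2 * m + e - 1 - n) (2 * (2 * m + e - 1)) A B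
      (corrOf q T n) := by
  have hone : 2 * (2 * m + e - 1) ≤ 2 * (2 * m + e - 1 - n) → corrOf q T n = 1 := by
    intro hR
    obtain rfl : n = 0 := by omega
    exact corrOf_zero
  constructor
  · intro hc
    refine ⟨fun hR _ => hone hR, fun hR hi => by omega, fun hR hi hi' => by omega, ?_,
      fun hR hi => by omega, ?_⟩
    · intro hR hi hi'
      obtain rfl : n = 1 := by omega
      exact corrOf_one_eq_neg_inv hq hT (h1 1 hn le_rfl hc)
    · intro hR1 hR2 hR3
      rcases Nat.eq_zero_or_pos n with rfl | hn0
      · exact absurd ⟨by omega, fun h => by omega⟩ hR1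
      · exact corrOf_eq_zero hn0 (h1 n hn hn0 hc) (h1 _ (by omega) (by omega) hc)
  · intro hc
    refine ⟨fun hR _ => hone hR, fun hR hi => by omega, ?_⟩
    intro hR hi
    obtain rfl : m = 1 := by omega
    obtain rfl : n = 1 := by omega
    exact norm_corrOf_one_le hq hT (h2 rfl (by omega))

/-! ### Correlations over the residue ring -/

section Residue

open scoped Classical
open QuadraticAlgebra

variable {R : Type*} [CommRing R] {D D' ϖ : R} {m e : ℕ}

lemma trChar_isPrimitive (hR : IsOddChainRing ϖ m) (hD : e = 1 → IsUnit D) {Ψ : AddChar R ℂ}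
    (hΨ : ∃ t, Ψ (ϖ ^ (m - 1) * t) ≠ 1) : (trChar e D Ψ).IsPrimitive := by
  rw [trChar]
  split_ifs with he
  · exact reChar_isPrimitive hR (hD he) hΨ
  · exact imChar_isPrimitive hR hΨ

/-- The square of a character of conductor `m` has conductor `m`, except possibly if `m = 1` in the
unramified case. -/
lemma not_trivOn_mul_self (hR : IsOddChainRing ϖ m) (hD : ϖ ∣ D * ϖ ^ (m - 1))
    {θ : (Quad D)ˣ →* ℂˣ} (hθ : TrivOn ϖ θ m) (hθ' : ¬ TrivOn ϖ θ (m - 1)) :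
    ¬ TrivOn ϖ (θ * θ) (m - 1) := by
  obtain ⟨t, u, hu, hne⟩ := exists_char_pow_pred_ne_one hR hD hθ hθ'
  obtain ⟨c, hc⟩ := hR.exists_half
  intro h
  obtain ⟨v, hv⟩ := exists_unit_pow_pred hR hD (c * t)
  have h1 : θ (v * v) = 1 := by
    rw [map_mul]
    exact h v (by rw [hv]; exact dvd_mul_right _ _)
  refine hne ?_
  rw [← h1]
  have h2 := mul_pow_pred_sq hR hD
  apply char_congr hθ (a := 1)
  rw [hu, Units.val_mul, hv]
  ext
  · simp only [re_mul, Quad.coe_re, Quad.coe_im]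
    linear_combination -(c * t * (c * t)) * h2
  · simp only [im_mul, Quad.coe_re, Quad.coe_im]
    linear_combination -(ϖ ^ (m - 1) * t) * hc

variable [Fintype R]

/-- The correlation for `n = 0` is a product of two Gauss sums of absolute value `|R|`. -/
lemma norm_pairSum_zero (hR : IsOddChainRing ϖ m) {r : R} {Φ : AddChar (Quad D) ℂ}
    (hΦ : Φ.IsPrimitive) {Φ' : AddChar (Quad D') ℂ} (hΦ' : Φ'.IsPrimitive)
    {θ : (Quad D)ˣ →* ℂˣ} (hθ : TrivOn ϖ θ m) (hθ1 : ¬ TrivOn ϖ θ (m - 1))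
    {θ' : (Quad D')ˣ →* ℂˣ} (hθ' : TrivOn ϖ θ' m) (hθ'1 : ¬ TrivOn ϖ θ' (m - 1)) :
    ‖pairSum ϖ r Φ Φ' θ θ' 0‖ = Fintype.card R ^ 2 := by
  have key : ∀ {D : R} {Φ : AddChar (Quad D) ℂ}, Φ.IsPrimitive → ∀ {θ : (Quad D)ˣ →* ℂˣ},
      TrivOn ϖ θ m → ¬ TrivOn ϖ θ (m - 1) → ‖unitGauss θ⁻¹ Φ 1‖ = Fintype.card R := by
    intro D Φ hΦ θ hθ hθ1
    have := norm_unitGauss_coe hR hΦ hR.pos le_rfl hθ.inv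
      (fun h => hθ1 (inv_inv θ ▸ h.inv))
    simpa using this
  rw [pairSum_zero, norm_mul, key hΦ hθ hθ1, RCLike.norm_conj, key hΦ' hθ' hθ'1, sq]

lemma pairSum_self_zero (hR : IsOddChainRing ϖ m) {Φ : AddChar (Quad D) ℂ}
    (hΦ : Φ.IsPrimitive) {θ : (Quad D)ˣ →* ℂˣ} (hθ : TrivOn ϖ θ m)
    (hθ1 : ¬ TrivOn ϖ θ (m - 1)) (r : R) :
    pairSum ϖ r Φ Φ θ θ 0 = Fintype.card R ^ 2 := by
  have h := norm_pairSum_zero (r := r) hR hΦ hΦ hθ hθ1 hθ hθ1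
  rw [pairSum_zero, Complex.mul_conj, Complex.norm_real,
    Real.norm_of_nonneg (Complex.normSq_nonneg _)] at h
  rw [pairSum_zero, Complex.mul_conj, h]
  push_cast
  rfl

/-- The table over the residue ring, for one algebra, if `θ θ'` has the maximal conductor `m`. -/
lemma expectedValues_pairSum_of_isLeast (hR : IsOddChainRing ϖ m) {q : ℝ} (hq : 3 ≤ q)
    (hcard : (Fintype.card R : ℝ) = q ^ m)
    (hann : (Fintype.card {a : R // ϖ ^ (m - 1) * a = 0} : ℝ) = q ^ (m - 1))
    (hD : (e = 1 ∧ IsUnit D) ∨ (e = 2 ∧ ϖ ∣ D)) {Ψ : AddChar R ℂ}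
    (hΨ : ∃ t, Ψ (ϖ ^ (m - 1) * t) ≠ 1) {θ θ' : (Quad D)ˣ →* ℂˣ}
    (hθ : TrivOn ϖ θ m) (hθ1 : ¬ TrivOn ϖ θ (m - 1))
    (hθ' : TrivOn ϖ θ' m) (hθ'1 : ¬ TrivOn ϖ θ' (m - 1)) {l : ℕ} (hl : l ≤ m)
    (hη : TrivOn ϖ (θ⁻¹ * θ') l) (hη' : 1 ≤ l → ¬ TrivOn ϖ (θ⁻¹ * θ') (l - 1))
    (hθθ' : ¬ TrivOn ϖ (θ * θ') (m - 1)) {A B : Prop}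
    (hinert : A ∨ B → e = 1 → ∀ s : R, ¬ ϖ ∣ s * s - D)
    (hsplit : ¬ A → ¬ B → e = 1 → ∃ s : R, IsUnit s ∧ D = s * s) {n : ℕ} (hn : n ≤ m) :
    ExpectedValues q (2 * m + e - 1) (2 * m + e - 1 - n) (2 * (m + l + e - 1)) A B
      (corrOf q (pairSum ϖ 1 (trChar e D Ψ) (trChar e D Ψ) θ θ') n) := by
  have hm := hR.pos
  have hΦ : (trChar e D Ψ).IsPrimitive := trChar_isPrimitive hR
    (fun he => by rcases hD with hD | hD; exacts [hD.2, by omega]) hΨ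
  have hT0 := norm_pairSum_zero (r := 1) hR hΦ hΦ hθ hθ1 hθ' hθ'1
  rw [hcard] at hT0
  have hself : l = 0 → θ' = θ := by
    rintro rfl
    ext1 x
    have := hη x (by simp)
    rw [MonoidHom.mul_apply, MonoidHom.inv_apply, inv_mul_eq_one] at this
    exact this.symm
  have hlast : e = 1 → l = 0 → pairSum ϖ 1 (trChar e D Ψ) (trChar e D Ψ) θ θ' m
      = Fintype.card (Quad D)ˣ - unitGauss 1 (reChar D Ψ) (Quad.coe D (ϖ ^ (m - 1))) := by
    intro he hl0
    obtain rfl := hself hl0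
    obtain ⟨-, hD⟩ | ⟨he2, -⟩ := hD
    · rw [pairSum_self_last hR hD hΦ hθ hθθ', trChar, if_pos he]
    · omega
  have hzero : l = 0 → pairSum ϖ 1 (trChar e D Ψ) (trChar e D Ψ) θ θ' 0 = Fintype.card R ^ 2 := by
    intro hl0
    obtain rfl := hself hl0
    exact pairSum_self_zero hR hΦ hθ hθ1 1
  refine expectedValues_of_same_algebra hq ?_ (hD.imp And.left And.left) hm hl hn ?_ ?_ ?_ ?_ ?_
  · rw [← norm_ne_zero_iff, hT0]
    positivity
  · intro n hnl h
    rcases Nat.eq_zero_or_pos l with hl0 | hl0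
    · obtain rfl := hself hl0
      by_cases hnm : n + 1 ≤ m
      · exact pairSum_self_eq_pairSum_zero hR hΦ hnm
      · rcases hD with hD | hD
        · omega
        · exact pairSum_self_eq_pairSum_zero_of_dvd hR hD.2 hΦ
    · exact pairSum_eq_pairSum_zero_of_add_le hR hΦ hl0 hη (hη' hl0) (by omega)
  · intro n hnm hl1 hl2 hln
    refine pairSum_eq_zero hR hl1 hl ?_ hΦ hθ hθ' hη (hη' hl1) hθθ' hln
    rcases hD with hD | hD
    · exact (dvd_pow_self ϖ (by omega)).mul_left _
    · exact hD.2.mul_right _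
  · intro hl0 he hAB
    rw [hlast he hl0, hzero hl0, card_units_sub_unitGauss_inert hR (hinert hAB he) hΨ]
  · intro hl0 he hA hB
    obtain ⟨s, hs, hDs⟩ := hsplit hA hB he
    have hc := card_units_add_card hR
    have hc' : (Fintype.card Rˣ : ℝ) = q ^ m - q ^ (m - 1) := by
      rw [← hcard, ← hann, ← hc]
      push_cast
      ring
    have hc1 : (Fintype.card Rˣ : ℂ) = q ^ m - q ^ (m - 1) := by exact_mod_cast congr_arg (fun x : ℝ => (x : ℂ)) hc'
    have hc2 : (Fintype.card R : ℂ) = q ^ m := by exact_mod_cast congr_arg (fun x : ℝ => (x : ℂ)) hcard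
    have hc3 : (Fintype.card {a : R // ϖ ^ (m - 1) * a = 0} : ℂ) = q ^ (m - 1) := by
      exact_mod_cast congr_arg (fun x : ℝ => (x : ℂ)) hann
    rw [hlast he hl0, hzero hl0, card_units_sub_unitGauss_split hR hs hDs hΨ, hc1, hc2, hc3]
    have h : (q : ℂ) ^ m = q ^ (m - 1) * q := by rw [← pow_succ, Nat.sub_add_cancel hm]
    rw [h]
    ring
  · intro hl1 he
    subst hl1
    rw [hT0]
    rcases hD with hD | hD
    · rw [norm_pairSum_last hR hD.2 hΦ hθ hθ' hη (hη' le_rfl) hθθ',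
        norm_unitGauss_coe hR hΦ le_rfl hm hη (hη' le_rfl), hcard, hann]
      have h : q ^ m = q ^ (m - 1) * q := by rw [← pow_succ, Nat.sub_add_cancel hm]
      rw [h]
      exact le_of_eq (by ring)
    · omega

/-- The table over the residue ring, for one algebra. The value of `R` involves the conductors of
`θ⁻¹ θ'` and of `θ θ'`, one of which is `m`, and replacing `θ'` by `θ'⁻¹` does not change the
correlation. -/
lemma expectedValues_pairSum (hR : IsOddChainRing ϖ m) {q : ℝ} (hq : 3 ≤ q)
    (hcard : (Fintype.card R : ℝ) = q ^ m)
    (hann : (Fintype.card {a : R // ϖ ^ (m - 1) * a = 0} : ℝ) = q ^ (m - 1))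
    (hD : (e = 1 ∧ IsUnit D) ∨ (e = 2 ∧ ϖ ∣ D)) {Ψ : AddChar R ℂ}
    (hΨ : ∃ t, Ψ (ϖ ^ (m - 1) * t) ≠ 1) {θ θ' : (Quad D)ˣ →* ℂˣ}
    (hθ : IsLeast {j | TrivOn ϖ θ j} m) (hθ' : IsLeast {j | TrivOn ϖ θ' j} m) {l l' : ℕ}
    (hl : IsLeast {j | TrivOn ϖ (θ⁻¹ * θ') j} l) (hl' : IsLeast {j | TrivOn ϖ (θ * θ') j} l')
    {A B : Prop} (hinert : A ∨ B → e = 1 → ∀ s : R, ¬ ϖ ∣ s * s - D)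
    (hsplit : ¬ A → ¬ B → e = 1 → ∃ s : R, IsUnit s ∧ D = s * s)
    (hsq : A ∨ B → ¬ TrivOn ϖ (θ * θ) (m - 1)) {n : ℕ} (hn : n ≤ m) :
    ExpectedValues q (2 * m + e - 1) (2 * m + e - 1 - n) (2 * (l' + l + e - 1)) A B
      (corrOf q (pairSum ϖ 1 (trChar e D Ψ) (trChar e D Ψ) θ θ') n) := by
  have hm := hR.pos
  have hlm : l ≤ m := hl.2 (hθ.1.inv.mul hθ'.1)
  have hlm' : l' ≤ m := hl'.2 (hθ.1.mul hθ'.1)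
  have hnot : ∀ {η : (Quad D)ˣ →* ℂˣ} {l : ℕ}, IsLeast {j | TrivOn ϖ η j} l → 1 ≤ l →
      ¬ TrivOn ϖ η (l - 1) := fun h hl h1 => by have := h.2 h1; omega
  by_cases h1 : l' = m
  · subst h1
    exact expectedValues_pairSum_of_isLeast hR hq hcard hann hD hΨ hθ.1 (hnot hθ hm) hθ'.1
      (hnot hθ' hm) hlm hl.1 (hnot hl) (hnot hl' hm) hinert hsplit hn
  by_cases h2 : l = m
  · subst h2
    -- The additive character depends on `re y`, with `ε = 1`, or on `im y`, with `ε = -1`.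
    have hε : ∃ ε : (Quad D)ˣ, (ε : Quad D).im = 0 ∧ norm (ε : Quad D) = 1 ∧
        ∀ y, trChar e D Ψ (ε * star y) = trChar e D Ψ y := by
      rcases hD with ⟨he, -⟩ | ⟨he, -⟩
      · refine ⟨1, by simp, by simp, fun y => ?_⟩
        rw [trChar, if_pos he]
        simp
      · refine ⟨-1, by simp, by simp, fun y => ?_⟩
        rw [trChar, if_neg (by omega)]
        simp
    obtain ⟨ε, hε, hεn, hΦ⟩ := hε
    have h3 : pairSum ϖ 1 (trChar e D Ψ) (trChar e D Ψ) θ θ'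
        = pairSum ϖ 1 (trChar e D Ψ) (trChar e D Ψ) θ θ'⁻¹ :=
      funext fun n => (pairSum_inv_right hε hεn 1 _ hΦ θ hθ'.1 n).symm
    have hinv : ∀ {η : (Quad D)ˣ →* ℂˣ} {j : ℕ}, ¬ TrivOn ϖ η j → ¬ TrivOn ϖ η⁻¹ j :=
      fun {η} _ h h' => h (inv_inv η ▸ h'.inv)
    have e1 : θ⁻¹ * θ'⁻¹ = (θ * θ')⁻¹ := MonoidHom.ext fun x => by simp [mul_comm]
    have e2 : θ * θ'⁻¹ = (θ⁻¹ * θ')⁻¹ := MonoidHom.ext fun x => by simp [mul_comm]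
    rw [h3, add_comm l']
    exact expectedValues_pairSum_of_isLeast hR hq hcard hann hD hΨ hθ.1 (hnot hθ hm) hθ'.1.inv
      (hinv (hnot hθ' hm)) hlm' (e1 ▸ hl'.1.inv) (fun h => e1 ▸ hinv (hnot hl' h))
      (e2 ▸ hinv (hnot hl hm)) hinert hsplit hn
  -- Now `θ²` has conductor less than `m`. This forces `m = 1`, and the algebra is split.
  have h3 : TrivOn ϖ (θ * θ) (m - 1) := by
    have h4 : θ * θ = (θ * θ') * (θ⁻¹ * θ')⁻¹ := by
      ext1 x
      simp only [MonoidHom.mul_apply, MonoidHom.inv_apply, mul_inv_rev, inv_inv]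
      rw [mul_assoc, mul_inv_cancel_left]
    rw [h4]
    exact (hl'.1.mono (by omega)).mul (hl.1.mono (by omega)).inv
  have h4 : ¬ ϖ ∣ D * ϖ ^ (m - 1) := fun h => not_trivOn_mul_self hR h hθ.1 (hnot hθ hm) h3
  have hm1 : m = 1 := by
    by_contra h
    exact h4 ((dvd_pow_self ϖ (by omega)).mul_left _)
  have he : e = 1 := by
    rcases hD with hD | hD
    · exact hD.1
    · exact absurd (hD.2.mul_right _) h4
  have hn01 : n = 0 ∨ n = 1 := by omega
  have hAB : ¬ (A ∨ B) := fun h => hsq h h3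
  subst hm1 he
  obtain rfl : l = 0 := by omega
  obtain rfl : l' = 0 := by omega
  refine ⟨fun h => by omega, fun _ => ⟨fun _ h => ?_, fun h h' => by omega, fun h => by omega⟩⟩
  rcases hn01 with rfl | rfl
  · exact corrOf_zero
  · exact absurd ⟨rfl, not_or.mp hAB⟩ h

/-- The table over the residue ring, for two algebras that are not isomorphic. -/
lemma expectedValues_pairSum_of_not_iso (hR : IsOddChainRing ϖ m) {q : ℝ} (hq : 3 ≤ q)
    (hcard : (Fintype.card R : ℝ) = q ^ m)
    {Ψ Ψ' : AddChar R ℂ} {r : R} (hΨ : ∃ t, Ψ (ϖ ^ (m - 1) * t) ≠ 1)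
    (hΨ' : ∃ t, Ψ' (ϖ ^ (m - 1) * t) ≠ 1)
    (hDD' : (e = 1 ∧ IsUnit D ∧ IsUnit D' ∧ Ψ' = Ψ ∧ r = 1 ∧
        ∀ a b, ϖ ∣ D * (a * a) - D' * (b * b) → ϖ ∣ a ∧ ϖ ∣ b) ∨
      (e = 2 ∧ ϖ ∣ D ∧ ϖ ∣ D' ∧ ∀ a b, IsUnit a → ¬ ϖ ∣ a * a - r * (b * b)))
    {θ : (Quad D)ˣ →* ℂˣ} {θ' : (Quad D')ˣ →* ℂˣ}
    (hθ : IsLeast {j | TrivOn ϖ θ j} m) (hθ' : IsLeast {j | TrivOn ϖ θ' j} m)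
    {A B : Prop}
    (hsq : ¬ TrivOn ϖ (θ * θ) (m - 1) ∨ ¬ TrivOn ϖ (θ' * θ') (m - 1)) {n : ℕ} (hn : n ≤ m) :
    ExpectedValues q (2 * m + e - 1) (2 * m + e - 1 - n) (2 * (2 * m + e - 1)) A B
      (corrOf q (pairSum ϖ r (trChar e D Ψ) (trChar e D' Ψ') θ θ') n) := by
  have hm := hR.pos
  have hnot : ∀ {D : R} {η : (Quad D)ˣ →* ℂˣ}, IsLeast {j | TrivOn ϖ η j} m →
      ¬ TrivOn ϖ η (m - 1) := fun h h1 => by have := h.2 h1; omega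
  have hT0 := norm_pairSum_zero (r := r) hR
    (trChar_isPrimitive hR (e := e) (D := D) (fun he => by
      rcases hDD' with h | h; exacts [h.2.1, by omega]) hΨ)
    (trChar_isPrimitive hR (e := e) (D := D') (fun he => by
      rcases hDD' with h | h; exacts [h.2.2.1, by omega]) hΨ') hθ.1 (hnot hθ) hθ'.1 (hnot hθ')
  rw [hcard] at hT0
  refine expectedValues_of_not_iso hq ?_ A B (hDD'.imp And.left And.left) hm hn ?_ ?_
  · rw [← norm_ne_zero_iff, hT0]
    positivity
  · intro n hnm hn1 hc
    rcases hDD' with ⟨rfl, hD, hD', rfl, rfl, h⟩ | ⟨rfl, hD, hD', h⟩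
    · rw [trChar, if_pos rfl, trChar, if_pos rfl]
      exact pairSum_eq_zero_of_not_square hR (by omega)
        (fun a b ha _ hab => hR.isUnit_iff.mp ha (h a b hab).1) hΨ hθ.1 (hnot hθ) hθ'.1 (hnot hθ') hn1
    · exact pairSum_eq_zero_of_dvd hR hD hD' h _ _ _ _ hn1
  · intro hm1 he
    subst hm1 he
    rcases hDD' with ⟨-, hD, hD', rfl, rfl, h⟩ | ⟨h, -⟩
    · have h0 : ϖ = 0 := by simpa using hR.pow_eq_zero
      rw [hT0, trChar, if_pos rfl, trChar, if_pos rfl, pairSum_one_of_not_square hR (fun a b hab => ?_)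
        hΨ hθ.1 hθ'.1 hsq, Complex.norm_natCast, hcard]
      · exact le_of_eq (by ring)
      · have := h a b (by rw [hab, sub_self]; exact dvd_zero _)
        rwa [h0, zero_dvd_iff, zero_dvd_iff] at this
    · omega

end Residue

/-! ### From the local field to the residue ring -/

section Transfer

open QuadraticAlgebra

variable {F : Type*} [Field F] [ValuativeRel F] [TopologicalSpace F] [IsNonarchimedeanLocalField F]
variable {E : Type*} [CommRing E] [Algebra F E] {ϖ D D' : 𝒪[F]} {e : ℕ}

lemma isLeast_cond_of_trivOn {θ : (Quad D)ˣ →* ℂˣ} {j : ℕ} (h : TrivOn ϖ θ j) :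
    IsLeast {j | TrivOn ϖ θ j} (cond ϖ θ) :=
  ⟨Nat.sInf_mem ⟨j, h⟩, fun _ hj => Nat.sInf_le hj⟩

lemma isLeast_cond_of_continuous [TopologicalSpace E] [IsModuleTopology F E] (hϖ : Irreducible ϖ)
    (f : Quad (algebraMap 𝒪[F] F D) ≃ₐ[F] E) {θ : Eˣ →* ℂˣ} (hθ : Continuous θ)
    (hF : ∀ a : Fˣ, θ (Units.map (algebraMap F E).toMonoidHom a) = 1) :
    IsLeast {j | TrivOn ϖ (restr f θ) j} (cond ϖ (restr f θ)) := by
  have := isTopologicalRing_of_algEquiv f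
  have := t2Space_of_algEquiv f
  obtain ⟨n, hn⟩ := (isIntegralModel_intEmb hϖ f).exists_forall_eq_one hθ
  exact isLeast_cond_of_trivOn (trivOn_of_forall hϖ (restr_coeUnit f hF) (m := n + 1) (by omega)
    fun w hw => hn w ((pow_dvd_pow _ (Nat.le_succ n)).trans hw))

lemma isLeast_redUnits (hϖ : Irreducible ϖ) {m l : ℕ} (hm : 1 ≤ m) {θ : (Quad D)ˣ →* ℂˣ}
    {θr : (Quad (toRes ϖ m D))ˣ →* ℂˣ} (h : ∀ w, θr (redUnits ϖ D m w) = θ w)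
    (hl : IsLeast {j | TrivOn ϖ θ j} l) (hlm : l ≤ m) :
    IsLeast {j | TrivOn (toRes ϖ m ϖ) θr j} l := by
  refine ⟨(trivOn_redUnits_iff hϖ hm h hlm).mpr hl.1, fun j hj => ?_⟩
  by_contra! hlt
  have := hl.2 ((trivOn_redUnits_iff hϖ hm h (by omega)).mp hj)
  omega

/-- In the unramified case, if the quadratic algebra `E` is a field then `E^× = F^× O_E^×`. -/
lemma exists_eq_base_mul_of_isField (h2 : IsUnit (2 : 𝒪[F])) (hϖ : Irreducible ϖ)
    (f : Quad (algebraMap 𝒪[F] F D) ≃ₐ[F] E) (hD : IsUnit D) (hE : IsField E) (u : Eˣ) :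
    ∃ (a : Fˣ) (w : (Quad D)ˣ), u = Units.map (algebraMap F E).toMonoidHom a
      * Units.map (intEmb f).toMonoidHom w := by
  -- It suffices to write the element as a scalar times an integral element of unit norm.
  have key : ∀ (a : F) (x : Quad D), IsUnit (norm x) →
      f.symm u = a • Quad.map (algebraMap 𝒪[F] F) D x → ∃ (a : Fˣ) (w : (Quad D)ˣ),
        u = Units.map (algebraMap F E).toMonoidHom a * Units.map (intEmb f).toMonoidHom w := by
    intro a x hx h
    have ha : a ≠ 0 := by
      rintro rfl
      rw [zero_smul, EmbeddingLike.map_eq_zero_iff] at h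
      have := hE.nontrivial
      exact u.ne_zero h
    refine ⟨Units.mk0 a ha, (isUnit_iff_norm_isUnit.mpr hx).unit, Units.ext ?_⟩
    have h1 := congr_arg f h
    rw [AlgEquiv.apply_symm_apply, map_smul, Algebra.smul_def] at h1
    exact h1
  have hns := not_dvd_of_isField h2 hϖ f hD hE
  by_cases hb : (f.symm u).im = 0
  · refine key (f.symm u).re 1 (by simp) ?_
    ext <;> simp [hb]
  rcases ValuationRing.isInteger_or_isInteger 𝒪[F] ((f.symm u).re / (f.symm u).im) with
    ⟨t, ht⟩ | ⟨t, ht⟩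
  · refine key (f.symm u).im ⟨t, 1⟩ ?_ ?_
    · rw [quad_norm, isUnit_iff_not_dvd hϖ]
      simpa using hns t
    · ext
      · simp only [re_smul, Quad.map_re, ht, smul_eq_mul]
        field_simp
      · simp
  · by_cases ha : (f.symm u).re = 0
    · refine key (f.symm u).im ⟨0, 1⟩ ?_ ?_
      · rw [quad_norm]
        simpa using hD
      · ext <;> simp [ha]
    refine key (f.symm u).re ⟨1, t⟩ ?_ ?_
    · rw [quad_norm, isUnit_iff_not_dvd hϖ]
      intro h
      have htu : IsUnit t := by
        rw [isUnit_iff_not_dvd hϖ]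
        intro h3
        have h4 := dvd_add h (h3.mul_left (D * t))
        refine hϖ.not_isUnit (isUnit_of_dvd_one ?_)
        simpa using h4
      obtain ⟨s, hs⟩ := htu.exists_right_inv
      refine hns s ((h.mul_left (s * s)).trans (dvd_of_eq ?_))
      simp only [mul_one]
      linear_combination (-D * (s * t) - D) * hs
    · ext
      · simp
      · simp only [im_smul, Quad.map_im, ht, smul_eq_mul]
        field_simp

/-- If `E` is an unramified field extension and `θ` is not equal to its conjugate `θ⁻¹`, the square
of `θ` is nontrivial on `O_E^×`. -/
lemma not_trivOn_mul_self_of_isField (h2 : IsUnit (2 : 𝒪[F])) (hϖ : Irreducible ϖ)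
    (f : Quad (algebraMap 𝒪[F] F D) ≃ₐ[F] E) (hD : IsUnit D) (hE : IsField E) {θ : Eˣ →* ℂˣ}
    (hF : ∀ a : Fˣ, θ (Units.map (algebraMap F E).toMonoidHom a) = 1) (hθ : θ ≠ θ⁻¹) :
    ¬ TrivOn ϖ (restr f θ * restr f θ) 0 := by
  intro h
  refine hθ (MonoidHom.ext fun u => ?_)
  obtain ⟨a, w, rfl⟩ := exists_eq_base_mul_of_isField h2 hϖ f hD hE u
  have h1 := h w (by simp)
  rw [MonoidHom.inv_apply, map_mul, hF, one_mul, eq_inv_iff_mul_eq_one]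
  exact h1

lemma nonempty_algEquiv_of_eq_mul_sq {E' : Type*} [CommRing E'] [Algebra F E']
    (f : Quad (algebraMap 𝒪[F] F D) ≃ₐ[F] E) (f' : Quad (algebraMap 𝒪[F] F D') ≃ₐ[F] E')
    {s : 𝒪[F]} (hs : s ≠ 0) (h : D = s * s * D') : Nonempty (E ≃ₐ[F] E') := by
  obtain ⟨g⟩ := nonempty_algEquiv_mul_sq (d := algebraMap 𝒪[F] F D') (algebraMap_ne_zero hs)
  have h1 : algebraMap 𝒪[F] F D
      = algebraMap 𝒪[F] F s * algebraMap 𝒪[F] F s * algebraMap 𝒪[F] F D' := by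
    rw [h, map_mul, map_mul]
  rw [← h1] at g
  exact ⟨(f.symm.trans g).trans f'⟩

/-- In the unramified case `D / D'` is not a square modulo `ϖ` if the algebras are not isomorphic. -/
lemma dvd_and_dvd_of_not_iso {E' : Type*} [CommRing E'] [Algebra F E'] (h2 : IsUnit (2 : 𝒪[F]))
    (hϖ : Irreducible ϖ) (f : Quad (algebraMap 𝒪[F] F D) ≃ₐ[F] E)
    (f' : Quad (algebraMap 𝒪[F] F D') ≃ₐ[F] E') (hD : IsUnit D) (hD' : IsUnit D')
    (hEE' : ¬ Nonempty (E ≃ₐ[F] E')) {a b : 𝒪[F]} (h : ϖ ∣ D * (a * a) - D' * (b * b)) :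
    ϖ ∣ a ∧ ϖ ∣ b := by
  have hp := hϖ.prime
  have hDn := (isUnit_iff_not_dvd hϖ).mp hD
  have hDn' := (isUnit_iff_not_dvd hϖ).mp hD'
  have hsq : ∀ {d x : 𝒪[F]}, ¬ ϖ ∣ d → ϖ ∣ d * (x * x) → ϖ ∣ x := fun hd hx =>
    ((hp.dvd_or_dvd hx).resolve_left hd |> hp.dvd_or_dvd).elim id id
  by_cases hb : ϖ ∣ b
  · exact ⟨hsq hDn ((dvd_iff_dvd_of_dvd_sub h).mpr ((hb.mul_right b).mul_left D')), hb⟩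
  obtain ⟨c, hc⟩ := ((isUnit_iff_not_dvd hϖ).mpr hb).exists_right_inv
  obtain ⟨t, ht, htt⟩ := exists_sq_eq_of_dvd h2 hϖ (hD.mul hD') (s := D * a * c)
    ((h.mul_left (D * c * c)).trans (dvd_of_eq (by
      linear_combination (-D * D' * (b * c) - D * D') * hc)))
  obtain ⟨d, hd⟩ := hD'.exists_right_inv
  refine absurd (nonempty_algEquiv_of_eq_mul_sq f f' (s := t * d) ?_ ?_) hEE'
  · exact (ht.mul (isUnit_iff_exists_inv'.mpr ⟨D', hd⟩)).ne_zero
  · linear_combination (-D) * hd - d * d * D' * htt - D * D' * d * hd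

end Transfer

/-! ### Values of the correlation for given presentations of the algebras -/

section Correlation

open QuadraticAlgebra

variable {F : Type*} [Field F] [ValuativeRel F] [TopologicalSpace F] [IsNonarchimedeanLocalField F]
variable {ϖ D D' : 𝒪[F]} {e : ℕ}

/-- The unit part of the norm of the generator is `1` in the unramified case, and `-D / ϖ` in the
ramified case. -/
lemma unitPart_normRadGen (hϖ : Irreducible ϖ) (hD : IsDisc ϖ D e) :
    (e = 1 → unitPart hϖ (normRadGen hϖ hD) = 1) ∧
    (e = 2 → D = -(ϖ * unitPart hϖ (normRadGen hϖ hD))) := by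
  constructor
  · intro he
    rw [normRadGen, if_pos he, map_pow, unitPart_unifUnit, one_pow]
  · intro he
    obtain ⟨h, -⟩ | ⟨-, u, hu, hDu⟩ := id hD
    · omega
    · have h : -Units.mk0 _ (algebraMap_ne_zero (IsDisc.ne_zero hϖ hD))
          = baseUnit F (-hu.unit) * unifUnit hϖ := by
        ext
        simp [hDu, mul_comm]
      rw [normRadGen, if_neg (by omega), h, map_mul, unitPart_baseUnit, unitPart_unifUnit, mul_one,
        hDu]
      simp

/-- In the ramified case the ratio of the units that occur in the norms of the generators is not a
square modulo `ϖ` if the algebras are not isomorphic. -/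
lemma not_dvd_of_not_iso_of_ramified {E : Type*} [CommRing E] [Algebra F E] {E' : Type*}
    [CommRing E'] [Algebra F E'] (h2 : IsUnit (2 : 𝒪[F]))
    (hϖ : Irreducible ϖ) (f : Quad (algebraMap 𝒪[F] F D) ≃ₐ[F] E)
    (f' : Quad (algebraMap 𝒪[F] F D') ≃ₐ[F] E') {u w : 𝒪[F]ˣ} (hD : D = -(ϖ * u))
    (hD' : D' = -(ϖ * (u * w))) (hEE' : ¬ Nonempty (E ≃ₐ[F] E')) (m : ℕ) {a b : 𝒪[F]}
    (ha : IsUnit a) : ¬ ϖ ∣ a * a - (w ^ (-((2 * m : ℕ) : ℤ) - (2 : ℕ) + 1) : 𝒪[F]ˣ) * (b * b) := by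
  intro h
  set r : 𝒪[F]ˣ := w ^ (-((2 * m : ℕ) : ℤ) - (2 : ℕ) + 1) with hr
  have hb : ¬ ϖ ∣ b := by
    intro hb
    refine (isUnit_iff_not_dvd hϖ).mp ha ?_
    have := (dvd_iff_dvd_of_dvd_sub h).mpr ((hb.mul_right b).mul_left _)
    exact (hϖ.prime.dvd_or_dvd this).elim id id
  obtain ⟨c, hc⟩ := ((isUnit_iff_not_dvd hϖ).mpr hb).exists_right_inv
  obtain ⟨t, ht, htt⟩ := exists_sq_eq_of_dvd h2 hϖ r.isUnit (s := a * c)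
    ((h.mul_left (c * c)).trans (dvd_of_eq (by
      linear_combination (-r * (b * c) - r : 𝒪[F]) * hc)))
  have hw : (w : 𝒪[F]) = r * (w ^ (m + 1) * w ^ (m + 1) : 𝒪[F]ˣ) := by
    rw [← Units.val_mul, hr]
    congr 1
    rw [← zpow_natCast, ← zpow_add, ← zpow_add]
    conv_lhs => rw [← zpow_one w]
    congr 1
    push_cast
    ring
  have hiso := nonempty_algEquiv_of_eq_mul_sq (D := D') (D' := D) f' f (s := t * (w ^ (m + 1) : 𝒪[F]ˣ))
    (ht.mul (Units.isUnit _)).ne_zero (by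
      rw [Units.val_mul] at hw
      rw [hD', hD]
      linear_combination (-ϖ * u) * hw
        + (ϖ * u * ((w ^ (m + 1) : 𝒪[F]ˣ) * (w ^ (m + 1) : 𝒪[F]ˣ))) * htt)
  exact hEE' (hiso.map AlgEquiv.symm)

variable {E : Type*} [CommRing E] [Algebra F E] [TopologicalSpace E]
    [IsModuleTopology F E] [MeasurableSpace Eˣ] [BorelSpace Eˣ]
    {E' : Type*} [CommRing E'] [Algebra F E'] [TopologicalSpace E']
    [IsModuleTopology F E'] [MeasurableSpace E'ˣ] [BorelSpace E'ˣ]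

open Classical in
/-- The normalized correlation is the normalized correlation over the residue ring
`O_F / ϖ ^ m`. -/
lemma exists_gaussCorr_eq (h2 : IsUnit (2 : 𝒪[F])) (hϖ : Irreducible ϖ)
    (hq : (3 : ℝ) ≤ Nat.card 𝓀[F]) (hD : IsDisc ϖ D e)
    (hD' : IsDisc ϖ D' e) (f : Quad (algebraMap 𝒪[F] F D) ≃ₐ[F] E)
    (f' : Quad (algebraMap 𝒪[F] F D') ≃ₐ[F] E') {m : ℕ} [Fintype (Res ϖ m)] (hm : 1 ≤ m)
    (μ : MeasureTheory.Measure Eˣ) [μ.IsHaarMeasure] (μ' : MeasureTheory.Measure E'ˣ)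
    [μ'.IsHaarMeasure] {ψ : AddChar F Circle} (hψ : IsUnramified ψ)
    {θ : Eˣ →* ℂˣ} {θ' : E'ˣ →* ℂˣ} (hθ : IsParameter F θ) (hθ' : IsParameter F θ')
    (hcond : cond ϖ (restr f θ) = m) (hcond' : cond ϖ (restr f' θ') = m)
    {ρ : 𝒪[F]ˣ} (hρ : unitPart hϖ (normRadGen hϖ hD') ^ (-((e * m : ℕ) : ℤ) - e + 1)
      = unitPart hϖ (normRadGen hϖ hD) ^ (-((e * m : ℕ) : ℤ) - e + 1) * ρ) :
    ∃ (Ψ Ψ' : AddChar (Res ϖ m) ℂ) (θr : (Quad (toRes ϖ m D))ˣ →* ℂˣ)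
      (θr' : (Quad (toRes ϖ m D'))ˣ →* ℂˣ),
      (∃ t, Ψ (toRes ϖ m ϖ ^ (m - 1) * t) ≠ 1) ∧ (∃ t, Ψ' (toRes ϖ m ϖ ^ (m - 1) * t) ≠ 1) ∧
      (trConst ϖ D' e m = trConst ϖ D e m → Ψ' = Ψ) ∧
      (∀ w, θr (redUnits ϖ D m w) = restr f θ w) ∧
      (∀ w, θr' (redUnits ϖ D' m w) = restr f' θ' w) ∧
      IsLeast {j | TrivOn (toRes ϖ m ϖ) θr j} m ∧ IsLeast {j | TrivOn (toRes ϖ m ϖ) θr' j} m ∧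
      ∀ n ≤ m, gaussNorm ϖ ψ μ μ' θ θ' n ≠ 0 ∧ gaussCorr ϖ ψ μ μ' θ θ' n
        = corrOf (Nat.card 𝓀[F]) (pairSum (toRes ϖ m ϖ) (toRes ϖ m ρ)
          (trChar e (toRes ϖ m D) Ψ) (trChar e (toRes ϖ m D') Ψ') θr θr') n := by
  obtain ⟨v, hv⟩ := exists_trConst h2 hϖ hD m
  obtain ⟨v', hv'⟩ := exists_trConst h2 hϖ hD' m
  obtain ⟨Ψ, hΨ, hΨ1⟩ := exists_addChar_res hϖ hψ hm v hv
  obtain ⟨Ψ', hΨ', hΨ'1⟩ := exists_addChar_res hϖ hψ hm v' hv'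
  have hl := isLeast_cond_of_continuous hϖ f hθ.continuous hθ.trivial_on_base
  have hl' := isLeast_cond_of_continuous hϖ f' hθ'.continuous hθ'.trivial_on_base
  rw [hcond] at hl
  rw [hcond'] at hl'
  obtain ⟨θr, hθr⟩ := exists_redUnits_lift hϖ hm hl.1
  obtain ⟨θr', hθr'⟩ := exists_redUnits_lift hϖ hm hl'.1
  have hlr := isLeast_redUnits hϖ hm hθr hl le_rfl
  have hlr' := isLeast_redUnits hϖ hm hθr' hl' le_rfl
  refine ⟨Ψ, Ψ', θr, θr', hΨ1, hΨ'1, fun h => ?_, hθr, hθr', hlr, hlr', fun n hn => ?_⟩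
  · ext x
    obtain ⟨a, rfl⟩ := toRes_surjective ϖ m x
    rw [hΨ, hΨ', h]
  · obtain ⟨K, hK, hS⟩ := exists_finsum_gaussInt_eq h2 hϖ hD hD' f f' hm μ μ' hΨ hΨ'
      hθ.trivial_on_base hθ'.trivial_on_base hcond hcond' hθr hθr' hρ
    refine gaussNorm_ne_zero_and_gaussCorr_eq hϖ h2 hq ?_ hK hS hn
    have hR := isOddChainRing_res hϖ h2 hm
    have hu : ∀ {D}, IsDisc ϖ D e → e = 1 → IsUnit (toRes ϖ m D) := by
      rintro D (⟨-, hD⟩ | ⟨he2, -⟩) he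
      · exact hD.map _
      · omega
    have hnot : ∀ {D : Res ϖ m} {η : (Quad D)ˣ →* ℂˣ},
        IsLeast {j | TrivOn (toRes ϖ m ϖ) η j} m → ¬ TrivOn (toRes ϖ m ϖ) η (m - 1) :=
      fun h h1 => by have := h.2 h1; omega
    have h0 := norm_pairSum_zero (r := toRes ϖ m ρ) hR (trChar_isPrimitive hR (hu hD) hΨ1)
      (trChar_isPrimitive hR (hu hD') hΨ'1) hlr.1 (hnot hlr) hlr'.1 (hnot hlr')
    rw [← norm_ne_zero_iff, h0]
    have : 0 < Fintype.card (Res ϖ m) := Fintype.card_pos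
    positivity

/-- The square of `θ` has conductor `m`, except possibly in the split case with `m = 1`. -/
lemma not_trivOn_redUnits_mul_self (h2 : IsUnit (2 : 𝒪[F])) (hϖ : Irreducible ϖ)
    (hD : IsDisc ϖ D e) (f : Quad (algebraMap 𝒪[F] F D) ≃ₐ[F] E) {m : ℕ} (hm : 1 ≤ m)
    {θ : Eˣ →* ℂˣ} (hθ : IsParameter F θ) {θr : (Quad (toRes ϖ m D))ˣ →* ℂˣ}
    (hθr : ∀ w, θr (redUnits ϖ D m w) = restr f θ w)
    (hl : IsLeast {j | TrivOn (toRes ϖ m ϖ) θr j} m) (h : 2 ≤ m ∨ e = 2 ∨ IsField E) :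
    ¬ TrivOn (toRes ϖ m ϖ) (θr * θr) (m - 1) := by
  have hR := isOddChainRing_res hϖ h2 hm
  by_cases hD1 : toRes ϖ m ϖ ∣ toRes ϖ m D * toRes ϖ m ϖ ^ (m - 1)
  · exact not_trivOn_mul_self hR hD1 hl.1 fun h1 => by have := hl.2 h1; omega
  have hm1 : m = 1 := by
    by_contra h
    exact hD1 ((dvd_pow_self _ (by omega)).mul_left _)
  rcases hD with ⟨he, hD⟩ | ⟨he, u, hu, rfl⟩
  · have hE : IsField E := (h.resolve_left (by omega)).resolve_left (by omega)
    rw [trivOn_redUnits_iff hϖ hm (θ := restr f θ * restr f θ) (fun w => by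
      rw [MonoidHom.mul_apply, MonoidHom.mul_apply, hθr]) (by omega), hm1]
    exact not_trivOn_mul_self_of_isField h2 hϖ f hD hE hθ.trivial_on_base (hθ.ne_conj hE)
  · exact absurd ((map_dvd _ (dvd_mul_right _ _)).mul_right _) hD1

open Classical in
/-- The theorem for two characters of the same algebra. -/
lemma expectedValues_gaussCorr (h2 : IsUnit (2 : 𝒪[F])) (hϖ : Irreducible ϖ)
    (hq : (3 : ℝ) ≤ Nat.card 𝓀[F]) (hD : IsDisc ϖ D e)
    (f : Quad (algebraMap 𝒪[F] F D) ≃ₐ[F] E)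
    (f' : Quad (algebraMap 𝒪[F] F D) ≃ₐ[F] E') {m : ℕ} (hm : 1 ≤ m)
    (μ : MeasureTheory.Measure Eˣ) [μ.IsHaarMeasure] (μ' : MeasureTheory.Measure E'ˣ)
    [μ'.IsHaarMeasure] {ψ : AddChar F Circle} (hψ : IsUnramified ψ)
    {θ : Eˣ →* ℂˣ} {θ' : E'ˣ →* ℂˣ} (hθ : IsParameter F θ) (hθ' : IsParameter F θ')
    (hcond : cond ϖ (restr f θ) = m) (hcond' : cond ϖ (restr f' θ') = m) {n : ℕ} (hn : n ≤ m) :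
    gaussNorm ϖ ψ μ μ' θ θ' n ≠ 0 ∧
      ExpectedValues (Nat.card 𝓀[F]) (2 * m + e - 1) (2 * m + e - 1 - n)
        (2 * (cond ϖ (restr f θ * restr f' θ') + cond ϖ ((restr f θ)⁻¹ * restr f' θ') + e - 1))
        (IsField E) (IsField E') (gaussCorr ϖ ψ μ μ' θ θ' n) := by
  have := Fact.mk hϖ
  have := Fintype.ofFinite (Res ϖ m)
  obtain ⟨Ψ, Ψ', θr, θr', hΨ, hΨ', hΨΨ', hθr, hθr', hl, hl', h⟩ := exists_gaussCorr_eq h2 hϖ hq hD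
    hD f f' hm μ μ' hψ hθ hθ' hcond hcond' (ρ := 1) (by rw [mul_one])
  obtain rfl := hΨΨ' rfl
  refine ⟨(h n hn).1, ?_⟩
  have hR := isOddChainRing_res hϖ h2 hm
  have hE : IsField E ↔ IsField E' := ⟨fun h => (f'.symm.trans f).toMulEquiv.isField h,
    fun h => (f.symm.trans f').toMulEquiv.isField h⟩
  have hu : e = 1 → IsUnit D := by
    rcases hD with ⟨-, hD⟩ | ⟨he2, -⟩
    · exact fun _ => hD
    · omega
  have ht := (isLeast_cond_of_continuous hϖ f hθ.continuous hθ.trivial_on_base).1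
  have ht' := (isLeast_cond_of_continuous hϖ f' hθ'.continuous hθ'.trivial_on_base).1
  rw [Set.mem_ofPred_eq, hcond] at ht
  rw [Set.mem_ofPred_eq, hcond'] at ht'
  have hprod := isLeast_cond_of_trivOn (ht.mul ht')
  have hquot := isLeast_cond_of_trivOn (ht.inv.mul ht')
  rw [(h n hn).2, Units.val_one, map_one]
  refine expectedValues_pairSum hR hq ?_ ?_ ?_ hΨ hl hl'
    (isLeast_redUnits hϖ hm (fun w => ?_) hquot (hquot.2 (ht.inv.mul ht')))
    (isLeast_redUnits hϖ hm (fun w => ?_) hprod (hprod.2 (ht.mul ht'))) ?_ ?_ ?_ hn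
  · rw [← Nat.card_eq_fintype_card, card_res hϖ, Nat.cast_pow]
  · rw [← Nat.card_eq_fintype_card, card_ann_res hϖ hm, Nat.cast_pow]
  · rcases hD with ⟨he, hD⟩ | ⟨he, u, -, rfl⟩
    · exact Or.inl ⟨he, hD.map _⟩
    · exact Or.inr ⟨he, map_dvd _ (dvd_mul_right _ _)⟩
  · rw [MonoidHom.mul_apply, MonoidHom.inv_apply, hθr, hθr']
    rfl
  · rw [MonoidHom.mul_apply, hθr, hθr']
    rfl
  · intro hAB he s
    have hE1 : IsField E := hAB.elim id hE.mpr
    obtain ⟨s, rfl⟩ := toRes_surjective ϖ m s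
    rw [← map_mul, ← map_sub, toRes_dvd_iff hm]
    exact not_dvd_of_isField h2 hϖ f (hu he) hE1 s
  · intro hA _ he
    obtain ⟨s, hs, hDs⟩ := exists_sq_of_not_isField f hD hA he
    exact ⟨toRes ϖ m s, hs.map _, by rw [← map_mul, hDs]⟩
  · intro hAB
    have hE1 : IsField E := hAB.elim id hE.mpr
    exact not_trivOn_redUnits_mul_self h2 hϖ hD f hm hθ hθr hl (Or.inr (Or.inr hE1))

open Classical in
/-- The theorem for characters of two algebras that are not isomorphic. -/
lemma expectedValues_gaussCorr_of_not_iso (h2 : IsUnit (2 : 𝒪[F])) (hϖ : Irreducible ϖ)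
    (hq : (3 : ℝ) ≤ Nat.card 𝓀[F]) (hD : IsDisc ϖ D e) (hD' : IsDisc ϖ D' e)
    (f : Quad (algebraMap 𝒪[F] F D) ≃ₐ[F] E)
    (f' : Quad (algebraMap 𝒪[F] F D') ≃ₐ[F] E') (hEE' : ¬ Nonempty (E ≃ₐ[F] E'))
    {m : ℕ} (hm : 1 ≤ m)
    (μ : MeasureTheory.Measure Eˣ) [μ.IsHaarMeasure] (μ' : MeasureTheory.Measure E'ˣ)
    [μ'.IsHaarMeasure] {ψ : AddChar F Circle} (hψ : IsUnramified ψ)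
    {θ : Eˣ →* ℂˣ} {θ' : E'ˣ →* ℂˣ} (hθ : IsParameter F θ) (hθ' : IsParameter F θ')
    (hcond : cond ϖ (restr f θ) = m) (hcond' : cond ϖ (restr f' θ') = m) {n : ℕ} (hn : n ≤ m) :
    gaussNorm ϖ ψ μ μ' θ θ' n ≠ 0 ∧
      ExpectedValues (Nat.card 𝓀[F]) (2 * m + e - 1) (2 * m + e - 1 - n)
        (2 * (2 * m + e - 1)) (IsField E) (IsField E') (gaussCorr ϖ ψ μ μ' θ θ' n) := by
  have := Fact.mk hϖ
  have := Fintype.ofFinite (Res ϖ m)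
  set w : 𝒪[F]ˣ := (unitPart hϖ (normRadGen hϖ hD))⁻¹ * unitPart hϖ (normRadGen hϖ hD') with hw
  obtain ⟨Ψ, Ψ', θr, θr', hΨ, hΨ', hΨΨ', hθr, hθr', hl, hl', h⟩ := exists_gaussCorr_eq h2 hϖ hq hD
    hD' f f' hm μ μ' hψ hθ hθ' hcond hcond' (ρ := w ^ (-((e * m : ℕ) : ℤ) - e + 1))
    (by rw [← mul_zpow, hw, mul_inv_cancel_left])
  refine ⟨(h n hn).1, ?_⟩
  have hR := isOddChainRing_res hϖ h2 hm
  rw [(h n hn).2]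
  refine expectedValues_pairSum_of_not_iso hR hq ?_ hΨ hΨ' ?_ hl hl' ?_ hn
  · rw [← Nat.card_eq_fintype_card, card_res hϖ, Nat.cast_pow]
  · by_cases he : e = 1
    · have hDu : IsUnit D := hD.elim And.right (fun h => by omega)
      have hDu' : IsUnit D' := hD'.elim And.right (fun h => by omega)
      refine Or.inl ⟨he, hDu.map _, hDu'.map _, hΨΨ' ?_, ?_, fun a b hab => ?_⟩
      · rw [trConst, trConst, if_pos he, if_pos he]
      · rw [hw, (unitPart_normRadGen hϖ hD).1 he, (unitPart_normRadGen hϖ hD').1 he, inv_one,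
          one_mul, one_zpow, Units.val_one, map_one]
      · obtain ⟨a, rfl⟩ := toRes_surjective ϖ m a
        obtain ⟨b, rfl⟩ := toRes_surjective ϖ m b
        simp only [← map_mul, ← map_sub, toRes_dvd_iff hm] at hab ⊢
        exact dvd_and_dvd_of_not_iso h2 hϖ f f' hDu hDu' hEE' hab
    · have he2 : e = 2 := by rcases hD with hD | hD <;> omega
      have hDu := (unitPart_normRadGen hϖ hD).2 he2
      have hDu' := (unitPart_normRadGen hϖ hD').2 he2
      refine Or.inr ⟨he2, ?_, ?_, fun a b ha hab => ?_⟩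
      · rw [hDu]
        exact map_dvd _ (dvd_neg.mpr (dvd_mul_right _ _))
      · rw [hDu']
        exact map_dvd _ (dvd_neg.mpr (dvd_mul_right _ _))
      · obtain ⟨a, rfl⟩ := toRes_surjective ϖ m a
        obtain ⟨b, rfl⟩ := toRes_surjective ϖ m b
        simp only [← map_mul, ← map_sub, toRes_dvd_iff hm] at hab
        rw [isUnit_toRes_iff hϖ hm] at ha
        subst he2
        refine not_dvd_of_not_iso_of_ramified h2 hϖ f f' (w := w) hDu ?_ hEE' m ha hab
        rw [← Units.val_mul, hw, mul_inv_cancel_left]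
        exact hDu'
  · by_cases hme : 2 ≤ m ∨ e = 2 ∨ IsField E
    · exact Or.inl (not_trivOn_redUnits_mul_self h2 hϖ hD f hm hθ hθr hl hme)
    · push Not at hme
      have he : e = 1 := by rcases hD with hD | hD <;> omega
      refine Or.inr (not_trivOn_redUnits_mul_self h2 hϖ hD' f' hm hθ' hθr' hl' (Or.inr (Or.inr ?_)))
      by_contra hE'
      -- Two split algebras are isomorphic.
      obtain ⟨s, hs, hDs⟩ := exists_sq_of_not_isField f hD hme.2.2 he
      obtain ⟨s', hs', hDs'⟩ := exists_sq_of_not_isField f' hD' hE' he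
      obtain ⟨t, ht⟩ := hs'.exists_right_inv
      refine hEE' (nonempty_algEquiv_of_eq_mul_sq f f' (s := s * t)
        (hs.mul (isUnit_iff_exists_inv'.mpr ⟨s', ht⟩)).ne_zero ?_)
      rw [hDs, hDs']
      linear_combination (-s * s * (s' * t) - s * s) * ht

end Correlation

/-! ### Values of the correlation for quadratic étale algebras -/

section Final

variable {F : Type*} [Field F] [ValuativeRel F] [TopologicalSpace F] [IsNonarchimedeanLocalField F]

lemma isUnit_two (hp : ringChar 𝓀[F] ≠ 2) : IsUnit (2 : 𝒪[F]) := by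
  have h := Ring.two_ne_zero hp
  by_contra h2
  apply h
  have : (2 : 𝓀[F]) = IsLocalRing.residue 𝒪[F] 2 := (map_ofNat _ 2).symm
  rw [this, IsLocalRing.residue_eq_zero_iff]
  exact (IsLocalRing.mem_maximalIdeal _).mpr h2

lemma three_le_card_residueField (hp : ringChar 𝓀[F] ≠ 2) : 3 ≤ Nat.card 𝓀[F] := by
  have h := Ring.two_ne_zero hp
  have := Fintype.ofFinite 𝓀[F]
  rw [Nat.card_eq_fintype_card]
  classical
  have h1 : ({0, 1, -1} : Finset 𝓀[F]).card = 3 := by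
    rw [Finset.card_eq_three]
    refine ⟨0, 1, -1, zero_ne_one, ?_, ?_, rfl⟩
    · exact (neg_ne_zero.mpr one_ne_zero).symm
    · intro h3
      apply h
      linear_combination h3
  rw [← h1]
  exact Finset.card_le_univ _

variable {E : Type*} [CommRing E] [Algebra F E] [Algebra.Etale F E] [TopologicalSpace E]
    [IsModuleTopology F E] [MeasurableSpace Eˣ] [BorelSpace Eˣ]
    {E' : Type*} [CommRing E'] [Algebra F E'] [Algebra.Etale F E'] [TopologicalSpace E']
    [IsModuleTopology F E'] [MeasurableSpace E'ˣ] [BorelSpace E'ˣ] {ϖ : 𝒪[F]}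

/-- The values of the correlation for the presentations `E = F[δ]`, `E' = F[δ']`. If the algebras are
isomorphic, the presentations are chosen to be the same. -/
lemma gaussCorr_values (hp : ringChar 𝓀[F] ≠ 2) (hE : Module.finrank F E = 2)
    (hE' : Module.finrank F E' = 2) (hϖ : Irreducible ϖ) {ψ : AddChar F Circle}
    (hψ : IsUnramified ψ) {θ₁ : Eˣ →* ℂˣ} {θ₂ : E'ˣ →* ℂˣ} (hθ₁ : IsParameter F θ₁)
    (hθ₂ : IsParameter F θ₂) (μ : MeasureTheory.Measure Eˣ) [μ.IsHaarMeasure]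
    (μ' : MeasureTheory.Measure E'ˣ) [μ'.IsHaarMeasure] {c i : ℕ}
    (hc₁ : condExp F θ₁ = c) (hc₂ : condExp F θ₂ = c) (hc : 2 ≤ c) (hci : c ≤ 2 * i)
    (hic : i ≤ c) :
    gaussNorm ϖ ψ μ μ' θ₁ θ₂ (c - i) ≠ 0 ∧
      ExpectedValues (Nat.card 𝓀[F]) c i (pairCondExp F θ₁ θ₂) (IsField E) (IsField E')
        (gaussCorr ϖ ψ μ μ' θ₁ θ₂ (c - i)) := by
  have h2 := isUnit_two hp
  have hq : (3 : ℝ) ≤ Nat.card 𝓀[F] := by exact_mod_cast three_le_card_residueField hp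
  obtain ⟨D, e, hD, ⟨f⟩⟩ := exists_algEquiv_quad hE h2 hϖ
  have he : e = 1 ∨ e = 2 := hD.imp And.left And.left
  have hm := condExp_eq h2 hϖ hD f hθ₁.trivial_on_base
  rw [hc₁] at hm
  set m := cond ϖ (restr f θ₁) with hm_def
  rw [pairCondExp]
  split_ifs with hiso
  · -- The second algebra gets the presentation of the first one.
    set f' : Quad (algebraMap 𝒪[F] F D) ≃ₐ[F] E' := f.trans hiso.some with hf'
    have hm' := condExp_eq h2 hϖ hD f' hθ₂.trivial_on_base
    rw [hc₂] at hm'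
    set θ₂' : Eˣ →* ℂˣ := θ₂.comp (Units.map (hiso.some : E →* E')) with hθ₂'
    have hbase : ∀ a : Fˣ, θ₂' (Units.map (algebraMap F E).toMonoidHom a) = 1 := by
      intro a
      rw [← hθ₂.trivial_on_base a]
      change θ₂ _ = θ₂ _
      congr 1
      ext
      exact hiso.some.commutes a
    have hrestr : restr f θ₂' = restr f' θ₂ := rfl
    have e1 : restr f (θ₁ * θ₂') = restr f θ₁ * restr f' θ₂ := by rw [restr_mul, hrestr]
    have e2 : restr f (θ₁ * θ₂'⁻¹) = ((restr f θ₁)⁻¹ * restr f' θ₂)⁻¹ := by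
      rw [restr_mul, restr_inv, hrestr]
      exact MonoidHom.ext fun x => by simp [mul_comm]
    have e3 : cond ϖ (((restr f θ₁)⁻¹ * restr f' θ₂)⁻¹) = cond ϖ ((restr f θ₁)⁻¹ * restr f' θ₂) := by
      rw [cond, cond]
      congr 1
      ext j
      exact ⟨fun h => inv_inv ((restr f θ₁)⁻¹ * restr f' θ₂) ▸ TrivOn.inv h, TrivOn.inv⟩
    have h := expectedValues_gaussCorr h2 hϖ hq hD f f' (m := m) (by omega) μ μ' hψ hθ₁ hθ₂ rfl
      (by omega) (n := c - i) (by omega)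
    rw [condExp_eq h2 hϖ hD f (fun a => by rw [MonoidHom.mul_apply, hθ₁.trivial_on_base, hbase, mul_one]),
      condExp_eq h2 hϖ hD f (fun a => by
        rw [MonoidHom.mul_apply, hθ₁.trivial_on_base, MonoidHom.inv_apply, hbase, inv_one, mul_one]),
      e1, e2, e3]
    rw [← hm, show c - (c - i) = i by omega] at h
    convert h using 2
    omega
  · obtain ⟨D', e', hD', ⟨f'⟩⟩ := exists_algEquiv_quad hE' h2 hϖ
    have he' : e' = 1 ∨ e' = 2 := hD'.imp And.left And.left
    have hm' := condExp_eq h2 hϖ hD' f' hθ₂.trivial_on_base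
    rw [hc₂] at hm'
    -- The parity of `c` determines the ramification index.
    obtain rfl : e' = e := by omega
    have h := expectedValues_gaussCorr_of_not_iso h2 hϖ hq hD hD' f f' hiso (m := m) (by omega) μ μ'
      hψ hθ₁ hθ₂ rfl (by omega) (n := c - i) (by omega)
    rw [← hm, show c - (c - i) = i by omega] at h
    rwa [hc₁, hc₂, max_self]

end Final

end GaussRel

theorem mainTheorem7 :
    ∃ C : ℝ, ∀ (F : Type*) [Field F] [ValuativeRel F] [TopologicalSpace F]
      [IsNonarchimedeanLocalField F]
      (E : Type*) [CommRing E] [Algebra F E] [Algebra.Etale F E] [TopologicalSpace E]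
      [IsModuleTopology F E] [MeasurableSpace Eˣ] [BorelSpace Eˣ]
      (E' : Type*) [CommRing E'] [Algebra F E'] [Algebra.Etale F E'] [TopologicalSpace E']
      [IsModuleTopology F E'] [MeasurableSpace E'ˣ] [BorelSpace E'ˣ]
      (μ : MeasureTheory.Measure Eˣ) [μ.IsHaarMeasure]
      (μ' : MeasureTheory.Measure E'ˣ) [μ'.IsHaarMeasure]
      (ϖ : 𝒪[F]) (ψ : AddChar F Circle) (θ₁ : Eˣ →* ℂˣ) (θ₂ : E'ˣ →* ℂˣ) (c i R : ℕ) (q : ℝ)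
      (P : ℂ),
      ringChar 𝓀[F] ≠ 2 → Module.finrank F E = 2 → Module.finrank F E' = 2 →
      Irreducible ϖ → GaussRel.IsUnramified ψ →
      GaussRel.IsParameter F θ₁ → GaussRel.IsParameter F θ₂ →
      GaussRel.condExp F θ₁ = c → GaussRel.condExp F θ₂ = c →
      2 ≤ c → c ≤ 2 * i → i ≤ c →
      R = GaussRel.pairCondExp F θ₁ θ₂ →
      q = Nat.card 𝓀[F] →
      P = GaussRel.gaussCorr ϖ ψ μ μ' θ₁ θ₂ (c - i) →
      GaussRel.gaussNorm ϖ ψ μ μ' θ₁ θ₂ (c - i) ≠ 0 ∧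
      (2 < c →
        (R ≤ 2 * i → ¬ (2 * i = c ∧ ¬ IsField E ∧ ¬ IsField E') → P = 1) ∧
        (2 * i = R → 2 * i = c → ¬ IsField E → ¬ IsField E' → P = (q - 3) / (q - 1)) ∧
        (2 * i + 2 = R → c < 2 * i → i + 1 < c → P = -1 / (q - 1)) ∧
        (2 * i + 2 = R → c < 2 * i → i + 1 = c → P = -1 / (q - 2)) ∧
        (2 * i + 2 = R → 2 * i = c → ‖P‖ ≤ 2 / (q - 1)) ∧
        (¬ (R ≤ 2 * i ∧ ¬ (2 * i = c ∧ ¬ IsField E ∧ ¬ IsField E')) →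
          ¬ (2 * i = R ∧ 2 * i = c ∧ ¬ IsField E ∧ ¬ IsField E') →
          2 * i + 2 ≠ R → P = 0)) ∧
      (c = 2 →
        (R ≤ 2 * i → ¬ (2 * i = c ∧ ¬ IsField E ∧ ¬ IsField E') → P = 1) ∧
        (2 * i = R → 2 * i = c → ¬ IsField E → ¬ IsField E' →
          P = (q - 3) / (q - 1) - 2 / (q * (q - 1) * (q - 2))) ∧
        (R = 4 → i = 1 → ‖P‖ ≤ C / q)) := by
  -- The constant is the one in `ExpectedValues`.
  refine ⟨6, ?_⟩
  intro F _ _ _ _ E _ _ _ _ _ _ _ E' _ _ _ _ _ _ _ μ _ μ' _ ϖ ψ θ₁ θ₂ c i R q P hp hE hE' hϖ hψ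
    hθ₁ hθ₂ hc₁ hc₂ hc hci hic hR hq hP
  subst hR hq hP
  have key := GaussRel.gaussCorr_values hp hE hE' hϖ hψ hθ₁ hθ₂ μ μ' hc₁ hc₂ hc hci hic
  exact key
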